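/- Let $M$ be a connected simply laced spherical Coxeter diagram (equivalently, $M$ is of type $A_n$ $(n\ge 1)$, $D_n$ $(n\ge 4)$, or $E_n$ $(n=6,7,8)$), and write $i\sim j$ if the nodes $i,j$ are adjacent. Let $m=(l-l^{-1})/(1-x)\in\mathbb{Q}(l,x)$ and let $B$ be the BMW algebra of type $M$: the unital associative $\mathbb{Q}(l,x)$-algebra generated by $g_i,e_i$ ($i$ a node of $M$) with defining relations $$g_ig_j=g_jg_i\ (i\not\sim j),\qquad g_ig_jg_i=g_jg_ig_j\ (i\sim j),\qquad me_i=l(g_i^2+mg_i-1),\qquad g_ie_i=l^{-1}e_i,\qquad e_ig_je_i=le_i\ (i\sim j).$$ Let $a\mapsto a^{op}$ be the $\mathbb{Q}(l,x)$-linear anti-involution of $B$ that fixes every $g_i$. Let $I_1$ be the two-sided ideal of $B$ generated by all $e_i$, and $I_2\subseteq I_1$ the two-sided ideal generated by all products $e_ie_j$ with $i\neq j$ and $i\not\sim j$. Let $(W,\{r_i\})$ be the Coxeter system of type $M$, with simple roots $\alpha_i$ and set of positive roots $\Phi^+$, let $\alpha_0$ be the highest root, $C=\{j : (\alpha_j,\alpha_0)=0\}$,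 and $W_C=\langle r_j : j\in C\rangle$. For $w\in W$ let $\widehat{w}=g_{i_1}\cdots g_{i_t}\in B$, where $w=r_{i_1}\cdots r_{i_t}$ is any reduced expression. For nodes $i,j$ let $w_{ji}$ be the unique element of $W$ of minimal length with $w_{ji}r_jw_{ji}^{-1}=r_i$. For a node $i$ let $D_i\subseteq W$ be the set of the elements $w_{\beta,i}$ $(\beta\in\Phi^+)$, where $w_{\beta,i}$ is the unique element of minimal length with $w_{\beta,i}\alpha_i=\beta$, and let $Z_i$ be the (not necessarily unital) subalgebra of $B$ generated by all elements $\widehat{w_{ji}}\,g_k\,\widehat{w_{ij}}\,e_i$ with $j,k$ non-adjacent nodes of $M$ ($j=k$ is allowed). Put $$\widehat{D_i}\,Z_i\,\widehat{D_i}^{op}=\{\widehat{u}\,z\,\widehat{v}^{\,op} : u,v\in D_i,\ z\in Z_i\}.$$ Then for every node $i$ of $M$: (a) the image of $\widehat{D_i}\,Z_i\,\widehat{D_i}^{op}$ in $B/I_2$ linearly spans $I_1/I_2$ over $\mathbb{Q}(l,x)$; (b) the image of $Z_i$ in $B/I_2$ has dimension at most $|W_C|$ over $\mathbb{Q}(l,x)$.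 (c) Consequently $\dim_{\mathbb{Q}(l,x)} I_1/I_2\le |\Phi^+|^2\,|W_C|$. -/

import Mathlib

/-! ### The field of coefficients -/

/-- The field `ℚ(l, x)` of rational functions in two indeterminates, as `ℚ(x)(l)`. -/
def Qlx : Type := RatFunc (RatFunc ℚ)

namespace Qlx

noncomputable instance : Field Qlx := inferInstanceAs (Field (RatFunc (RatFunc ℚ)))

/-- The indeterminate `l`. -/
noncomputable def l : Qlx := (RatFunc.X : RatFunc (RatFunc ℚ))

/-- The indeterminate `x`. -/
noncomputable def x : Qlx := (RatFunc.C (RatFunc.X : RatFunc ℚ) : RatFunc (RatFunc ℚ))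

/-- The parameter `m = (l - l⁻¹) / (1 - x)`. -/
noncomputable def m : Qlx := (l - l⁻¹) / (1 - x)

theorem l_ne_zero : l ≠ 0 := RatFunc.X_ne_zero

theorem one_sub_x_ne_zero : 1 - x ≠ 0 := by
  intro h
  have h1 : (RatFunc.C (RatFunc.X : RatFunc ℚ) : RatFunc (RatFunc ℚ)) = RatFunc.C 1 := by
    rw [map_one]; exact (sub_eq_zero.mp h).symm
  have h2 : (RatFunc.X : RatFunc ℚ) = 1 := RatFunc.C_injective h1
  have h3 : RatFunc.intDegree (RatFunc.X : RatFunc ℚ) = RatFunc.intDegree (1 : RatFunc ℚ) := by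
    rw [h2]
  simp at h3

theorem l_mul_l_ne_one : l * l ≠ 1 := by
  intro h
  have h1 : (RatFunc.X : RatFunc (RatFunc ℚ)) * RatFunc.X = 1 := h
  have h3 := congrArg RatFunc.intDegree h1
  rw [RatFunc.intDegree_mul RatFunc.X_ne_zero RatFunc.X_ne_zero] at h3
  simp at h3

theorem m_ne_zero : m ≠ 0 := by
  refine div_ne_zero (fun h => l_mul_l_ne_one ?_) one_sub_x_ne_zero
  have h1 : l = l⁻¹ := sub_eq_zero.mp h
  calc l * l = l * l⁻¹ := by rw [← h1]
    _ = 1 := mul_inv_cancel₀ l_ne_zero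

end Qlx

/-! ### Coxeter group, root lattice and roots of a simply laced diagram

A simply laced Coxeter diagram is a simple graph `M` on its set `V` of nodes. -/

namespace Diagram

section Coxeter

variable {V : Type*} (M : SimpleGraph V)

open Classical in
/-- The Coxeter matrix of `M`: the entries off the diagonal are `3` on edges and `2` elsewhere. -/
noncomputable def coxeterMatrix : CoxeterMatrix V where
  M := fun i j => if i = j then 1 else if M.Adj i j then 3 else 2
  isSymm := by
    refine Matrix.IsSymm.ext fun i j => ?_
    simp only [@eq_comm _ j i, M.adj_comm j i]
  diagonal := fun i => by simp
  off_diagonal := fun i j h => by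
    simp only [h, if_false]
    split_ifs <;> norm_num

/-- The Coxeter group `W` of type `M`. -/
abbrev W : Type _ := (coxeterMatrix M).Group

/-- The Coxeter system `(W, R)` of type `M`. -/
noncomputable abbrev cox : CoxeterSystem (coxeterMatrix M) (W M) :=
  (coxeterMatrix M).toCoxeterSystem

/-- The diagram is spherical if its Coxeter group is finite. -/
def IsSpherical : Prop := Finite (W M)

open Classical in
/-- The inner products of the simple roots. -/
noncomputable def gram : Matrix V V ℤ :=
  fun i j => if i = j then 2 else if M.Adj i j then -1 else 0

theorem gram_symm (i j : V) : gram M i j = gram M j i := by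
  by_cases h : i = j
  · rw [h]
  · by_cases ha : M.Adj i j
    · simp [gram, h, Ne.symm h, ha, ha.symm]
    · simp [gram, h, Ne.symm h, ha, M.adj_comm j i]

end Coxeter

section Roots

variable {V : Type*} [Fintype V] (M : SimpleGraph V)

open Classical in
/-- The simple root `α i`, in the root lattice `V → ℤ` (coordinates with respect to the simple
roots). -/
noncomputable def simpleRoot (i : V) : V → ℤ := Pi.single i 1

/-- The inner product on the root lattice. -/
noncomputable def form (u v : V → ℤ) : ℤ := ∑ i, ∑ j, u i * gram M i j * v j

theorem form_simpleRoot_left (i : V) (v : V → ℤ) :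
    form M (simpleRoot i) v = ∑ j, gram M i j * v j := by
  classical
  rw [form, Finset.sum_eq_single i]
  · simp [simpleRoot]
  · intro b _ hb
    simp [simpleRoot, Pi.single_eq_of_ne hb]
  · simp

theorem form_simpleRoot_simpleRoot (i j : V) :
    form M (simpleRoot i) (simpleRoot j) = gram M i j := by
  classical
  rw [form_simpleRoot_left]
  simp [simpleRoot, Pi.single_apply]

/-- The fundamental reflection `v ↦ v - (α i, v) α i` of the root lattice. -/
noncomputable def reflection (i : V) : Module.End ℤ (V → ℤ) where
  toFun v := v - form M (simpleRoot i) v • simpleRoot i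
  map_add' u v := by
    simp only [form_simpleRoot_left, Pi.add_apply, mul_add, Finset.sum_add_distrib, add_smul]
    abel
  map_smul' c v := by
    simp only [form_simpleRoot_left, Pi.smul_apply, smul_eq_mul, RingHom.id_apply, smul_sub,
      smul_smul, Finset.mul_sum]
    congr 2
    exact Finset.sum_congr rfl fun j _ => by ring

theorem reflection_apply (i : V) (v : V → ℤ) :
    reflection M i v = v - form M (simpleRoot i) v • simpleRoot i := rfl

theorem reflection_coord (i : V) (v : V → ℤ) (k : V) :
    reflection M i v k = v k - form M (simpleRoot i) v * simpleRoot i k := rfl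

theorem form_reflection (i j : V) (v : V → ℤ) :
    form M (simpleRoot i) (reflection M j v) =
      form M (simpleRoot i) v - form M (simpleRoot j) v * gram M i j := by
  rw [reflection_apply, ← form_simpleRoot_simpleRoot M i j]
  simp only [form_simpleRoot_left M i, Pi.sub_apply, Pi.smul_apply, smul_eq_mul, mul_sub,
    Finset.sum_sub_distrib, Finset.mul_sum]
  congr 1
  exact Finset.sum_congr rfl fun k _ => by ring

theorem reflection_isLiftable : (coxeterMatrix M).IsLiftable (reflection M) := by
  classical
  have hii : ∀ i, gram M i i = 2 := fun i => by simp [gram]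
  intro i j
  by_cases hij : i = j
  · subst hij
    rw [show coxeterMatrix M i i = 1 from (coxeterMatrix M).diagonal i, pow_one]
    refine LinearMap.ext fun v => ?_
    rw [Module.End.mul_apply, reflection_apply M i (reflection M i v), form_reflection, hii,
      reflection_apply]
    ext k
    simp only [Pi.sub_apply, Pi.smul_apply, smul_eq_mul, Module.End.one_apply]
    ring
  · by_cases ha : M.Adj i j
    · rw [show coxeterMatrix M i j = 3 by simp [coxeterMatrix, hij, ha]]
      have h1 : gram M i j = -1 := by simp [gram, hij, ha]
      have h2 : gram M j i = -1 := by rw [gram_symm, h1]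
      refine LinearMap.ext fun v => ?_
      simp only [pow_succ, pow_zero, one_mul, Module.End.mul_apply, Module.End.one_apply]
      ext k
      simp only [reflection_coord, form_reflection, hii, h1, h2]
      ring
    · rw [show coxeterMatrix M i j = 2 by simp [coxeterMatrix, hij, ha]]
      have h1 : gram M i j = 0 := by simp [gram, hij, ha]
      have h2 : gram M j i = 0 := by rw [gram_symm, h1]
      refine LinearMap.ext fun v => ?_
      simp only [pow_succ, pow_zero, one_mul, Module.End.mul_apply, Module.End.one_apply]
      ext k
      simp only [reflection_coord, form_reflection, hii, h1, h2]
      ring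

/-- The reflection representation of `W` on the root lattice. -/
noncomputable def act : W M →* Module.End ℤ (V → ℤ) :=
  (cox M).lift ⟨reflection M, reflection_isLiftable M⟩

/-- The root system `Φ`: the images of the simple roots under `W`. -/
def roots : Set (V → ℤ) := {β | ∃ (w : W M) (i : V), β = act M w (simpleRoot i)}

/-- The set `Φ⁺` of positive roots. -/
def posRoots : Set (V → ℤ) := {β | β ∈ roots M ∧ 0 ≤ β}

/-- `β` is the highest root: it is coefficientwise at least every root. -/
def IsHighestRoot (β : V → ℤ) : Prop := β ∈ roots M ∧ ∀ γ ∈ roots M, γ ≤ β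

/-- The set `C` of nodes `j` with `α j` orthogonal to the highest root. -/
def nodesC : Set V := {j | ∃ β, IsHighestRoot M β ∧ form M (simpleRoot j) β = 0}

/-- The parabolic subgroup `W_X`, generated by the fundamental reflections `r j` with `j ∈ X`. -/
noncomputable def parabolic (X : Set V) : Subgroup (W M) := Subgroup.closure ((cox M).simple '' X)

/-- The set `D_i` of the elements `w ∈ W` of minimal length with `w (α i) = β`, where `β` runs over
the positive roots. -/
def D (i : V) : Set (W M) :=
  {w | act M w (simpleRoot i) ∈ posRoots M ∧
    ∀ v : W M, act M v (simpleRoot i) = act M w (simpleRoot i) →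
      (cox M).length w ≤ (cox M).length v}

end Roots

section Conjugators

variable {V : Type*} (M : SimpleGraph V)

/-- `w` is the element `w_{ji}`, of minimal length subject to `w r_j w⁻¹ = r_i`. -/
def IsConjugator (j i : V) (w : W M) : Prop :=
  w * (cox M).simple j * w⁻¹ = (cox M).simple i ∧
    ∀ v : W M, v * (cox M).simple j * v⁻¹ = (cox M).simple i →
      (cox M).length w ≤ (cox M).length v

/-- A reduced word for `w`. -/
noncomputable def reducedWord (w : W M) : List V := ((cox M).exists_isReduced w).choose

theorem reducedWord_isReduced (w : W M) : (cox M).IsReduced (reducedWord M w) :=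
  ((cox M).exists_isReduced w).choose_spec.1

theorem wordProd_reducedWord (w : W M) : (cox M).wordProd (reducedWord M w) = w :=
  ((cox M).exists_isReduced w).choose_spec.2.symm

end Conjugators

end Diagram

/-! ### The BMW algebra of type `M` -/

namespace BMW

open Diagram

section

variable {V : Type*} (M : SimpleGraph V)

/-- The symbols `g i` and `e i`, for `i` a node. -/
inductive Gen (V : Type*) : Type _
  | g : V → Gen V
  | e : V → Gen V

/-- The symbol `g i` in the free algebra. -/
noncomputable def fg (i : V) : FreeAlgebra Qlx (Gen V) := FreeAlgebra.ι Qlx (Gen.g i)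

/-- The symbol `e i` in the free algebra. -/
noncomputable def fe (i : V) : FreeAlgebra Qlx (Gen V) := FreeAlgebra.ι Qlx (Gen.e i)

/-- The defining relations of the BMW algebra. -/
inductive Rel : FreeAlgebra Qlx (Gen V) → FreeAlgebra Qlx (Gen V) → Prop
  | B1 (i j : V) (h : ¬ M.Adj i j) : Rel (fg i * fg j) (fg j * fg i)
  | B2 (i j : V) (h : M.Adj i j) : Rel (fg i * fg j * fg i) (fg j * fg i * fg j)
  | D1 (i : V) : Rel (Qlx.m • fe i) (Qlx.l • (fg i ^ 2 + Qlx.m • fg i - 1))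
  | R1 (i : V) : Rel (fg i * fe i) (Qlx.l⁻¹ • fe i)
  | R2 (i j : V) (h : M.Adj i j) : Rel (fe i * fg j * fe i) (Qlx.l • fe i)

/-- The BMW algebra `B` of type `M`. -/
def Alg : Type _ := RingQuot (Rel M)

noncomputable instance : Ring (Alg M) := inferInstanceAs (Ring (RingQuot (Rel M)))

noncomputable instance : Algebra Qlx (Alg M) := inferInstanceAs (Algebra Qlx (RingQuot (Rel M)))

/-- The quotient map from the free algebra. -/
noncomputable def proj : FreeAlgebra Qlx (Gen V) →ₐ[Qlx] Alg M := RingQuot.mkAlgHom Qlx (Rel M)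

theorem proj_rel {a b : FreeAlgebra Qlx (Gen V)} (h : Rel M a b) : proj M a = proj M b :=
  RingQuot.mkAlgHom_rel Qlx h

/-- The generator `g i` of `B`. -/
noncomputable def g (i : V) : Alg M := proj M (fg i)

/-- The generator `e i` of `B`. -/
noncomputable def e (i : V) : Alg M := proj M (fe i)

theorem e_eq (i : V) : e M i = Qlx.m⁻¹ • Qlx.l • (g M i ^ 2 + Qlx.m • g M i - 1) := by
  have h := proj_rel M (Rel.D1 i)
  simp only [map_smul, map_add, map_sub, map_pow, map_one] at h
  rw [eq_inv_smul_iff₀ Qlx.m_ne_zero]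
  exact h

theorem e_mul_g_of_commute (i j : V) (h : Commute (g M i) (g M j)) : Commute (e M i) (g M j) := by
  rw [e_eq]
  refine Commute.smul_left (Commute.smul_left ?_ _) _
  exact ((h.pow_left 2).add_left (h.smul_left _)).sub_left (Commute.one_left _)

/-- On the free algebra: the homomorphism to the opposite algebra of `B` fixing the generators. -/
noncomputable def opFree : FreeAlgebra Qlx (Gen V) →ₐ[Qlx] (Alg M)ᵐᵒᵖ :=
  FreeAlgebra.lift Qlx fun s => match s with
    | Gen.g i => MulOpposite.op (g M i)
    | Gen.e i => MulOpposite.op (e M i)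

theorem opFree_fg (i : V) : opFree M (fg i) = MulOpposite.op (g M i) := by
  simp [opFree, fg]

theorem opFree_fe (i : V) : opFree M (fe i) = MulOpposite.op (e M i) := by
  simp [opFree, fe]

theorem opFree_rel ⦃a b : FreeAlgebra Qlx (Gen V)⦄ (h : Rel M a b) : opFree M a = opFree M b := by
  have hp := proj_rel M h
  cases h with
  | B1 i j h =>
    simp only [map_mul, opFree_fg] at hp ⊢
    rw [← MulOpposite.op_mul, ← MulOpposite.op_mul]
    exact congrArg MulOpposite.op hp.symm
  | B2 i j h =>
    simp only [map_mul, opFree_fg] at hp ⊢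
    simp only [← MulOpposite.op_mul, ← mul_assoc]
    exact congrArg MulOpposite.op hp
  | D1 i =>
    simp only [map_smul, map_add, map_sub, map_pow, map_one, opFree_fg, opFree_fe] at hp ⊢
    exact congrArg MulOpposite.op hp
  | R1 i =>
    simp only [map_smul, map_mul, opFree_fg, opFree_fe] at hp ⊢
    rw [← MulOpposite.op_mul, (e_mul_g_of_commute M i i (Commute.refl _)).eq]
    exact congrArg MulOpposite.op hp
  | R2 i j h =>
    simp only [map_smul, map_mul, opFree_fg, opFree_fe] at hp ⊢
    simp only [← MulOpposite.op_mul, ← mul_assoc]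
    exact congrArg MulOpposite.op hp

/-- The anti-involution of `B` that fixes all `g i`, as a homomorphism to the opposite algebra. -/
noncomputable def opHom : Alg M →ₐ[Qlx] (Alg M)ᵐᵒᵖ :=
  RingQuot.liftAlgHom Qlx ⟨opFree M, opFree_rel M⟩

/-- The anti-involution `a ↦ a^op` of `B`. -/
noncomputable def op (a : Alg M) : Alg M := MulOpposite.unop (opHom M a)

theorem op_g (i : V) : op M (g M i) = g M i := by
  have : opHom M (g M i) = opFree M (fg i) :=
    RingQuot.liftAlgHom_mkAlgHom_apply Qlx (opFree M) (opFree_rel M) (fg i)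
  rw [op, this, opFree_fg, MulOpposite.unop_op]

theorem op_mul (a b : Alg M) : op M (a * b) = op M b * op M a := by
  rw [op, map_mul, MulOpposite.unop_mul]; rfl

/-- The element `ŵ` of `B`: the product `g i₁ ⋯ g i_t` for a reduced expression
`w = r i₁ ⋯ r i_t`. By the braid relations it does not depend on the reduced expression. -/
noncomputable def hat (w : W M) : Alg M := ((reducedWord M w).map (g M)).prod

/-- The ideal `I₁` generated by all `e i`. -/
noncomputable def idealOne : Submodule Qlx (Alg M) :=
  (TwoSidedIdeal.span (Set.range (e M))).asIdeal.restrictScalars Qlx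

/-- The ideal `I₂` generated by all `e i * e j` with `i`, `j` distinct and not adjacent. -/
noncomputable def idealTwo : Submodule Qlx (Alg M) :=
  (TwoSidedIdeal.span {b : Alg M | ∃ i j : V, i ≠ j ∧ ¬ M.Adj i j ∧ b = e M i * e M j}).asIdeal
    |>.restrictScalars Qlx

/-- Reduction modulo `I₂`. -/
noncomputable def modTwo : Alg M →ₗ[Qlx] Alg M ⧸ idealTwo M := (idealTwo M).mkQ

/-- `I₁ / I₂`, as a subspace of `B / I₂`. -/
noncomputable def oneModTwo : Submodule Qlx (Alg M ⧸ idealTwo M) := (idealOne M).map (modTwo M)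

/-- The subalgebra `Z_i` of `B`, not required to contain the identity, generated by all
`ŵ_{ji} g_k ŵ_{ij} e_i` with `j`, `k` non-adjacent, possibly equal, nodes. -/
noncomputable def Z (i : V) : NonUnitalSubalgebra Qlx (Alg M) :=
  NonUnitalAlgebra.adjoin Qlx
    {b | ∃ (j k : V) (u v : W M), ¬ M.Adj j k ∧ IsConjugator M j i u ∧ IsConjugator M i j v ∧
      b = hat M u * g M k * hat M v * e M i}

end

section

variable {V : Type*} [Fintype V] (M : SimpleGraph V)

/-- The set `D̂_i Z_i D̂_i^op`. -/
def spanningSet (i : V) : Set (Alg M) :=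
  {b | ∃ u ∈ D M i, ∃ z ∈ Z M i, ∃ v ∈ D M i, b = hat M u * z * op M (hat M v)}

end

end BMW

/-! Modulo `I₂`, the left ideal of `e_i` is spanned by the products `b_β c`, where `β` runs over the
positive roots, `b_β = ŵ_{β,i} e_i`, and `c` over a space `P` inside `e_i B e_i` spanned by the
image of a Hecke algebra of type `C`. As every `e_j` lies in `B e_i B`, the anti-involution turns
this into a spanning set of `I₁ / I₂`; the bound is that for matrices over a Hecke algebra.

Coefficients: for non-adjacent `j ≠ k`, `g_k` acts on the path element `e_j ⋯ e_i` as right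
multiplication by some `z(i,j,k)` in `e_i B e_i`. Modulo `I₂` it satisfies a Hecke quadratic
relation with unit `x⁻¹ e_i` (`Rep.z_sq`). The pair `(α_j, k)` is moved through pairs of a positive
root and an orthogonal node, carrying `z` along. The element carried depends only on the pair
(`Rep.H.unique`), elements at the same root satisfy the braid relations (`Rep.H.braidRel`), and each
`z` reaches the highest root (`Rep.H.exists_dominant`), where the orthogonal nodes are those in `C`.
Hence the span `P` of products along reduced words of `W_C` is stable under all `z`.

Left ideal: the sum of the `b_β P` is filtered by the height of `β`. One induction
(`Rep.filtration_props`) shows that `g_k` raises the height by at most one and that `e_k` maps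
everything into `e_k ⋯ e_i P`. So the sum is a left ideal containing `e_i`, and `e_i` multiplies it
into `P`. Thus `P` contains the corner at `e_i` and is the image of `Z_i` (`map_quot_Z`).

Roots: the form is positive definite by averaging and the lattice is even, so positive roots are the
nonnegative vectors of norm `2`. The length of `w_{β,i}` is the height of `β`, minus one, plus twice
the distance from `i` to the support of `β`. -/

set_option linter.unusedSectionVars false

/-! ### The root lattice and positive definiteness of its form -/

namespace Diagram

section RootLattice

variable {V : Type*}

theorem simpleRoot_self (k : V) : (simpleRoot k : V → ℤ) k = 1 := by
  simp [simpleRoot]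

theorem simpleRoot_ne {k j : V} (h : j ≠ k) : (simpleRoot k : V → ℤ) j = 0 := by
  simp [simpleRoot, h]

theorem simpleRoot_nonneg (k : V) : (0 : V → ℤ) ≤ simpleRoot k := by
  intro j
  by_cases h : j = k
  · subst h; rw [simpleRoot_self]; exact zero_le_one
  · rw [simpleRoot_ne h]; rfl

theorem simpleRoot_injective : Function.Injective (simpleRoot : V → V → ℤ) := by
  intro j k h
  by_contra hjk
  have := congrFun h j
  rw [simpleRoot_self, simpleRoot_ne hjk] at this
  exact one_ne_zero this

variable [Fintype V] (M : SimpleGraph V)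

/-- The pairing `v ↦ (α k, v)` with a simple root, as a linear form. -/
noncomputable def coroot (k : V) : (V → ℤ) →ₗ[ℤ] ℤ where
  toFun v := form M (simpleRoot k) v
  map_add' u v := by
    simp only [form_simpleRoot_left, Pi.add_apply, mul_add, Finset.sum_add_distrib]
  map_smul' c v := by
    simp only [form_simpleRoot_left, Pi.smul_apply, smul_eq_mul, RingHom.id_apply, Finset.mul_sum]
    exact Finset.sum_congr rfl fun j _ => by ring

theorem form_simpleRoot (k : V) (v : V → ℤ) : form M (simpleRoot k) v = coroot M k v := rfl

@[simp] theorem coroot_self (k : V) : coroot M k (simpleRoot k) = 2 := by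
  rw [← form_simpleRoot, form_simpleRoot_simpleRoot]; simp [gram]

theorem coroot_adj {k j : V} (h : M.Adj k j) : coroot M k (simpleRoot j) = -1 := by
  rw [← form_simpleRoot, form_simpleRoot_simpleRoot]; simp [gram, h, h.ne]

theorem coroot_not_adj {k j : V} (hne : k ≠ j) (h : ¬ M.Adj k j) :
    coroot M k (simpleRoot j) = 0 := by
  rw [← form_simpleRoot, form_simpleRoot_simpleRoot]; simp [gram, h, hne]

theorem sum_smul_simpleRoot (v : V → ℤ) : ∑ k, v k • simpleRoot k = v := by
  classical
  ext j
  rw [Finset.sum_apply, Finset.sum_eq_single j]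
  · simp [simpleRoot_self]
  · intro b _ hb; simp [simpleRoot_ne (Ne.symm hb)]
  · simp

theorem form_eq_sum (u v : V → ℤ) : form M u v = ∑ k, u k * coroot M k v := by
  rw [form]
  refine Finset.sum_congr rfl fun k _ => ?_
  rw [← form_simpleRoot, form_simpleRoot_left, Finset.mul_sum]
  exact Finset.sum_congr rfl fun j _ => by ring

theorem form_comm (u v : V → ℤ) : form M u v = form M v u := by
  rw [form, form, Finset.sum_comm]
  refine Finset.sum_congr rfl fun k _ => Finset.sum_congr rfl fun j _ => ?_
  rw [gram_symm]; ring

theorem form_add_left (u u' v : V → ℤ) : form M (u + u') v = form M u v + form M u' v := by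
  simp only [form_eq_sum, Pi.add_apply, add_mul, Finset.sum_add_distrib]

theorem form_sub_left (u u' v : V → ℤ) : form M (u - u') v = form M u v - form M u' v := by
  simp only [form_eq_sum, Pi.sub_apply, sub_mul, Finset.sum_sub_distrib]

theorem form_neg_left (u v : V → ℤ) : form M (-u) v = - form M u v := by
  simp only [form_eq_sum, Pi.neg_apply, neg_mul, Finset.sum_neg_distrib]

theorem form_smul_left (c : ℤ) (u v : V → ℤ) : form M (c • u) v = c * form M u v := by
  simp only [form_eq_sum, Pi.smul_apply, smul_eq_mul, mul_assoc, Finset.mul_sum]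

theorem form_add_right (u v v' : V → ℤ) : form M u (v + v') = form M u v + form M u v' := by
  simp only [form_comm M u, form_add_left]

theorem form_sub_right (u v v' : V → ℤ) : form M u (v - v') = form M u v - form M u v' := by
  simp only [form_comm M u, form_sub_left]

theorem form_smul_right (c : ℤ) (u v : V → ℤ) : form M u (c • v) = c * form M u v := by
  simp only [form_comm M u, form_smul_left]

theorem form_simpleRoot_right (k : V) (v : V → ℤ) : form M v (simpleRoot k) = coroot M k v := by
  rw [form_comm, form_simpleRoot]

theorem reflection_eq (k : V) (v : V → ℤ) :
    reflection M k v = v - coroot M k v • simpleRoot k := rfl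

theorem form_reflection_reflection (k : V) (u v : V → ℤ) :
    form M (reflection M k u) (reflection M k v) = form M u v := by
  simp only [reflection_eq, form_sub_left, form_sub_right, form_smul_left, form_smul_right,
    form_simpleRoot, form_simpleRoot_right, map_sub, map_smul, coroot_self, smul_eq_mul]
  ring

theorem act_simple (k : V) : act M ((cox M).simple k) = reflection M k :=
  (cox M).lift_apply_simple (reflection_isLiftable M) k

theorem act_mul_apply (w w' : W M) (v : V → ℤ) : act M (w * w') v = act M w (act M w' v) := by
  rw [map_mul]; rfl

theorem act_simple_apply (k : V) (v : V → ℤ) :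
    act M ((cox M).simple k) v = v - coroot M k v • simpleRoot k := by
  rw [act_simple, reflection_eq]

theorem act_one_apply (v : V → ℤ) : act M 1 v = v := by
  rw [map_one]; rfl

theorem act_inv_act (w : W M) (v : V → ℤ) : act M w⁻¹ (act M w v) = v := by
  rw [← act_mul_apply, inv_mul_cancel, act_one_apply]

theorem act_act_inv (w : W M) (v : V → ℤ) : act M w (act M w⁻¹ v) = v := by
  rw [← act_mul_apply, mul_inv_cancel, act_one_apply]

theorem form_act (w : W M) : ∀ u v : V → ℤ, form M (act M w u) (act M w v) = form M u v := by
  induction w using (cox M).simple_induction_left with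
  | one => intro u v; simp only [act_one_apply]
  | mul_simple_left w k ih =>
    intro u v
    rw [act_mul_apply, act_mul_apply, act_simple, form_reflection_reflection, ih]

theorem form_roots {β : V → ℤ} (h : β ∈ roots M) : form M β β = 2 := by
  obtain ⟨w, i, rfl⟩ := h
  rw [form_act, form_simpleRoot, coroot_self]

theorem act_roots (w : W M) {β : V → ℤ} (h : β ∈ roots M) : act M w β ∈ roots M := by
  obtain ⟨v, i, rfl⟩ := h
  exact ⟨w * v, i, (act_mul_apply M w v _).symm⟩

theorem neg_roots {β : V → ℤ} (h : β ∈ roots M) : -β ∈ roots M := by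
  obtain ⟨v, i, rfl⟩ := h
  refine ⟨v * (cox M).simple i, i, ?_⟩
  rw [act_mul_apply, act_simple_apply, coroot_self, ← map_neg]
  congr 1
  module

theorem simpleRoot_mem_roots (k : V) : simpleRoot k ∈ roots M :=
  ⟨1, k, (act_one_apply M _).symm⟩

/-- Reflection in an arbitrary root. -/
theorem act_conj_simple (w : W M) (i : V) (v : V → ℤ) :
    act M (w * (cox M).simple i * w⁻¹) v =
      v - form M (act M w (simpleRoot i)) v • act M w (simpleRoot i) := by
  rw [act_mul_apply, act_mul_apply, act_simple_apply, map_sub, map_smul, act_act_inv,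
    ← form_simpleRoot, ← form_act M w, act_act_inv]

theorem sub_form_smul_mem_roots {β γ : V → ℤ} (hβ : β ∈ roots M) (hγ : γ ∈ roots M) :
    γ - form M β γ • β ∈ roots M := by
  obtain ⟨w, i, rfl⟩ := hβ
  rw [← act_conj_simple]
  exact act_roots M _ hγ

theorem add_simpleRoot_mem_roots {β : V → ℤ} {k : V} (hβ : β ∈ roots M) (h : coroot M k β = -1) :
    β + simpleRoot k ∈ roots M := by
  have := sub_form_smul_mem_roots M (simpleRoot_mem_roots M k) hβ
  rwa [form_simpleRoot, h, neg_one_smul, sub_neg_eq_add] at this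

/-- The sum of the coordinate products over the `W`-translates of two vectors. -/
noncomputable def averagedForm [Fintype (W M)] : (V → ℤ) →ₗ[ℤ] (V → ℤ) →ₗ[ℤ] ℤ :=
  LinearMap.mk₂ ℤ (fun u v => ∑ w : W M, ∑ k, act M w u k * act M w v k)
    (fun u u' v => by
      simp only [map_add, Pi.add_apply, add_mul, Finset.sum_add_distrib])
    (fun c u v => by
      simp only [map_smul, Pi.smul_apply, smul_eq_mul, Finset.mul_sum, mul_assoc])
    (fun u v v' => by
      simp only [map_add, Pi.add_apply, mul_add, Finset.sum_add_distrib])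
    (fun c u v => by
      simp only [map_smul, Pi.smul_apply, smul_eq_mul, Finset.mul_sum, mul_left_comm])

theorem averagedForm_comm [Fintype (W M)] (u v : V → ℤ) :
    averagedForm M u v = averagedForm M v u := by
  simp only [averagedForm, LinearMap.mk₂_apply, mul_comm]

theorem averagedForm_act [Fintype (W M)] (w : W M) (u v : V → ℤ) :
    averagedForm M (act M w u) (act M w v) = averagedForm M u v := by
  simp only [averagedForm, LinearMap.mk₂_apply, ← act_mul_apply]
  exact Fintype.sum_equiv (Equiv.mulRight w) _ _ fun _ => rfl

theorem averagedForm_pos [Fintype (W M)] {v : V → ℤ} (hv : v ≠ 0) : 0 < averagedForm M v v := by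
  simp only [averagedForm, LinearMap.mk₂_apply]
  refine Finset.sum_pos' (fun w _ => Finset.sum_nonneg fun k _ => mul_self_nonneg _)
    ⟨1, Finset.mem_univ _, ?_⟩
  obtain ⟨k, hk⟩ := Function.ne_iff.mp hv
  rw [act_one_apply]
  exact Finset.sum_pos' (fun k _ => mul_self_nonneg _)
    ⟨k, Finset.mem_univ _, mul_self_pos.mpr hk⟩

/-- The reflection in `k` negates `simpleRoot k` and shifts `v` by a multiple of it; invariance
compares the two pairings. -/
theorem averagedForm_simpleRoot [Fintype (W M)] (k : V) (v : V → ℤ) :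
    2 * averagedForm M (simpleRoot k) v =
      averagedForm M (simpleRoot k) (simpleRoot k) * coroot M k v := by
  have h := averagedForm_act M ((cox M).simple k) (simpleRoot k) v
  simp only [act_simple_apply, coroot_self, map_sub, map_smul, LinearMap.sub_apply,
    LinearMap.smul_apply, smul_eq_mul] at h
  linarith

variable {M}

/-- The form of a connected spherical diagram is positive definite. -/
theorem form_pos (hconn : M.Connected) (hsph : IsSpherical M) {v : V → ℤ} (hv : v ≠ 0) :
    0 < form M v v := by
  have : Finite (W M) := hsph
  have := Fintype.ofFinite (W M)
  obtain ⟨i⟩ := hconn.nonempty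
  -- Symmetry of the averaged pairing of adjacent simple roots equates their averaged norms. By
  -- connectedness all these norms agree, so the averaged form is a positive multiple of `form`.
  have hadj : ∀ j k, M.Adj j k → averagedForm M (simpleRoot j) (simpleRoot j) =
      averagedForm M (simpleRoot k) (simpleRoot k) := fun j k h => by
    have h1 := averagedForm_simpleRoot M j (simpleRoot k)
    have h2 := averagedForm_simpleRoot M k (simpleRoot j)
    rw [averagedForm_comm, coroot_adj M h.symm] at h2
    rw [coroot_adj M h] at h1
    linarith
  have hconst : ∀ k, averagedForm M (simpleRoot k) (simpleRoot k) =
      averagedForm M (simpleRoot i) (simpleRoot i) := fun k => by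
    obtain ⟨p⟩ := hconn k i
    induction p with
    | nil => rfl
    | cons h _ ih => rw [hadj _ _ h, ih]
  have hi : 0 < averagedForm M (simpleRoot i) (simpleRoot i) := by
    refine averagedForm_pos M fun h => ?_
    have := congrFun h i
    rw [simpleRoot_self] at this
    exact one_ne_zero this
  have key : 2 * averagedForm M v v =
      averagedForm M (simpleRoot i) (simpleRoot i) * form M v v := by
    have : averagedForm M v v = ∑ k, v k * averagedForm M (simpleRoot k) v := by
      have h := congrArg (fun u => averagedForm M u v) (sum_smul_simpleRoot v)
      simp only [map_sum, LinearMap.sum_apply, map_smul, LinearMap.smul_apply, smul_eq_mul] at h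
      exact h.symm
    rw [this, form_eq_sum, Finset.mul_sum, Finset.mul_sum]
    refine Finset.sum_congr rfl fun k _ => ?_
    rw [mul_left_comm, averagedForm_simpleRoot, hconst]
    ring
  have := averagedForm_pos M hv
  exact pos_of_mul_pos_right (by linarith) hi.le

end RootLattice

end Diagram

/-! ### Positive roots as nonnegative vectors of norm two -/

namespace Diagram

section PositiveRoots

variable {V : Type*} [Fintype V] {M : SimpleGraph V}

variable (M) in
/-- The form of the diagram is positive definite. -/
def FormPos : Prop := ∀ v : V → ℤ, v ≠ 0 → 0 < form M v v

variable (M) in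
-- Simple roots have norm `2` and every cross term occurs twice. Evenness improves positivity to a
-- lower bound of `2` on norms.
theorem even_form (v : V → ℤ) : Even (form M v v) := by
  rw [← sum_smul_simpleRoot v]
  refine Finset.sum_induction _ (fun v => Even (form M v v)) (fun u v hu hv => ?_) ?_ fun k _ => ?_
  · rw [form_add_left, form_add_right, form_add_right, form_comm M v u]
    obtain ⟨a, ha⟩ := hu
    obtain ⟨b, hb⟩ := hv
    exact ⟨a + b + form M u v, by rw [ha, hb]; ring⟩
  · simp [form_eq_sum]
  · rw [form_smul_left, form_smul_right, form_simpleRoot, coroot_self]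
    exact ⟨v k * v k, by ring⟩

theorem two_le_form (hM : FormPos M) {v : V → ℤ} (hv : v ≠ 0) : 2 ≤ form M v v := by
  obtain ⟨a, ha⟩ := even_form M v
  have := hM v hv
  omega

theorem gram_nonpos {i j : V} (h : i ≠ j) : gram M i j ≤ 0 := by
  unfold gram
  rw [if_neg h]
  split_ifs <;> norm_num

/-- A vector of norm `2` has all its coordinates of the same sign. -/
theorem nonneg_or_nonpos (hM : FormPos M) {v : V → ℤ} (hv : form M v v = 2) : 0 ≤ v ∨ v ≤ 0 := by
  by_contra! h
  -- If both parts are nonzero, each has norm at least `2`, and their pairing is nonpositive because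
  -- the supports are disjoint; then `v` would have norm at least `4`.
  have hp : v⁻ ≠ 0 := fun h' => h.1 (negPart_eq_zero.mp h')
  have hn : v⁺ ≠ 0 := fun h' => h.2 (posPart_eq_zero.mp h')
  have h1 := two_le_form hM hp
  have h2 := two_le_form hM hn
  have h3 : form M v⁺ v⁻ ≤ 0 := by
    refine Finset.sum_nonpos fun i _ => Finset.sum_nonpos fun j _ => ?_
    have hi : 0 ≤ v⁺ i := posPart_nonneg v i
    have hj : 0 ≤ v⁻ j := negPart_nonneg v j
    by_cases hij : i = j
    · subst hij
      have : v⁺ i * v⁻ i = 0 := by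
        rw [Pi.posPart_apply, Pi.negPart_apply, posPart_def, negPart_def]
        rcases le_total 0 (v i) with h | h
        · rw [sup_of_le_right (show -v i ≤ 0 by omega), mul_zero]
        · rw [sup_of_le_right h, zero_mul]
      rw [mul_right_comm, this, zero_mul]
    · have := gram_nonpos (M := M) hij
      rw [mul_right_comm]
      exact mul_nonpos_of_nonneg_of_nonpos (mul_nonneg hi hj) this
  have h4 : form M v v = form M v⁺ v⁺ + form M v⁻ v⁻ - 2 * form M v⁺ v⁻ := by
    conv_lhs => rw [← posPart_sub_negPart v]
    rw [form_sub_left, form_sub_right, form_sub_right, form_comm M v⁻ v⁺]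
    ring
  omega

variable (M) in
/-- Nonnegative vectors of norm `2`; these are the positive roots. -/
structure IsPosRoot (β : V → ℤ) : Prop where
  nonneg : 0 ≤ β
  form_self : form M β β = 2

theorem isPosRoot_simpleRoot (k : V) : IsPosRoot M (simpleRoot k) :=
  ⟨simpleRoot_nonneg k, by rw [form_simpleRoot, coroot_self]⟩

theorem IsPosRoot.ne_zero {β : V → ℤ} (h : IsPosRoot M β) : β ≠ 0 := by
  rintro rfl
  have := h.form_self
  simp [form_eq_sum] at this

theorem IsPosRoot.form_add {β : V → ℤ} (h : IsPosRoot M β) (k : V) :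
    form M (β + simpleRoot k) (β + simpleRoot k) = 4 + 2 * coroot M k β := by
  rw [form_add_left, form_add_right, form_add_right, h.form_self, form_simpleRoot,
    form_simpleRoot_right, form_simpleRoot, coroot_self]
  ring

theorem IsPosRoot.form_sub {β : V → ℤ} (h : IsPosRoot M β) (k : V) :
    form M (β - simpleRoot k) (β - simpleRoot k) = 4 - 2 * coroot M k β := by
  rw [form_sub_left, form_sub_right, form_sub_right, h.form_self, form_simpleRoot,
    form_simpleRoot_right, form_simpleRoot, coroot_self]
  ring

theorem IsPosRoot.add {β : V → ℤ} (h : IsPosRoot M β) {k : V} (hk : coroot M k β = -1) :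
    IsPosRoot M (β + simpleRoot k) :=
  ⟨add_nonneg h.nonneg (simpleRoot_nonneg k), by rw [h.form_add, hk]; norm_num⟩

theorem eq_smul_simpleRoot {v : V → ℤ} {k : V} (h : ∀ j, j ≠ k → v j = 0) :
    v = v k • simpleRoot k := by
  ext j
  by_cases hj : j = k
  · subst hj; simp [simpleRoot_self]
  · simp [simpleRoot_ne hj, h j hj]

theorem IsPosRoot.eq_simpleRoot {β : V → ℤ} (h : IsPosRoot M β) {k : V} (hk : β ≤ simpleRoot k) :
    β = simpleRoot k := by
  have h0 : ∀ j, j ≠ k → β j = 0 := fun j hj => by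
    have h1 := h.nonneg j
    have h2 := hk j
    rw [simpleRoot_ne hj] at h2
    exact le_antisymm h2 h1
  have h1 := eq_smul_simpleRoot h0
  have h2 : β k ≤ (simpleRoot k : V → ℤ) k := hk k
  have h3 : 0 ≤ β k := h.nonneg k
  rw [simpleRoot_self] at h2
  have h4 : β k ≠ 0 := fun h4 => h.ne_zero (by rw [h1, h4, zero_smul])
  rw [h1, show β k = 1 by omega, one_smul]

/-- The difference still has norm `2`, hence a sign. Were it nonpositive, `β` would be `simpleRoot
k`, whose pairing with itself is `2`. -/
theorem IsPosRoot.sub (hM : FormPos M) {β : V → ℤ} (h : IsPosRoot M β) {k : V}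
    (hk : coroot M k β = 1) : IsPosRoot M (β - simpleRoot k) := by
  have h2 : form M (β - simpleRoot k) (β - simpleRoot k) = 2 := by rw [h.form_sub, hk]; norm_num
  refine ⟨(nonneg_or_nonpos hM h2).resolve_right fun h3 => ?_, h2⟩
  have := h.eq_simpleRoot (sub_nonpos.mp h3)
  rw [this, coroot_self] at hk
  norm_num at hk

theorem IsPosRoot.coroot_le_one (hM : FormPos M) {β : V → ℤ} (h : IsPosRoot M β) {k : V}
    (hk : β ≠ simpleRoot k) : coroot M k β ≤ 1 := by
  have := hM _ (sub_ne_zero.mpr hk)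
  rw [h.form_sub] at this
  omega

theorem IsPosRoot.neg_one_le_coroot (hM : FormPos M) {β : V → ℤ} (h : IsPosRoot M β) (k : V) :
    -1 ≤ coroot M k β := by
  have := hM (β + simpleRoot k) fun h' => by
    have h1 := congrFun h' k
    have h2 : 0 ≤ β k := h.nonneg k
    rw [Pi.add_apply, simpleRoot_self, Pi.zero_apply] at h1
    omega
  rw [h.form_add] at this
  omega

theorem IsPosRoot.eq_of_two_le (hM : FormPos M) {β : V → ℤ} (h : IsPosRoot M β) {k : V}
    (hk : 2 ≤ coroot M k β) : β = simpleRoot k := by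
  by_contra hne
  have := h.coroot_le_one hM hne
  omega

theorem IsPosRoot.coroot_cases (hM : FormPos M) {β : V → ℤ} (h : IsPosRoot M β) (k : V) :
    coroot M k β = -1 ∨ coroot M k β = 0 ∨ coroot M k β = 1 ∨ β = simpleRoot k := by
  by_cases hk : β = simpleRoot k
  · exact Or.inr (Or.inr (Or.inr hk))
  · have h1 := h.coroot_le_one hM hk
    have h2 := h.neg_one_le_coroot hM k
    omega

/-- Any node of the support of a positive root survives a suitable step down. -/
theorem IsPosRoot.exists_descent (hM : FormPos M) {β : V → ℤ} (h : IsPosRoot M β) {j : V}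
    (hj : β j ≠ 0) (hne : β ≠ simpleRoot j) :
    ∃ k, coroot M k β = 1 ∧ (β - simpleRoot k) j ≠ 0 := by
  classical
  have hsum := h.form_self
  rw [form_eq_sum, ← Finset.add_sum_erase _ _ (Finset.mem_univ j)] at hsum
  have hjpos : 0 ≤ β j := h.nonneg j
  have hj1 := h.coroot_le_one hM hne
  -- By `2 = ∑ k, β k * coroot M k β` some node of the support pairs positively with `β`. One other
  -- than `j` leaves the coordinate at `j` alone; if there is only `j`, then `β j ≥ 2` and one unit
  -- can be spared.
  by_cases hk : ∃ k, k ≠ j ∧ 0 < coroot M k β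
  · obtain ⟨k, hkj, hk⟩ := hk
    by_cases hβ : β = simpleRoot k
    · rw [hβ, simpleRoot_ne hkj.symm] at hj
      exact absurd rfl hj
    · have := h.coroot_le_one hM hβ
      refine ⟨k, by omega, ?_⟩
      rwa [Pi.sub_apply, simpleRoot_ne hkj.symm, sub_zero]
  · push Not at hk
    have h0 : ∑ k ∈ Finset.univ.erase j, β k * coroot M k β ≤ 0 :=
      Finset.sum_nonpos fun k hk' =>
        mul_nonpos_of_nonneg_of_nonpos (h.nonneg k) (hk k (Finset.ne_of_mem_erase hk'))
    have h1 : 2 ≤ β j * coroot M j β := by linarith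
    have h2 : coroot M j β = 1 := by
      by_contra h2
      have : coroot M j β ≤ 0 := by omega
      nlinarith
    refine ⟨j, h2, ?_⟩
    rw [h2, mul_one] at h1
    rw [Pi.sub_apply, simpleRoot_self]
    omega

/-- The sum of the absolute values of the coordinates; the height on positive roots. -/
def height (v : V → ℤ) : ℕ := ∑ k, (v k).natAbs

theorem height_add_simpleRoot {v : V → ℤ} (hv : 0 ≤ v) (k : V) :
    height (v + simpleRoot k) = height v + 1 := by
  classical
  unfold height
  rw [← Finset.add_sum_erase _ _ (Finset.mem_univ k),
    ← Finset.add_sum_erase _ (fun k => (v k).natAbs) (Finset.mem_univ k)]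
  have h1 : ∑ x ∈ Finset.univ.erase k, ((v + simpleRoot k) x).natAbs =
      ∑ x ∈ Finset.univ.erase k, (v x).natAbs :=
    Finset.sum_congr rfl fun j hj => by
      rw [Pi.add_apply, simpleRoot_ne (Finset.ne_of_mem_erase hj), add_zero]
  have h2 : 0 ≤ v k := hv k
  rw [h1, Pi.add_apply, simpleRoot_self]
  omega

theorem height_simpleRoot (k : V) : height (simpleRoot k : V → ℤ) = 1 := by
  have := height_add_simpleRoot (le_refl (0 : V → ℤ)) k
  rw [zero_add] at this
  rw [this]
  simp [height]

theorem IsPosRoot.height_sub (hM : FormPos M) {β : V → ℤ} (h : IsPosRoot M β) {k : V}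
    (hk : coroot M k β = 1) : height β = height (β - simpleRoot k) + 1 := by
  rw [← height_add_simpleRoot (h.sub hM hk).nonneg k, sub_add_cancel]

theorem IsPosRoot.height_pos {β : V → ℤ} (h : IsPosRoot M β) : 0 < height β := by
  by_contra h0
  refine h.ne_zero (funext fun k => ?_)
  have : height β = 0 := by omega
  exact Int.natAbs_eq_zero.mp ((Finset.sum_eq_zero_iff.mp this) k (Finset.mem_univ k))

theorem IsPosRoot.exists_support {β : V → ℤ} (h : IsPosRoot M β) : ∃ j, β j ≠ 0 :=
  Function.ne_iff.mp h.ne_zero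

theorem IsPosRoot.mem_roots (hM : FormPos M) : ∀ {β : V → ℤ}, IsPosRoot M β → β ∈ roots M := by
  suffices ∀ n (β : V → ℤ), height β = n → IsPosRoot M β → β ∈ roots M from
    fun {β} h => this _ β rfl h
  intro n
  induction n with
  | zero => intro β hn h; exact absurd hn h.height_pos.ne'
  | succ n ih =>
    intro β hn h
    obtain ⟨j, hj⟩ := h.exists_support
    by_cases hβ : β = simpleRoot j
    · rw [hβ]; exact simpleRoot_mem_roots M j
    · obtain ⟨k, hk, -⟩ := h.exists_descent hM hj hβ
      have h1 := ih (β - simpleRoot k) (by have := h.height_sub hM hk; omega) (h.sub hM hk)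
      have h2 := add_simpleRoot_mem_roots M h1 (k := k)
        (by rw [map_sub, hk, coroot_self]; norm_num)
      rwa [sub_add_cancel] at h2

theorem mem_posRoots_iff (hM : FormPos M) {β : V → ℤ} : β ∈ posRoots M ↔ IsPosRoot M β :=
  ⟨fun h => ⟨h.2, form_roots M h.1⟩, fun h => ⟨h.mem_roots hM, h.nonneg⟩⟩

theorem isPosRoot_or_neg (hM : FormPos M) {β : V → ℤ} (h : β ∈ roots M) :
    IsPosRoot M β ∨ IsPosRoot M (-β) := by
  refine (nonneg_or_nonpos hM (form_roots M h)).imp (fun h' => ⟨h', form_roots M h⟩) fun h' =>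
    ⟨neg_nonneg.mpr h', form_roots M (neg_roots M h)⟩

theorem finite_roots (hsph : IsSpherical M) : (roots M).Finite := by
  have : Finite (W M) := hsph
  refine (Set.finite_range fun x : W M × V => act M x.1 (simpleRoot x.2)).subset ?_
  rintro _ ⟨w, i, rfl⟩
  exact ⟨(w, i), rfl⟩

/-- A positive root is dominant if no step up from it is possible. -/
def IsDominant (M : SimpleGraph V) (β : V → ℤ) : Prop := IsPosRoot M β ∧ ∀ k, 0 ≤ coroot M k β

theorem exists_dominant_ge (hM : FormPos M) (hsph : IsSpherical M) {β : V → ℤ}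
    (h : IsPosRoot M β) : ∃ γ, β ≤ γ ∧ IsDominant M γ := by
  have hfin : {γ | IsPosRoot M γ ∧ β ≤ γ}.Finite :=
    (finite_roots hsph).subset fun γ hγ => hγ.1.mem_roots hM
  obtain ⟨γ, hγ, hmax⟩ := hfin.exists_maximal ⟨β, h, le_rfl⟩
  refine ⟨γ, hγ.2, hγ.1, fun k => ?_⟩
  by_contra hk
  have hk' : coroot M k γ = -1 := by
    have := hγ.1.neg_one_le_coroot hM k
    omega
  have hle : γ ≤ γ + simpleRoot k := le_add_of_nonneg_right (simpleRoot_nonneg k)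
  have : (γ + simpleRoot k) k ≤ γ k := hmax ⟨hγ.1.add hk', hγ.2.trans hle⟩ hle k
  rw [Pi.add_apply, simpleRoot_self] at this
  omega

/-- A node outside the support but next to it would pair negatively with `β`, so the support is
closed under adjacency. -/
theorem IsDominant.coord_pos (hconn : M.Connected) {β : V → ℤ} (h : IsDominant M β) (k : V) :
    0 < β k := by
  obtain ⟨j, hj⟩ := h.1.exists_support
  have hadj : ∀ a b, M.Adj a b → β a ≠ 0 → β b ≠ 0 := fun a b hab ha hb => by
    have h1 := h.2 b
    rw [← form_simpleRoot, form_simpleRoot_left] at h1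
    have h2 : ∑ c, gram M b c * β c < 0 := by
      refine Finset.sum_neg' (fun c _ => ?_) ⟨a, Finset.mem_univ a, ?_⟩
      · by_cases hc : b = c
        · subst hc; rw [hb, mul_zero]
        · exact mul_nonpos_of_nonpos_of_nonneg (gram_nonpos hc) (h.1.nonneg c)
      · have : 0 ≤ β a := h.1.nonneg a
        have : gram M b a = -1 := by simp [gram, hab.symm, hab.ne']
        rw [this]
        omega
    omega
  have : β k ≠ 0 := by
    obtain ⟨p⟩ := hconn j k
    induction p with
    | nil => exact hj
    | cons hab _ ih => exact ih (hadj _ _ hab hj)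
  have h0 : 0 ≤ β k := h.1.nonneg k
  omega

theorem IsDominant.form_nonneg {β v : V → ℤ} (h : IsDominant M β) (hv : 0 ≤ v) :
    0 ≤ form M v β := by
  rw [form_eq_sum]
  exact Finset.sum_nonneg fun k _ => mul_nonneg (hv k) (h.2 k)

/-- Full support makes the pairing of two dominant roots positive. If they differ, the norm `4 - 2
(γ, β)` of the difference is at least `2`, so the pairing is `1` and the difference has a sign.
Pairing the difference or its negative, whichever is nonnegative, with `γ` or `β` gives `-1`,
against dominance. -/
theorem IsDominant.unique (hM : FormPos M) (hconn : M.Connected) {β γ : V → ℤ}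
    (hβ : IsDominant M β) (hγ : IsDominant M γ) : β = γ := by
  by_contra hne
  have hpos : 0 < form M γ β := by
    rw [form_eq_sum]
    refine Finset.sum_pos' (fun k _ => mul_nonneg (hγ.1.nonneg k) (hβ.2 k)) ?_
    by_contra! hk
    have h2 := hβ.1.form_self
    rw [form_eq_sum, Finset.sum_eq_zero] at h2
    · norm_num at h2
    · intro k _
      have h3 := hk k (Finset.mem_univ k)
      have h4 := hγ.coord_pos hconn k
      have h5 := hβ.2 k
      have h6 : coroot M k β = 0 := by nlinarith
      rw [h6, mul_zero]
  have h1 := two_le_form hM (sub_ne_zero.mpr hne)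
  rw [form_sub_left, form_sub_right, form_sub_right, hβ.1.form_self, hγ.1.form_self,
    form_comm M β γ] at h1
  have h1' : form M γ β = 1 := by omega
  have h2 : form M (β - γ) (β - γ) = 2 := by
    rw [form_sub_left, form_sub_right, form_sub_right, hβ.1.form_self, hγ.1.form_self,
      form_comm M β γ, h1']
    norm_num
  rcases nonneg_or_nonpos hM h2 with h3 | h3
  · have := hγ.form_nonneg h3
    rw [form_sub_left, hγ.1.form_self, form_comm M β γ] at this
    omega
  · have := hβ.form_nonneg (neg_nonneg.mpr h3)
    rw [form_neg_left, form_sub_left, hβ.1.form_self] at this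
    omega

theorem IsDominant.isHighestRoot (hM : FormPos M) (hconn : M.Connected) (hsph : IsSpherical M)
    {β : V → ℤ} (hβ : IsDominant M β) : IsHighestRoot M β := by
  refine ⟨hβ.1.mem_roots hM, fun γ hγ => ?_⟩
  rcases isPosRoot_or_neg hM hγ with h | h
  · obtain ⟨δ, h1, h2⟩ := exists_dominant_ge hM hsph h
    rwa [hβ.unique hM hconn h2]
  · exact (neg_nonneg.mp h.nonneg).trans hβ.1.nonneg

theorem IsDominant.mem_nodesC_iff (hM : FormPos M) (hconn : M.Connected) (hsph : IsSpherical M)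
    {β : V → ℤ} (hβ : IsDominant M β) {k : V} : k ∈ nodesC M ↔ coroot M k β = 0 := by
  have h := hβ.isHighestRoot hM hconn hsph
  refine ⟨?_, fun hk => ⟨β, h, hk⟩⟩
  rintro ⟨γ, hγ, hk⟩
  rwa [le_antisymm (h.2 γ hγ.1) (hγ.2 β h.1)] at hk

/-- A connected diagram with positive definite form is a tree. -/
theorem isTree (hM : FormPos M) (hconn : M.Connected) : M.IsTree := by
  classical
  rw [SimpleGraph.isTree_iff_connected_and_card]
  refine ⟨hconn, le_antisymm ?_ hconn.card_vert_le_card_edgeSet_add_one⟩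
  -- The all-one vector has norm `2 |V| - 2 |E|`; its positivity leaves no room for more edges than
  -- a tree has.
  have hne : (fun _ => 1 : V → ℤ) ≠ 0 := fun h => by
    obtain ⟨i⟩ := hconn.nonempty
    exact one_ne_zero (congrFun h i)
  have h1 := hM _ hne
  have h2 : ∀ k, ∑ j, gram M k j = 2 - M.degree k := fun k => by
    have : ∀ j, gram M k j = (if k = j then 2 else 0) + (if M.Adj k j then -1 else 0) := by
      intro j
      unfold gram
      by_cases h : k = j
      · subst h; simp
      · simp [h]
    simp only [this, Finset.sum_add_distrib, Finset.sum_ite_eq, Finset.mem_univ, if_true]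
    rw [← Finset.sum_filter, Finset.sum_const, ← M.card_neighborFinset_eq_degree,
      SimpleGraph.neighborFinset_eq_filter]
    simp; ring
  have h3 : form M (fun _ => 1 : V → ℤ) (fun _ => 1) = 2 * Fintype.card V - 2 * M.edgeFinset.card := by
    simp only [form, one_mul, mul_one, h2, Finset.sum_sub_distrib, Finset.sum_const]
    have := M.sum_degrees_eq_twice_card_edges
    rw [← Nat.cast_sum, this]
    simp; ring
  rw [h3] at h1
  rw [Nat.card_eq_fintype_card, Nat.card_eq_fintype_card, ← SimpleGraph.edgeFinset_card]
  omega

end PositiveRoots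

end Diagram

/-! ### Descents in the Coxeter group and Matsumoto's theorem -/

namespace Diagram

section CoxeterWords

variable {V : Type*} (M : SimpleGraph V)

theorem simple_commute {i j : V} (h : ¬ M.Adj i j) :
    (cox M).simple i * (cox M).simple j = (cox M).simple j * (cox M).simple i := by
  by_cases hij : i = j
  · rw [hij]
  · have h1 := (cox M).simple_mul_simple_pow i j
    rw [show coxeterMatrix M i j = 2 by simp [coxeterMatrix, hij, h], pow_two] at h1
    have h2 := mul_eq_one_iff_eq_inv.mp h1
    rw [h2, mul_inv_rev, CoxeterSystem.inv_simple, CoxeterSystem.inv_simple]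

theorem simple_braid {i j : V} (h : M.Adj i j) :
    (cox M).simple i * ((cox M).simple j * (cox M).simple i) =
      (cox M).simple j * ((cox M).simple i * (cox M).simple j) := by
  have h1 := (cox M).simple_mul_simple_pow i j
  rw [show coxeterMatrix M i j = 3 by simp [coxeterMatrix, h, h.ne], pow_succ, pow_two] at h1
  have h2 : ((cox M).simple i * ((cox M).simple j * (cox M).simple i)) *
      ((cox M).simple j * ((cox M).simple i * (cox M).simple j)) = 1 := by
    rw [← h1]; simp only [mul_assoc]
  have h3 := mul_eq_one_iff_eq_inv.mp h2
  rw [h3]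
  simp only [mul_inv_rev, CoxeterSystem.inv_simple, mul_assoc]

variable [Fintype V]

/-- An element sends a simple root to a nonnegative vector if it gets longer by right
multiplication with the corresponding reflection. -/
theorem act_simpleRoot_nonneg : ∀ (n : ℕ) (w : W M) (i : V), (cox M).length w = n →
    (cox M).length w < (cox M).length (w * (cox M).simple i) → 0 ≤ act M w (simpleRoot i) := by
  intro n
  induction n using Nat.strong_induction_on with
  | _ n ih =>
  intro w i hn hi
  by_cases hw : w = 1
  · subst hw; rw [act_one_apply]; exact simpleRoot_nonneg i
  obtain ⟨j, hj⟩ := (cox M).exists_rightDescent_of_ne_one hw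
  obtain ⟨v, rfl⟩ : ∃ v, w = v * (cox M).simple j :=
    ⟨w * (cox M).simple j, by rw [CoxeterSystem.simple_mul_simple_cancel_right]⟩
  have hij : i ≠ j := by rintro rfl; exact absurd hj (not_lt_of_gt hi)
  rw [CoxeterSystem.IsRightDescent, CoxeterSystem.simple_mul_simple_cancel_right] at hj
  by_cases hadj : M.Adj j i
  · have hvj : 0 ≤ act M v (simpleRoot j) := ih _ (hn ▸ hj) v j rfl hj
    have e1 : act M (v * (cox M).simple j) (simpleRoot i) =
        act M v (simpleRoot i) + act M v (simpleRoot j) := by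
      rw [act_mul_apply, act_simple_apply, coroot_adj M hadj, ← map_add]
      congr 1
      module
    -- The image is `v α_i + v α_j`. If `i` lengthens `v`, both terms are nonnegative by induction.
    -- Otherwise `v = u r_i`, the sum collapses to `u α_j`, and the braid relation shows that `j`
    -- lengthens `u`.
    rcases (cox M).length_mul_simple v i with h | h
    · rw [e1]
      exact add_nonneg (ih _ (hn ▸ hj) v i rfl (by omega)) hvj
    · obtain ⟨u, rfl⟩ : ∃ u, v = u * (cox M).simple i :=
        ⟨v * (cox M).simple i, by rw [CoxeterSystem.simple_mul_simple_cancel_right]⟩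
      rw [CoxeterSystem.simple_mul_simple_cancel_right] at h
      have e2 : act M (u * (cox M).simple i * (cox M).simple j) (simpleRoot i) =
          act M u (simpleRoot j) := by
        rw [e1, ← map_add, act_mul_apply, act_simple_apply, map_add, coroot_self,
          coroot_adj M hadj.symm]
        congr 1
        module
      rw [e2]
      refine ih _ (by omega) u j rfl ?_
      by_contra hlt
      have h1 : u * (cox M).simple i * (cox M).simple j * (cox M).simple i =
          u * (cox M).simple j * ((cox M).simple i * (cox M).simple j) := by
        simp only [mul_assoc]
        rw [simple_braid M hadj]
      have h2 := (cox M).length_mul_le (u * (cox M).simple j) ((cox M).simple i * (cox M).simple j)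
      have h3 := (cox M).length_mul_le ((cox M).simple i) ((cox M).simple j)
      rw [CoxeterSystem.length_simple, CoxeterSystem.length_simple] at h3
      rw [← h1] at h2
      rcases (cox M).length_mul_simple u j with h4 | h4 <;> omega
  · have e1 : act M (v * (cox M).simple j) (simpleRoot i) = act M v (simpleRoot i) := by
      rw [act_mul_apply, act_simple_apply, coroot_not_adj M hij.symm hadj, zero_smul, sub_zero]
    rw [e1]
    refine ih _ (hn ▸ hj) v i rfl ?_
    by_contra hlt
    have h2 := (cox M).length_mul_le (v * (cox M).simple i) ((cox M).simple j)
    rw [mul_assoc, ← simple_commute M hadj, ← mul_assoc, CoxeterSystem.length_simple] at h2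
    rcases (cox M).length_mul_simple v i with h4 | h4 <;> omega

theorem act_simpleRoot_nonpos {w : W M} {i : V} (h : (cox M).IsRightDescent w i) :
    act M w (simpleRoot i) ≤ 0 := by
  have h1 := act_simpleRoot_nonneg M _ (w * (cox M).simple i) i rfl
    (by rwa [CoxeterSystem.simple_mul_simple_cancel_right])
  rw [act_mul_apply, act_simple_apply, coroot_self,
    show simpleRoot i - (2 : ℤ) • simpleRoot i = -(simpleRoot i : V → ℤ) by module, map_neg] at h1
  exact neg_nonneg.mp h1

theorem act_simpleRoot_ne_zero (w : W M) (i : V) : act M w (simpleRoot i) ≠ 0 := by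
  intro h
  have := form_roots M ⟨w, i, rfl⟩
  rw [h] at this
  simp [form_eq_sum] at this

/-- Images of simple roots are nonzero, so signs detect descents. The statements on descents that
follow become computations in rank two. -/
theorem isRightDescent_of_nonpos {w : W M} {i : V} (h : act M w (simpleRoot i) ≤ 0) :
    (cox M).IsRightDescent w i := by
  by_contra hd
  rw [CoxeterSystem.not_isRightDescent_iff] at hd
  exact act_simpleRoot_ne_zero M w i
    (le_antisymm h (act_simpleRoot_nonneg M _ w i rfl (by omega)))

theorem isRightDescent_mul_of_not_adj {w : W M} {i j : V} (hij : i ≠ j) (h : ¬ M.Adj i j)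
    (hi : (cox M).IsRightDescent w i) : (cox M).IsRightDescent (w * (cox M).simple j) i := by
  apply isRightDescent_of_nonpos
  rw [act_mul_apply, act_simple_apply, coroot_not_adj M hij.symm fun h' => h h'.symm, zero_smul,
    sub_zero]
  exact act_simpleRoot_nonpos M hi

theorem isRightDescent_mul_of_adj {w : W M} {i j : V} (h : M.Adj i j)
    (hi : (cox M).IsRightDescent w i) (hj : (cox M).IsRightDescent w j) :
    (cox M).IsRightDescent (w * (cox M).simple j) i := by
  apply isRightDescent_of_nonpos
  rw [act_mul_apply, act_simple_apply, coroot_adj M h.symm, neg_one_smul, sub_neg_eq_add, map_add]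
  exact add_nonpos (act_simpleRoot_nonpos M hi) (act_simpleRoot_nonpos M hj)

theorem isRightDescent_mul_mul_of_adj {w : W M} {i j : V} (h : M.Adj i j)
    (hi : (cox M).IsRightDescent w i) :
    (cox M).IsRightDescent (w * (cox M).simple j * (cox M).simple i) j := by
  apply isRightDescent_of_nonpos
  rw [act_mul_apply, act_mul_apply, act_simple_apply M i, coroot_adj M h, act_simple_apply,
    map_sub (coroot M j), map_smul, coroot_self, coroot_adj M h.symm, smul_eq_mul,
    show simpleRoot j - (-1 : ℤ) • simpleRoot i - (2 - -1 * -1 : ℤ) • simpleRoot j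
      = (simpleRoot i : V → ℤ) by module]
  exact act_simpleRoot_nonpos M hi

theorem isReduced_of_cons {i : V} {ω : List V} (h : (cox M).IsReduced (i :: ω)) :
    (cox M).IsReduced ω := h.drop 1

theorem isLeftDescent_of_cons {i : V} {ω : List V} (h : (cox M).IsReduced (i :: ω)) :
    (cox M).IsLeftDescent ((cox M).wordProd (i :: ω)) i := by
  rw [CoxeterSystem.IsLeftDescent, h.eq, CoxeterSystem.wordProd_cons,
    CoxeterSystem.simple_mul_simple_cancel_left, (isReduced_of_cons M h).eq, List.length_cons]
  exact Nat.lt_succ_self _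

theorem exists_isReduced_cons {w : W M} {i : V} (h : (cox M).IsLeftDescent w i) :
    ∃ τ, (cox M).IsReduced (i :: τ) ∧ (cox M).wordProd τ = (cox M).simple i * w ∧
      (cox M).wordProd (i :: τ) = w := by
  obtain ⟨τ, h1, h2⟩ := (cox M).exists_isReduced ((cox M).simple i * w)
  have h3 : (cox M).wordProd (i :: τ) = w := by
    rw [CoxeterSystem.wordProd_cons, ← h2, CoxeterSystem.simple_mul_simple_cancel_left]
  refine ⟨τ, ?_, h2.symm, h3⟩
  rw [CoxeterSystem.IsReduced, h3, List.length_cons, ← h1.eq, ← h2]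
  exact ((cox M).isLeftDescent_iff.mp h).symm

/-- Matsumoto's theorem: a product over a reduced word only depends on the group element if the
factors satisfy the braid relations. -/
theorem prod_map_eq_of_isReduced {N : Type*} [Monoid N] (f : V → N)
    (hcomm : ∀ i j, ¬ M.Adj i j → f i * f j = f j * f i)
    (hbraid : ∀ i j, M.Adj i j → f i * (f j * f i) = f j * (f i * f j)) :
    ∀ (n : ℕ) (ω ω' : List V), ω.length = n → (cox M).IsReduced ω → (cox M).IsReduced ω' →
      (cox M).wordProd ω = (cox M).wordProd ω' → (ω.map f).prod = (ω'.map f).prod := by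
  intro n
  induction n with
  | zero =>
    intro ω ω' hn h h' he
    have h1 := h'.eq
    rw [← he, h.eq, hn] at h1
    rw [List.length_eq_zero_iff.mp hn, List.length_eq_zero_iff.mp h1.symm]
  | succ n ih =>
    intro ω ω' hn h h' he
    have hlen : ω'.length = n + 1 := by rw [← h'.eq, ← he, h.eq, hn]
    obtain ⟨i, ω, rfl⟩ := List.exists_cons_of_length_eq_add_one hn
    obtain ⟨j, ω', rfl⟩ := List.exists_cons_of_length_eq_add_one hlen
    rw [List.length_cons, Nat.add_right_cancel_iff] at hn hlen
    have hω := isReduced_of_cons M h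
    have hω' := isReduced_of_cons M h'
    have hi := isLeftDescent_of_cons M h
    have hj := isLeftDescent_of_cons M h'
    rw [← he] at hj
    have hwi : (cox M).wordProd ω = (cox M).simple i * (cox M).wordProd (i :: ω) := by
      rw [CoxeterSystem.wordProd_cons, CoxeterSystem.simple_mul_simple_cancel_left]
    have hwj : (cox M).wordProd ω' = (cox M).simple j * (cox M).wordProd (i :: ω) := by
      rw [he, CoxeterSystem.wordProd_cons, CoxeterSystem.simple_mul_simple_cancel_left]
    generalize (cox M).wordProd (i :: ω) = w at *
    simp only [List.map_cons, List.prod_cons]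
    by_cases hij : i = j
    · subst hij
      rw [ih ω ω' hn hω hω' (hwi.trans hwj.symm)]
    -- With distinct first letters, `i` and `j` are both left descents of `w`. So `w` has reduced
    -- words starting with the two sides of the relation between `i` and `j`, with a common tail
    -- `τ`; induction replaces each given word by one of them.
    by_cases hadj : M.Adj i j
    · have h1 : (cox M).IsLeftDescent ((cox M).simple i * w) j := by
        rw [← CoxeterSystem.isRightDescent_inv_iff, mul_inv_rev, CoxeterSystem.inv_simple]
        exact isRightDescent_mul_of_adj M hadj.symm ((cox M).isRightDescent_inv_iff.mpr hj)
          ((cox M).isRightDescent_inv_iff.mpr hi)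
      have h2 : (cox M).IsLeftDescent ((cox M).simple j * ((cox M).simple i * w)) i := by
        rw [← CoxeterSystem.isRightDescent_inv_iff, mul_inv_rev, mul_inv_rev,
          CoxeterSystem.inv_simple, CoxeterSystem.inv_simple]
        exact isRightDescent_mul_mul_of_adj M hadj.symm ((cox M).isRightDescent_inv_iff.mpr hj)
      obtain ⟨τ, ht1, ht2, ht3⟩ := exists_isReduced_cons M h2
      have e1 : (cox M).wordProd ω = (cox M).wordProd (j :: i :: τ) := by
        rw [CoxeterSystem.wordProd_cons, ht3, CoxeterSystem.simple_mul_simple_cancel_left, hwi]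
      have e2 : (cox M).wordProd ω' = (cox M).wordProd (i :: j :: τ) := by
        rw [CoxeterSystem.wordProd_cons, CoxeterSystem.wordProd_cons, ht2, hwj]
        have hb := simple_braid M hadj
        have : (cox M).simple i * ((cox M).simple j * ((cox M).simple i *
            ((cox M).simple j * ((cox M).simple i * w)))) =
            ((cox M).simple i * ((cox M).simple j * (cox M).simple i)) *
            ((cox M).simple j * ((cox M).simple i * w)) := by simp only [mul_assoc]
        rw [this, hb]
        simp only [mul_assoc, CoxeterSystem.simple_mul_simple_cancel_left]
      have l1 : τ.length + 2 = n := by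
        have a1 := (cox M).isLeftDescent_iff.mp h1
        have a2 := ht1.eq
        rw [ht3] at a2
        rw [← hwi, hω.eq, hn] at a1
        rw [← hwi] at a2
        simp only [List.length_cons] at a2
        omega
      have r1 : (cox M).IsReduced (j :: i :: τ) := by
        rw [CoxeterSystem.IsReduced, ← e1, hω.eq, hn, ← l1]; rfl
      have r2 : (cox M).IsReduced (i :: j :: τ) := by
        rw [CoxeterSystem.IsReduced, ← e2, hω'.eq, hlen, ← l1]; rfl
      rw [ih ω _ hn hω r1 e1, ih ω' _ hlen hω' r2 e2]
      simp only [List.map_cons, List.prod_cons]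
      have := congrArg (· * (τ.map f).prod) (hbraid i j hadj)
      simpa only [mul_assoc] using this
    · have h1 : (cox M).IsLeftDescent ((cox M).simple i * w) j := by
        rw [← CoxeterSystem.isRightDescent_inv_iff, mul_inv_rev, CoxeterSystem.inv_simple]
        exact isRightDescent_mul_of_not_adj M (Ne.symm hij) (fun h => hadj h.symm)
          ((cox M).isRightDescent_inv_iff.mpr hj)
      obtain ⟨τ, ht1, ht2, ht3⟩ := exists_isReduced_cons M h1
      have e1 : (cox M).wordProd ω = (cox M).wordProd (j :: τ) := by rw [ht3, hwi]
      have e2 : (cox M).wordProd ω' = (cox M).wordProd (i :: τ) := by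
        rw [CoxeterSystem.wordProd_cons, ht2, hwj, ← mul_assoc, ← mul_assoc, mul_assoc _ _ w,
          simple_commute M hadj]
        simp only [mul_assoc, CoxeterSystem.simple_mul_simple_cancel_left]
      have l1 : τ.length + 1 = n := by
        rw [← hn, ← hω.eq, e1, ht1.eq, List.length_cons]
      have r2 : (cox M).IsReduced (i :: τ) := by
        rw [CoxeterSystem.IsReduced, ← e2, hω'.eq, hlen, ← l1]; rfl
      rw [ih ω _ hn hω ht1 e1, ih ω' _ hlen hω' r2 e2]
      simp only [List.map_cons, List.prod_cons, ← mul_assoc, hcomm i j hadj]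

end CoxeterWords

end Diagram

/-! ### Minimal words for nodes and positive roots -/

namespace Diagram

section Words

variable {V : Type*} {M : SimpleGraph V}

theorem exists_parent (hconn : M.Connected) {i j : V} (h : j ≠ i) :
    ∃ k, M.Adj k j ∧ M.dist i k + 1 = M.dist i j := by
  obtain ⟨p, hp⟩ := hconn.exists_walk_length_eq_dist j i
  cases p with
  | nil => exact absurd rfl h
  | @cons _ k _ hadj p =>
    refine ⟨k, hadj.symm, le_antisymm ?_ ?_⟩
    · rw [M.dist_comm (u := i) (v := j), ← hp, SimpleGraph.Walk.length_cons, M.dist_comm]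
      exact Nat.succ_le_succ (M.dist_le p)
    · have := hconn.dist_triangle (u := i) (v := k) (w := j)
      rwa [SimpleGraph.dist_eq_one_iff_adj.mpr hadj.symm] at this

open Classical in
variable (M) in
/-- The neighbour of `j` that is closer to `i`. -/
noncomputable def parent (i j : V) : V :=
  if h : ∃ k, M.Adj k j ∧ M.dist i k + 1 = M.dist i j then h.choose else j

theorem parent_spec (hconn : M.Connected) {i j : V} (h : j ≠ i) :
    M.Adj (parent M i j) j ∧ M.dist i (parent M i j) + 1 = M.dist i j := by
  have := exists_parent hconn h
  rw [parent, dif_pos this]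
  exact this.choose_spec

/-- In a tree the distances from `i` to adjacent nodes differ by exactly one, and by uniqueness of
paths the nearer node is the parent of the farther one. -/
theorem parent_eq_of_adj (htree : M.IsTree) {i j k : V} (h : M.Adj k j) :
    parent M i j = k ∨ parent M i k = j := by
  have hconn := htree.1
  have key : ∀ a b, M.Adj a b → M.dist i a + 1 = M.dist i b → parent M i b = a := by
    intro a b hab hd
    have hb : b ≠ i := by rintro rfl; rw [SimpleGraph.dist_self] at hd; omega
    obtain ⟨h1, h2⟩ := parent_spec hconn hb
    obtain ⟨p, hp, hpl⟩ := hconn.exists_path_of_dist i a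
    obtain ⟨q, hq, hql⟩ := hconn.exists_path_of_dist i (parent M i b)
    have hpp : (p.concat hab).IsPath := SimpleGraph.Walk.isPath_of_length_eq_dist _ (by
      rw [SimpleGraph.Walk.length_concat, hpl, hd])
    have hqq : (q.concat h1).IsPath := SimpleGraph.Walk.isPath_of_length_eq_dist _ (by
      rw [SimpleGraph.Walk.length_concat, hql, h2])
    have h3 := congrArg Subtype.val
      ((htree.2.subsingleton_path i b).elim ⟨_, hpp⟩ ⟨_, hqq⟩)
    have h4 := congrArg SimpleGraph.Walk.penultimate h3
    simpa using h4.symm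
  rcases htree.dist_eq_dist_add_one_of_adj i h with h1 | h1
  · exact Or.inr (key j k h.symm h1.symm)
  · exact Or.inl (key k j h h1.symm)

variable (M) in
/-- The word of the shortest element that moves the simple root of `i` to that of `j`,
with the distance of the nodes as first argument. -/
noncomputable def nodeWordAux (i : V) : ℕ → V → List V
  | 0, _ => []
  | n + 1, j => parent M i j :: j :: nodeWordAux i n (parent M i j)

variable (M) in
/-- The word of the shortest element that moves the simple root of `i` to that of `j`. -/
noncomputable def nodeWord (i j : V) : List V := nodeWordAux M i (M.dist i j) j

@[simp] theorem nodeWord_self (i : V) : nodeWord M i i = [] := by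
  rw [nodeWord, SimpleGraph.dist_self, nodeWordAux]

theorem nodeWord_of_ne (hconn : M.Connected) {i j : V} (h : j ≠ i) :
    nodeWord M i j = parent M i j :: j :: nodeWord M i (parent M i j) := by
  rw [nodeWord, ← (parent_spec hconn h).2, nodeWordAux, nodeWord]

/-- Induction along a tree away from the node `i`. -/
@[elab_as_elim]
theorem parent_induction (hconn : M.Connected) (i : V) {p : V → Prop} (base : p i)
    (step : ∀ j, j ≠ i → p (parent M i j) → p j) (j : V) : p j := by
  suffices ∀ n j, M.dist i j = n → p j from this _ j rfl
  intro n
  induction n with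
  | zero => intro j hj; rwa [← hconn.dist_eq_zero_iff.mp hj]
  | succ n ih =>
    intro j hj
    have hji : j ≠ i := by rintro rfl; rw [SimpleGraph.dist_self] at hj; omega
    have := (parent_spec hconn hji).2
    exact step j hji (ih _ (by omega))

theorem length_nodeWord (hconn : M.Connected) (i j : V) :
    (nodeWord M i j).length = 2 * M.dist i j := by
  refine parent_induction hconn i ?_ (fun j hj ih => ?_) j
  · simp
  · rw [nodeWord_of_ne hconn hj, List.length_cons, List.length_cons, ih,
      ← (parent_spec hconn hj).2]
    ring

variable (M) in
/-- The distance from a node to the support of a vector. -/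
noncomputable def supportDist (i : V) (v : V → ℤ) : ℕ := sInf (M.dist i '' {j | v j ≠ 0})

theorem supportDist_le (i : V) {v : V → ℤ} {j : V} (h : v j ≠ 0) :
    supportDist M i v ≤ M.dist i j := Nat.sInf_le ⟨j, h, rfl⟩

theorem exists_supportDist (i : V) {v : V → ℤ} (hv : v ≠ 0) :
    ∃ j, v j ≠ 0 ∧ M.dist i j = supportDist M i v := by
  obtain ⟨k, hk⟩ := Function.ne_iff.mp hv
  exact Nat.sInf_mem (s := M.dist i '' {j | v j ≠ 0}) ⟨_, k, hk, rfl⟩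

theorem supportDist_eq (i : V) {v : V → ℤ} (hv : v ≠ 0) {j : V} (h : ∀ k, k ≠ j → v k = 0) :
    supportDist M i v = M.dist i j := by
  obtain ⟨k, hk, hd⟩ := exists_supportDist (M := M) i hv
  have : k = j := by_contra fun hkj => hk (h k hkj)
  rw [← hd, this]

variable [Fintype V]

theorem act_nodeWord (hconn : M.Connected) (i j : V) :
    act M ((cox M).wordProd (nodeWord M i j)) (simpleRoot i) = simpleRoot j := by
  refine parent_induction hconn i ?_ (fun j hj ih => ?_) j
  · rw [nodeWord_self, CoxeterSystem.wordProd_nil, act_one_apply]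
  · have hadj := (parent_spec hconn hj).1
    rw [nodeWord_of_ne hconn hj, CoxeterSystem.wordProd_cons, CoxeterSystem.wordProd_cons,
      act_mul_apply, act_mul_apply, ih, act_simple_apply M j, act_simple_apply,
      coroot_adj M hadj.symm, map_sub, map_smul, coroot_self, coroot_adj M hadj, smul_eq_mul]
    module

theorem nodeWord_conj (hconn : M.Connected) (i j : V) :
    (cox M).wordProd (nodeWord M i j) * (cox M).simple i =
      (cox M).simple j * (cox M).wordProd (nodeWord M i j) := by
  refine parent_induction hconn i ?_ (fun j hj ih => ?_) j
  · simp
  · have hadj := (parent_spec hconn hj).1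
    rw [nodeWord_of_ne hconn hj, CoxeterSystem.wordProd_cons, CoxeterSystem.wordProd_cons,
      mul_assoc, mul_assoc, ih]
    have := congrArg (· * (cox M).wordProd (nodeWord M i (parent M i j))) (simple_braid M hadj)
    simpa only [mul_assoc] using this

theorem height_update {v v' : V → ℤ} {k : V} (h : ∀ j, j ≠ k → v' j = v j) :
    height v' + (v k).natAbs = height v + (v' k).natAbs := by
  classical
  unfold height
  rw [← Finset.add_sum_erase _ _ (Finset.mem_univ k),
    ← Finset.add_sum_erase _ (fun k => (v k).natAbs) (Finset.mem_univ k),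
    Finset.sum_congr rfl fun j hj => by rw [h j (Finset.ne_of_mem_erase hj)]]
  ring

theorem height_neg (v : V → ℤ) : height (-v) = height v := by
  simp [height]

theorem supportDist_neg (i : V) (v : V → ℤ) : supportDist M i (-v) = supportDist M i v := by
  simp [supportDist]

theorem height_pos {v : V → ℤ} (hv : v ≠ 0) : 0 < height v := by
  obtain ⟨k, hk⟩ := Function.ne_iff.mp hv
  exact Finset.sum_pos' (fun _ _ => Nat.zero_le _)
    ⟨k, Finset.mem_univ k, Int.natAbs_pos.mpr hk⟩

theorem exists_adj_support {v : V → ℤ} {k : V} (hk : v k = 0) (h : coroot M k v ≠ 0) :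
    ∃ j, M.Adj k j ∧ v j ≠ 0 := by
  rw [← form_simpleRoot, form_simpleRoot_left] at h
  obtain ⟨j, -, hj⟩ := Finset.exists_ne_zero_of_sum_ne_zero h
  have hvj := right_ne_zero_of_mul hj
  have hg := left_ne_zero_of_mul hj
  refine ⟨j, ?_, hvj⟩
  by_contra hadj
  have hkj : k ≠ j := by rintro rfl; exact hvj hk
  exact hg (by simp [gram, hkj, hadj])

/-- A fundamental reflection increases the height plus twice the distance to the support by at
most one. -/
theorem height_add_supportDist_le (hM : FormPos M) (hconn : M.Connected) (i k : V) {γ : V → ℤ}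
    (hγ : γ ∈ roots M) :
    height (act M ((cox M).simple k) γ) + 2 * supportDist M i (act M ((cox M).simple k) γ) ≤
      height γ + 2 * supportDist M i γ + 1 := by
  have hγ0 : γ ≠ 0 := by
    rintro rfl
    have := form_roots M hγ
    simp [form_eq_sum] at this
  have hγ'0 : act M ((cox M).simple k) γ ≠ 0 := fun h => hγ0 (by
    rw [← act_inv_act M ((cox M).simple k) γ, h, map_zero])
  have hcases : γ = simpleRoot k ∨ γ = -simpleRoot k ∨
      coroot M k γ = 0 ∨ coroot M k γ = 1 ∨ coroot M k γ = -1 := by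
    rcases isPosRoot_or_neg hM hγ with h | h
    · rcases h.coroot_cases hM k with h | h | h | h <;> simp [h]
    · rcases h.coroot_cases hM k with h | h | h | h
      · rw [map_neg] at h
        exact Or.inr (Or.inr (Or.inr (Or.inl (by omega))))
      · rw [map_neg] at h
        exact Or.inr (Or.inr (Or.inl (by omega)))
      · rw [map_neg] at h
        exact Or.inr (Or.inr (Or.inr (Or.inr (by omega))))
      · exact Or.inr (Or.inl (by rw [← h, neg_neg]))
  have hneg : act M ((cox M).simple k) γ = -γ → height (act M ((cox M).simple k) γ) +
      2 * supportDist M i (act M ((cox M).simple k) γ) ≤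
      height γ + 2 * supportDist M i γ + 1 := fun h => by
    rw [h, height_neg, supportDist_neg]; omega
  have hunit : coroot M k γ = 1 ∨ coroot M k γ = -1 → height (act M ((cox M).simple k) γ) +
      2 * supportDist M i (act M ((cox M).simple k) γ) ≤
      height γ + 2 * supportDist M i γ + 1 := fun hc => by
    rw [act_simple_apply] at hγ'0 ⊢
    set c := coroot M k γ with hcdef
    set γ' := γ - c • simpleRoot k with hγ'
    have hoff : ∀ j, j ≠ k → γ' j = γ j := fun j hj => by
      simp [hγ', simpleRoot_ne hj]
    have hk : γ' k = γ k - c := by simp [hγ', simpleRoot_self]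
    have hh := height_update hoff
    obtain ⟨j, hj, hjd⟩ := exists_supportDist (M := M) i hγ0
    -- The critical case: the coordinate at `k` vanishes and the support may recede by one. The
    -- distance counts twice but the height drops by one, so the sum grows by at most `2 - 1`. Some
    -- neighbour of `k` is in the support because `γ'` pairs to `-c ≠ 0` with `α_k`.
    by_cases hk0 : γ' k = 0
    · have hs : supportDist M i γ' ≤ supportDist M i γ + 1 := by
        by_cases hjk : j = k
        · subst hjk
          obtain ⟨a, ha, ha0⟩ := exists_adj_support (M := M) hk0
            (by rw [hγ', map_sub, map_smul, coroot_self, smul_eq_mul]; omega)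
          have h1 := supportDist_le (M := M) i ha0
          have h2 := hconn.dist_triangle (u := i) (v := j) (w := a)
          rw [SimpleGraph.dist_eq_one_iff_adj.mpr ha] at h2
          omega
        · have := supportDist_le (M := M) i (v := γ') (j := j) (by rwa [hoff j hjk])
          omega
      omega
    · have hs : supportDist M i γ' ≤ supportDist M i γ := by
        by_cases hjk : j = k
        · subst hjk
          rw [← hjd]; exact supportDist_le i hk0
        · rw [← hjd]; exact supportDist_le i (by rwa [hoff j hjk])
      omega
  rcases hcases with h | h | h | h | h
  · refine hneg ?_
    rw [act_simple_apply, h, coroot_self]; module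
  · refine hneg ?_
    rw [act_simple_apply, h, map_neg, coroot_self]; module
  · rw [act_simple_apply, h, zero_smul, sub_zero]; omega
  · exact hunit (Or.inl h)
  · exact hunit (Or.inr h)

/-- The left side is `1` for the empty word and each letter adds at most one. The words `rootWord`
attain the bound, which proves them minimal. -/
theorem height_add_supportDist_le_length (hM : FormPos M) (hconn : M.Connected) (i : V) (w : W M) :
    height (act M w (simpleRoot i)) + 2 * supportDist M i (act M w (simpleRoot i)) ≤
      (cox M).length w + 1 := by
  obtain ⟨ω, hω, rfl⟩ := (cox M).exists_isReduced w
  rw [hω.eq]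
  clear hω
  induction ω with
  | nil =>
    rw [CoxeterSystem.wordProd_nil, act_one_apply, height_simpleRoot,
      supportDist_eq i (isPosRoot_simpleRoot (M := M) i).ne_zero fun k hk => simpleRoot_ne hk,
      SimpleGraph.dist_self]
    simp
  | cons k ω ih =>
    rw [CoxeterSystem.wordProd_cons, act_mul_apply, List.length_cons]
    have := height_add_supportDist_le hM hconn i k
      (act_roots M ((cox M).wordProd ω) (simpleRoot_mem_roots M i))
    omega

/-- The vector `v α_i` is negated by `r_j`, so it is supported at `j` alone and the general bound on
the length applies. -/
theorem two_mul_dist_le_length (hM : FormPos M) (hconn : M.Connected) {i j : V} {v : W M}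
    (h : v * (cox M).simple i * v⁻¹ = (cox M).simple j) :
    2 * M.dist i j ≤ (cox M).length v := by
  have h1 : act M v (simpleRoot i) ≠ 0 := act_simpleRoot_ne_zero M v i
  have h2 := act_conj_simple M v i (act M v (simpleRoot i))
  rw [h, form_act, form_simpleRoot, coroot_self, act_simple_apply] at h2
  have h3 : ∀ k, k ≠ j → act M v (simpleRoot i) k = 0 := fun k hk => by
    have := congrFun h2 k
    simp only [Pi.sub_apply, Pi.smul_apply, simpleRoot_ne hk, smul_eq_mul, mul_zero] at this
    omega
  have h4 := height_add_supportDist_le_length hM hconn i v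
  rw [supportDist_eq i h1 h3] at h4
  have := height_pos h1
  omega

theorem isReduced_nodeWord (hM : FormPos M) (hconn : M.Connected) (i j : V) :
    (cox M).IsReduced (nodeWord M i j) := by
  refine le_antisymm ((cox M).length_wordProd_le _) ?_
  rw [length_nodeWord hconn]
  exact two_mul_dist_le_length hM hconn (by rw [nodeWord_conj hconn, mul_inv_cancel_right])

theorem isConjugator_nodeWord (hM : FormPos M) (hconn : M.Connected) (i j : V) :
    IsConjugator M i j ((cox M).wordProd (nodeWord M i j)) := by
  refine ⟨by rw [nodeWord_conj hconn, mul_inv_cancel_right], fun v hv => ?_⟩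
  rw [(isReduced_nodeWord hM hconn i j).eq, length_nodeWord hconn]
  exact two_mul_dist_le_length hM hconn hv

theorem IsConjugator.inv {i j : V} {w : W M} (h : IsConjugator M i j w) :
    IsConjugator M j i w⁻¹ := by
  refine ⟨by rw [← h.1]; group, fun v hv => ?_⟩
  rw [CoxeterSystem.length_inv, ← (cox M).length_inv v]
  exact h.2 _ (by rw [← hv]; group)

open Classical in
variable (M) in
/-- A shortest word of an element that moves the simple root of `i` to `β`, with the height of `β`
as first argument. -/
noncomputable def rootWordAux (i : V) : ℕ → (V → ℤ) → List V
  | 0, _ => []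
  | n + 1, β =>
    if h : ∃ k, coroot M k β = 1 ∧ supportDist M i (β - simpleRoot k) = supportDist M i β then
      h.choose :: rootWordAux i n (β - simpleRoot h.choose)
    else if h : ∃ j, β = simpleRoot j then nodeWord M i h.choose else []

variable (M) in
/-- A shortest word of an element that moves the simple root of `i` to `β`. -/
noncomputable def rootWord (i : V) (β : V → ℤ) : List V := rootWordAux M i (height β) β

theorem rootWord_simpleRoot (i j : V) : rootWord M i (simpleRoot j) = nodeWord M i j := by
  rw [rootWord, height_simpleRoot, rootWordAux, dif_neg, dif_pos ⟨j, rfl⟩]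
  · congr 1
    exact (simpleRoot_injective (Exists.choose_spec
      (⟨j, rfl⟩ : ∃ k, (simpleRoot j : V → ℤ) = simpleRoot k))).symm
  · rintro ⟨k, hk, -⟩
    by_cases hkj : k = j
    · subst hkj; rw [coroot_self] at hk; omega
    · by_cases hadj : M.Adj k j
      · rw [coroot_adj M hadj] at hk; omega
      · rw [coroot_not_adj M hkj hadj] at hk; omega

theorem exists_rootWord_eq_cons (hM : FormPos M) (i : V) {β : V → ℤ} (h : IsPosRoot M β)
    (hβ : ∀ j, β ≠ simpleRoot j) : ∃ k, coroot M k β = 1 ∧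
      supportDist M i (β - simpleRoot k) = supportDist M i β ∧
      rootWord M i β = k :: rootWord M i (β - simpleRoot k) := by
  have hex : ∃ k, coroot M k β = 1 ∧
      supportDist M i (β - simpleRoot k) = supportDist M i β := by
    -- The descent keeps a support node nearest to `i`, so the distance does not grow; it does not
    -- shrink because subtraction creates no new support.
    obtain ⟨j, hj, hd⟩ := exists_supportDist (M := M) i h.ne_zero
    obtain ⟨k, hk, hkj⟩ := h.exists_descent hM hj (hβ j)
    refine ⟨k, hk, le_antisymm (hd ▸ supportDist_le i hkj) ?_⟩
    obtain ⟨a, ha, had⟩ := exists_supportDist (M := M) i (h.sub hM hk).ne_zero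
    rw [← had]
    refine supportDist_le i fun h0 => ha ?_
    have h1 : 0 ≤ (β - simpleRoot k) a := (h.sub hM hk).nonneg a
    have h2 : 0 ≤ (simpleRoot k : V → ℤ) a := simpleRoot_nonneg k a
    rw [Pi.sub_apply] at h1 ⊢
    omega
  refine ⟨hex.choose, hex.choose_spec.1, hex.choose_spec.2, ?_⟩
  rw [rootWord, h.height_sub hM hex.choose_spec.1, rootWordAux, dif_pos hex, rootWord]

/-- Induction on positive roots along the steps of `rootWord`. -/
@[elab_as_elim]
theorem IsPosRoot.induction (hM : FormPos M) (i : V) {p : (V → ℤ) → Prop}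
    (base : ∀ j, p (simpleRoot j))
    (step : ∀ β k, IsPosRoot M β → coroot M k β = 1 →
      supportDist M i (β - simpleRoot k) = supportDist M i β →
      rootWord M i β = k :: rootWord M i (β - simpleRoot k) → p (β - simpleRoot k) → p β)
    (β : V → ℤ) (h : IsPosRoot M β) : p β := by
  suffices ∀ n β, height β = n → IsPosRoot M β → p β from this _ β rfl h
  intro n
  induction n with
  | zero => intro β hn h; exact absurd hn h.height_pos.ne'
  | succ n ih =>
    intro β hn h
    by_cases hβ : ∃ j, β = simpleRoot j
    · obtain ⟨j, rfl⟩ := hβ; exact base j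
    · push Not at hβ
      obtain ⟨k, hk, hd, hw⟩ := exists_rootWord_eq_cons hM i h hβ
      have := h.height_sub hM hk
      exact step β k h hk hd hw (ih _ (by omega) (h.sub hM hk))

theorem act_rootWord (hM : FormPos M) (hconn : M.Connected) (i : V) {β : V → ℤ}
    (h : IsPosRoot M β) :
    act M ((cox M).wordProd (rootWord M i β)) (simpleRoot i) = β := by
  refine IsPosRoot.induction hM i (fun j => ?_) (fun β k _ hk _ hw ih => ?_) β h
  · rw [rootWord_simpleRoot, act_nodeWord hconn]
  · rw [hw, CoxeterSystem.wordProd_cons, act_mul_apply, ih, act_simple_apply, map_sub, coroot_self,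
      hk]
    module

theorem length_rootWord (hM : FormPos M) (hconn : M.Connected) (i : V) {β : V → ℤ}
    (h : IsPosRoot M β) :
    (rootWord M i β).length + 1 = height β + 2 * supportDist M i β := by
  refine IsPosRoot.induction hM i (fun j => ?_) (fun β k h hk hd hw ih => ?_) β h
  · rw [rootWord_simpleRoot, length_nodeWord hconn, height_simpleRoot,
      supportDist_eq i (isPosRoot_simpleRoot (M := M) j).ne_zero fun k hk => simpleRoot_ne hk]
    ring
  · rw [hw, List.length_cons, ih, hd, h.height_sub hM hk]
    ring

theorem isReduced_rootWord (hM : FormPos M) (hconn : M.Connected) (i : V) {β : V → ℤ}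
    (h : IsPosRoot M β) : (cox M).IsReduced (rootWord M i β) := by
  refine le_antisymm ((cox M).length_wordProd_le _) ?_
  have h1 := height_add_supportDist_le_length hM hconn i ((cox M).wordProd (rootWord M i β))
  rw [act_rootWord hM hconn i h] at h1
  have := length_rootWord hM hconn i h
  omega

theorem rootWord_mem_D (hM : FormPos M) (hconn : M.Connected) (i : V) {β : V → ℤ}
    (h : IsPosRoot M β) : (cox M).wordProd (rootWord M i β) ∈ D M i := by
  refine ⟨by rwa [act_rootWord hM hconn i h, mem_posRoots_iff hM], fun v hv => ?_⟩
  rw [act_rootWord hM hconn i h] at hv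
  have h1 := height_add_supportDist_le_length hM hconn i v
  rw [hv] at h1
  have := length_rootWord hM hconn i h
  rw [(isReduced_rootWord hM hconn i h).eq]
  omega

end Words

end Diagram

/-! ### Identities between the scalars -/

namespace Qlx

theorem m_mul_one_sub_x : m * (1 - x) = l - l⁻¹ := div_mul_cancel₀ _ one_sub_x_ne_zero

theorem x_ne_zero : x ≠ 0 := by
  intro h
  have h1 : (RatFunc.C (RatFunc.X : RatFunc ℚ) : RatFunc (RatFunc ℚ)) = RatFunc.C 0 := by
    rw [map_zero]; exact h
  exact RatFunc.X_ne_zero (RatFunc.C_injective h1)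

theorem l_mul_l_ne_x : l * l ≠ x := by
  intro h
  have h1 : (RatFunc.X : RatFunc (RatFunc ℚ)) * RatFunc.X =
    RatFunc.C (RatFunc.X : RatFunc ℚ) := h
  have h3 := congrArg RatFunc.intDegree h1
  rw [RatFunc.intDegree_mul RatFunc.X_ne_zero RatFunc.X_ne_zero] at h3
  simp at h3

theorem l_mul_x : l * (m * x) = l * m - l * l + 1 := by
  have h := m_mul_one_sub_x
  have h2 : l * l⁻¹ = 1 := mul_inv_cancel₀ l_ne_zero
  linear_combination (-l) * h + h2

/-- Vanishing would force `l * l = x`. This factor is cancelled in `e_e_e`. -/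
theorem one_add_l_mul_m_ne_zero : 1 + l * m ≠ 0 := by
  intro h
  apply l_mul_l_ne_x
  have h1 := l_mul_x
  linear_combination (1 - x) * h + h1

end Qlx

/-! ### Relations in the BMW algebra, path elements and the elements `z` -/

namespace BMW

open Diagram

variable {V : Type*} (M : SimpleGraph V)

/-- Elements of an algebra that satisfy the defining relations of the BMW algebra. -/
structure Rep (A : Type*) [Ring A] [Algebra Qlx A] where
  g : V → A
  e : V → A
  g_comm : ∀ i j, ¬ M.Adj i j → g i * g j = g j * g i
  g_braid : ∀ i j, M.Adj i j → g i * (g j * g i) = g j * (g i * g j)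
  e_def : ∀ i, Qlx.m • e i = Qlx.l • (g i * g i + Qlx.m • g i - 1)
  g_mul_e : ∀ i, g i * e i = Qlx.l⁻¹ • e i
  e_g_e : ∀ i j, M.Adj i j → e i * (g j * e i) = Qlx.l • e i

theorem ne_of_parent_adj {M : SimpleGraph V} {i j k : V} (h : M.Adj k j) (hp : parent M i j = k) : j ≠ i := by
  rintro rfl
  have : parent M j j = j := by
    rw [parent, dif_neg]
    rintro ⟨a, -, ha⟩
    rw [SimpleGraph.dist_self] at ha
    omega
  rw [this] at hp
  exact h.ne hp.symm

namespace Rep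

open Qlx

section Relations

variable {M} {A : Type*} [Ring A] [Algebra Qlx A] (R : Rep M A)

theorem e_eq (i : V) : R.e i = (m⁻¹ * l) • (R.g i * R.g i + m • R.g i - 1) := by
  rw [mul_smul, eq_inv_smul_iff₀ m_ne_zero, R.e_def]

theorem g_sq (i : V) : R.g i * R.g i = 1 - m • R.g i + (l⁻¹ * m) • R.e i := by
  rw [mul_smul, R.e_def, smul_smul, inv_mul_cancel₀ l_ne_zero, one_smul]
  abel

/-- Each `e` is the same polynomial in its `g`, so whatever intertwines two `g`s intertwines the
`e`s. -/
theorem semiconj_e {i j : V} {u : A} (h : u * R.g i = R.g j * u) : u * R.e i = R.e j * u := by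
  rw [e_eq, e_eq, mul_smul_comm, smul_mul_assoc, mul_sub, mul_add, sub_mul, add_mul, mul_smul_comm,
    smul_mul_assoc, h, ← mul_assoc, h, mul_assoc, h, ← mul_assoc, mul_one, one_mul]

theorem e_g_comm {i j : V} (h : ¬ M.Adj i j) : R.e i * R.g j = R.g j * R.e i :=
  (R.semiconj_e (R.g_comm j i fun h' => h h'.symm)).symm

theorem e_mul_g (i : V) : R.e i * R.g i = l⁻¹ • R.e i := by
  rw [R.e_g_comm (M.loopless.irrefl i), R.g_mul_e]

/-- Multiplying the definition of `e` by `e` evaluates `g` to `l⁻¹`; the resulting scalar is `m * x`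
by the choice of `m`. -/
theorem e_sq (i : V) : R.e i * R.e i = x • R.e i := by
  have h : m • (R.e i * R.e i) = m • (x • R.e i) := by
    rw [← mul_smul_comm, R.e_def, mul_smul_comm, mul_sub, mul_add, mul_smul_comm, ← mul_assoc,
      R.e_mul_g, smul_mul_assoc, R.e_mul_g, mul_one]
    match_scalars
    have h := m_mul_one_sub_x
    have h2 : l * l⁻¹ = 1 := mul_inv_cancel₀ l_ne_zero
    linear_combination (l⁻¹ + m) * h2 + h
  exact (smul_right_injective A m_ne_zero) h

/-- The inverse of `g i`. -/
noncomputable def gInv (i : V) : A := R.g i + m • 1 - m • R.e i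

theorem g_mul_gInv (i : V) : R.g i * R.gInv i = 1 := by
  rw [gInv, mul_sub, mul_add, mul_smul_comm, mul_smul_comm, R.g_sq, R.g_mul_e, mul_one]
  module

theorem gInv_mul_g (i : V) : R.gInv i * R.g i = 1 := by
  rw [gInv, sub_mul, add_mul, smul_mul_assoc, smul_mul_assoc, R.g_sq, R.e_mul_g, one_mul]
  module

theorem gInv_mul_g_mul (i : V) (y : A) : R.gInv i * (R.g i * y) = y := by
  rw [← mul_assoc, R.gInv_mul_g, one_mul]

theorem g_mul_gInv_mul (i : V) (y : A) : R.g i * (R.gInv i * y) = y := by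
  rw [← mul_assoc, R.g_mul_gInv, one_mul]

theorem gInv_g_comm {i j : V} (h : ¬ M.Adj i j) : R.gInv i * R.g j = R.g j * R.gInv i := by
  have h' : ¬ M.Adj j i := fun h' => h h'.symm
  rw [gInv, sub_mul, add_mul, mul_sub, mul_add, smul_mul_assoc, smul_mul_assoc, mul_smul_comm,
    mul_smul_comm, R.g_comm i j h, R.e_g_comm h, mul_one, one_mul]

theorem gInv_g_g {i j : V} (h : M.Adj i j) (y : A) :
    R.gInv i * (R.g j * (R.g i * y)) = R.g j * (R.g i * (R.gInv j * y)) := by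
  have h1 := congrArg (fun t => R.gInv i * (t * (R.gInv j * y))) (R.g_braid i j h)
  simp only [mul_assoc, R.gInv_mul_g_mul, R.g_mul_gInv_mul] at h1
  exact h1.symm

theorem g_g_e_eq {i j : V} (h : M.Adj i j) :
    R.g i * (R.g j * R.e i) = R.e j * (R.g i * R.g j) := by
  have := R.semiconj_e (i := i) (j := j) (u := R.g i * R.g j) (by rw [mul_assoc, R.g_braid i j h])
  rwa [mul_assoc] at this

theorem e_g_g_e {i j : V} (h : M.Adj i j) : R.e j * (R.g i * (R.g j * R.e j)) = R.e j := by
  rw [R.g_mul_e, mul_smul_comm, mul_smul_comm, R.e_g_e j i h.symm, smul_smul,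
    inv_mul_cancel₀ l_ne_zero, one_smul]

theorem e_mul_e_eq {i j : V} (h : M.Adj i j) : R.e i * R.e j = R.e i * (R.gInv j * R.gInv i) := by
  have h1 : R.e i * (R.e j * (R.g i * R.g j)) = R.e i := by
    rw [← R.g_g_e_eq h, ← mul_assoc, R.e_mul_g, smul_mul_assoc, R.e_g_e i j h, smul_smul,
      inv_mul_cancel₀ l_ne_zero, one_smul]
  conv_rhs => rw [← h1]
  simp only [mul_assoc, R.g_mul_gInv_mul, R.g_mul_gInv, mul_one]

theorem gInv_mul_e (i : V) : R.gInv i * R.e i = l • R.e i := by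
  have h := R.gInv_mul_g_mul i (R.e i)
  rw [R.g_mul_e, mul_smul_comm, inv_smul_eq_iff₀ l_ne_zero] at h
  exact h

/-- By `e_mul_e_eq` the left side is `e_i g_j⁻¹ g_i⁻¹ e_i = l e_i g_j⁻¹ e_i`. Expanding `g_j⁻¹`
brings the left side back with coefficient `-l m`, and `1 + l m` is invertible. -/
theorem e_e_e {i j : V} (h : M.Adj i j) : R.e i * (R.e j * R.e i) = R.e i := by
  have h1 : R.e i * (R.e j * R.e i) =
      l • (l • R.e i + (m * x) • R.e i - m • (R.e i * (R.e j * R.e i))) := by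
    conv_lhs => rw [← mul_assoc, R.e_mul_e_eq h, mul_assoc, mul_assoc, R.gInv_mul_e, mul_smul_comm,
      mul_smul_comm, gInv, sub_mul, add_mul, mul_sub, mul_add, R.e_g_e i j h, smul_mul_assoc,
      smul_mul_assoc, mul_smul_comm, mul_smul_comm, one_mul, R.e_sq, smul_smul]
  have h2 : (1 + l * m) • (R.e i * (R.e j * R.e i)) = (1 + l * m) • R.e i := by
    have h3 : R.e i * (R.e j * R.e i) =
        (l * l + l * (m * x)) • R.e i - (l * m) • (R.e i * (R.e j * R.e i)) := by
      conv_lhs => rw [h1]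
      module
    rw [add_smul, one_smul, eq_sub_iff_add_eq.mp h3]
    congr 1
    have := l_mul_x
    linear_combination this
  exact smul_right_injective A one_add_l_mul_m_ne_zero h2

theorem g_g_e {i j : V} (h : M.Adj i j) : R.g i * (R.g j * R.e i) = R.e j * R.e i := by
  have h1 : R.g i * (R.g j * R.e i) * R.e j = R.e j := by
    rw [R.g_g_e_eq h, mul_assoc, mul_assoc, R.e_g_g_e h]
  rw [← h1]
  simp only [mul_assoc]
  rw [R.e_e_e h]

theorem e_g_g {i j : V} (h : M.Adj i j) : R.e j * (R.g i * R.g j) = R.e j * R.e i := by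
  rw [← R.g_g_e_eq h, R.g_g_e h]

theorem e_g {i j : V} (h : M.Adj i j) : R.e j * R.g i = R.e j * (R.e i * R.gInv j) := by
  rw [← mul_assoc, ← R.e_g_g h]
  simp only [mul_assoc, R.g_mul_gInv, mul_one]

theorem g_e_e {i j : V} (h : M.Adj i j) :
    R.g i * (R.e j * R.e i) = R.g j * R.e i - m • (R.e j * R.e i) + m • R.e i := by
  rw [← R.g_g_e h, ← mul_assoc, R.g_sq, add_mul, sub_mul, one_mul, smul_mul_assoc, R.g_g_e h,
    smul_mul_assoc, R.e_g_e i j h, smul_smul]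
  congr 2
  rw [mul_right_comm, inv_mul_cancel₀ l_ne_zero, one_mul]

/-- The product of the `g i` along a word. -/
def word (ω : List V) : A := (ω.map R.g).prod

@[simp] theorem word_nil : R.word [] = 1 := rfl

theorem word_cons (i : V) (ω : List V) : R.word (i :: ω) = R.g i * R.word ω := by
  simp [word]

theorem word_append (ω ω' : List V) : R.word (ω ++ ω') = R.word ω * R.word ω' := by
  simp [word]

/-- The element `e j ⋯ e i` along the path from `i` to `j`. -/
noncomputable def p (i j : V) : A := R.word (nodeWord M i j) * R.e i

/-- The element `e i ⋯ e j` along the path from `j` to `i`. -/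
noncomputable def q (i j : V) : A := R.e i * R.word (nodeWord M i j).reverse

@[simp] theorem p_self (i : V) : R.p i i = R.e i := by simp [p]

@[simp] theorem q_self (i : V) : R.q i i = R.e i := by simp [q]

variable (hconn : M.Connected)
include hconn

/-- The claims depend on each other: the first, at the parent, puts an `e` in front of the shorter
path element, and `g_g_e` then turns the two new letters into `e_j`. -/
theorem e_mul_p_and (i j : V) : R.e j * R.p i j = x • R.p i j ∧
    (j ≠ i → R.p i j = R.e j * R.p i (parent M i j)) := by
  induction j using parent_induction hconn i with
  | base => exact ⟨by rw [p_self, e_sq], fun h => absurd rfl h⟩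
  | step j hj ih =>
    have hadj := (parent_spec hconn hj).1
    have h1 : R.p i j = R.e j * R.p i (parent M i j) := by
      apply smul_right_injective A x_ne_zero
      show x • R.p i j = x • (R.e j * R.p i (parent M i j))
      rw [← mul_smul_comm, ← ih.1, ← mul_assoc, ← R.g_g_e hadj, p, nodeWord_of_ne hconn hj,
        word_cons, word_cons]
      rw [mul_assoc, mul_assoc, mul_assoc, mul_assoc, ih.1, ← p, mul_smul_comm, mul_smul_comm]
    refine ⟨?_, fun _ => h1⟩
    rw [h1, ← mul_assoc, e_sq, smul_mul_assoc]

theorem q_mul_e_and (i j : V) : R.q i j * R.e j = x • R.q i j ∧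
    (j ≠ i → R.q i j = R.q i (parent M i j) * R.e j) := by
  induction j using parent_induction hconn i with
  | base => exact ⟨by rw [q_self, e_sq], fun h => absurd rfl h⟩
  | step j hj ih =>
    have hadj := (parent_spec hconn hj).1
    have h1 : R.q i j = R.q i (parent M i j) * R.e j := by
      apply smul_right_injective A x_ne_zero
      show x • R.q i j = x • (R.q i (parent M i j) * R.e j)
      rw [← smul_mul_assoc, ← ih.1, mul_assoc, ← R.e_g_g hadj.symm, ← mul_assoc, ih.1, q,
        nodeWord_of_ne hconn hj, List.reverse_cons, List.reverse_cons, word_append, word_append,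
        smul_mul_assoc, q]
      simp only [word_cons, word_nil, mul_one, mul_assoc]
    refine ⟨?_, fun _ => h1⟩
    rw [h1, mul_assoc, e_sq, mul_smul_comm]

theorem e_mul_p (i j : V) : R.e j * R.p i j = x • R.p i j := (R.e_mul_p_and hconn i j).1

theorem q_mul_e (i j : V) : R.q i j * R.e j = x • R.q i j := (R.q_mul_e_and hconn i j).1

theorem e_e_p {i j k : V} (h : M.Adj j k) : R.e j * (R.e k * R.p i j) = R.p i j := by
  apply smul_right_injective A x_ne_zero
  show x • _ = x • _
  rw [← mul_smul_comm, ← mul_smul_comm, ← R.e_mul_p hconn, ← mul_assoc, ← mul_assoc,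
    mul_assoc _ (R.e k), R.e_e_e h]

theorem q_e_e {i j k : V} (h : M.Adj j k) : R.q i j * (R.e k * R.e j) = R.q i j := by
  apply smul_right_injective A x_ne_zero
  show x • _ = x • _
  rw [← smul_mul_assoc, ← R.q_mul_e hconn, mul_assoc, R.e_e_e h]

variable (htree : M.IsTree)

section Tree

include htree

/-- In a tree one of two adjacent nodes is the parent of the other. Moving away from `i` is the
recursion for `p`; moving back cancels by `e_e_p`. -/
theorem e_mul_p_adj {i j k : V} (h : M.Adj k j) : R.e k * R.p i j = R.p i k := by
  rcases parent_eq_of_adj (i := i) htree h with hp | hp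
  · rw [(R.e_mul_p_and hconn i j).2 (ne_of_parent_adj h hp), hp, R.e_e_p hconn h]
  · rw [(R.e_mul_p_and hconn i k).2 (ne_of_parent_adj h.symm hp), hp]

theorem q_mul_e_adj {i j k : V} (h : M.Adj k j) : R.q i j * R.e k = R.q i k := by
  rcases parent_eq_of_adj (i := i) htree h with hp | hp
  · rw [(R.q_mul_e_and hconn i j).2 (ne_of_parent_adj h hp), hp, mul_assoc,
      R.q_e_e hconn h]
  · rw [(R.q_mul_e_and hconn i k).2 (ne_of_parent_adj h.symm hp), hp]

end Tree

theorem p_mul_q (i j : V) : R.p i j * R.q i j = x • R.e j := by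
  induction j using parent_induction hconn i with
  | base => rw [p_self, q_self, e_sq]
  | step j hj ih =>
    have hadj := (parent_spec hconn hj).1
    rw [(R.e_mul_p_and hconn i j).2 hj, (R.q_mul_e_and hconn i j).2 hj, mul_assoc,
      ← mul_assoc (R.p i _), ih, smul_mul_assoc, mul_smul_comm, R.e_e_e hadj.symm]

theorem q_mul_p (i j : V) : R.q i j * R.p i j = x • R.e i := by
  induction j using parent_induction hconn i with
  | base => rw [p_self, q_self, e_sq]
  | step j hj ih =>
    have hadj := (parent_spec hconn hj).1
    rw [← ih, (R.q_mul_e_and hconn i j).2 hj, (R.e_mul_p_and hconn i j).2 hj, mul_assoc,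
      ← mul_assoc (R.e j), R.e_sq, smul_mul_assoc, mul_smul_comm, ← smul_mul_assoc,
      ← R.q_mul_e hconn, mul_assoc, R.e_e_p hconn hadj]

theorem e_mul_q (i j : V) : R.e i * R.q i j = x • R.q i j := by
  rw [q, ← mul_assoc, e_sq, smul_mul_assoc]

theorem g_mul_p (i j : V) : R.g j * R.p i j = l⁻¹ • R.p i j := by
  apply smul_right_injective A x_ne_zero
  show x • _ = x • _
  rw [← mul_smul_comm, ← R.e_mul_p hconn, ← mul_assoc, R.g_mul_e, smul_mul_assoc, R.e_mul_p hconn,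
    smul_comm]

/-- The element of `e i A e i` by which `g k` acts on `e j ⋯ e i`, for non-adjacent `j` and `k`. -/
noncomputable def z (i j k : V) : A := (x⁻¹ * x⁻¹) • (R.q i j * (R.g k * R.p i j))

theorem e_mul_z (i j k : V) : R.e i * R.z i j k = x • R.z i j k := by
  rw [z, mul_smul_comm, ← mul_assoc, R.e_mul_q hconn, smul_mul_assoc, smul_comm]

/-- Because `p q = x e_j` and `e_j` commutes with `g_k`, the letter `g_k` can be pulled to the left;
the two factors `x` that arise cancel the normalisation of `z`. -/
theorem p_mul_z {i j k : V} (h : ¬ M.Adj j k) : R.p i j * R.z i j k = R.g k * R.p i j := by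
  rw [z, mul_smul_comm, ← mul_assoc, R.p_mul_q hconn, smul_mul_assoc, ← mul_assoc, R.e_g_comm h,
    mul_assoc, R.e_mul_p hconn, mul_smul_comm, smul_smul, smul_smul]
  rw [show x⁻¹ * x⁻¹ * x * x = (x⁻¹ * x) * (x⁻¹ * x) by ring, inv_mul_cancel₀ x_ne_zero, one_mul,
    one_smul]

theorem z_mul_z {i j k k' : V} (h : ¬ M.Adj j k') :
    R.z i j k * R.z i j k' = (x⁻¹ * x⁻¹) • (R.q i j * (R.g k * (R.g k' * R.p i j))) := by
  conv_lhs => rw [z]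
  rw [smul_mul_assoc, mul_assoc, mul_assoc, R.p_mul_z hconn h]

theorem z_comm {i j k k' : V} (h : ¬ M.Adj j k) (h' : ¬ M.Adj j k') (hk : ¬ M.Adj k k') :
    R.z i j k * R.z i j k' = R.z i j k' * R.z i j k := by
  rw [R.z_mul_z hconn h, R.z_mul_z hconn h', ← mul_assoc (R.g k), R.g_comm k k' hk, mul_assoc]

theorem z_braid {i j k k' : V} (h : ¬ M.Adj j k) (h' : ¬ M.Adj j k') (hk : M.Adj k k') :
    R.z i j k * (R.z i j k' * R.z i j k) = R.z i j k' * (R.z i j k * R.z i j k') := by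
  have key : ∀ a b, ¬ M.Adj j a → ¬ M.Adj j b → R.z i j a * (R.z i j b * R.z i j a) =
      (x⁻¹ * x⁻¹) • (R.q i j * ((R.g a * (R.g b * R.g a)) * R.p i j)) := by
    intro a b ha hb
    rw [← mul_assoc, R.z_mul_z hconn hb, smul_mul_assoc, mul_assoc, mul_assoc, mul_assoc,
      R.p_mul_z hconn ha]
    simp only [mul_assoc]
  rw [key k k' h h', key k' k h' h, R.g_braid k k' hk]

theorem e_mul_p_zero (horth : ∀ i j, i ≠ j → ¬ M.Adj i j → R.e i * R.e j = 0) {i j k : V}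
    (hne : k ≠ j) (h : ¬ M.Adj k j) : R.e k * R.p i j = 0 := by
  apply smul_right_injective A x_ne_zero
  show x • _ = x • _
  rw [← mul_smul_comm, ← R.e_mul_p hconn, ← mul_assoc, horth k j hne h, zero_mul, smul_zero]

/-- Since `e_k e_j = 0`, the `e_k` in the quadratic relation for `g_k` annihilates the path element.
What remains is a Hecke relation with identity `x⁻¹ • e i`. -/
theorem z_sq (horth : ∀ i j, i ≠ j → ¬ M.Adj i j → R.e i * R.e j = 0) {i j k : V}
    (hne : j ≠ k) (h : ¬ M.Adj j k) :
    R.z i j k * R.z i j k = x⁻¹ • R.e i - m • R.z i j k := by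
  rw [R.z_mul_z hconn h, ← mul_assoc (R.g k), g_sq, add_mul, sub_mul, one_mul, smul_mul_assoc,
    smul_mul_assoc, R.e_mul_p_zero hconn horth hne.symm fun h' => h h'.symm, smul_zero, add_zero,
    mul_sub, R.q_mul_p hconn, mul_smul_comm, z, smul_sub, smul_smul, mul_assoc,
    inv_mul_cancel₀ x_ne_zero, mul_one, smul_comm]

/-- Both sides pass through the middle node, as `e_c g_b e_a e_c` and its mirror image. Writing `e_a
e_c = g_c g_a e_c` and `e_c g_b g_c = e_c e_b` exchanges the two. -/
theorem z_swap {i a b c : V} (htree : M.IsTree) (hac : M.Adj a c) (hcb : M.Adj c b)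
    (hab : ¬ M.Adj a b) : R.z i a b = R.z i b a := by
  have hba : ¬ M.Adj b a := fun h => hab h.symm
  have key : ∀ a b, M.Adj a c → M.Adj c b → ¬ M.Adj a b →
      R.q i a * (R.g b * R.p i a) = x⁻¹ • (R.q i c * ((R.e c * (R.g b * (R.e a * R.e c)))
        * R.p i c)) := by
    intro a b hac hcb hab
    rw [← R.q_mul_e_adj hconn htree hac, ← R.e_mul_p_adj hconn htree hac, mul_assoc,
      ← mul_assoc (R.g b), ← mul_assoc (R.e a), ← mul_assoc (R.e a), R.e_g_comm hab,
      mul_assoc (R.g b), R.e_sq, mul_assoc (R.e c), ← mul_assoc (R.q i c) (R.e c), R.q_mul_e hconn]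
    simp only [mul_assoc, smul_mul_assoc, mul_smul_comm]
    rw [R.e_mul_p hconn]
    simp only [mul_smul_comm, smul_smul]
    rw [inv_mul_cancel_left₀ x_ne_zero]
  have h1 : R.e c * (R.g b * (R.e a * R.e c)) = R.e c * (R.g a * (R.e b * R.e c)) := by
    rw [← R.g_g_e hac.symm, ← mul_assoc (R.g b), ← mul_assoc (R.e c), R.e_g_g hcb.symm, mul_assoc,
      ← mul_assoc (R.e b), R.e_g_comm hba, mul_assoc]
  rw [z, z, key a b hac hcb hab, key b a hcb.symm hac.symm hba, h1]

/-- `g_k` commutes with both `e_j` and `e_j'`, so the path may be prolonged or shortened by this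
edge. -/
theorem z_congr {i j j' k : V} (htree : M.IsTree) (hj : M.Adj j j') (h : ¬ M.Adj j k)
    (h' : ¬ M.Adj j' k) : R.z i j k = R.z i j' k := by
  have h1 : R.q i j * (R.g k * R.p i j) = R.q i j' * (R.g k * R.p i j') := by
    rw [← R.q_mul_e_adj hconn htree hj, ← R.e_mul_p_adj hconn htree hj, mul_assoc,
      ← mul_assoc (R.g k), ← mul_assoc (R.e j), ← mul_assoc (R.e j), R.e_g_comm h,
      mul_assoc (R.g k), R.e_sq, mul_smul_comm, smul_mul_assoc, mul_smul_comm, ← smul_mul_assoc,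
      ← R.q_mul_e hconn, mul_assoc, mul_assoc, ← mul_assoc (R.e j'), R.e_g_comm h', mul_assoc,
      R.e_e_p hconn hj.symm]
  rw [z, z, h1]

end Relations

end Rep

end BMW

/-! ### Elements attached to a root and an orthogonal node -/

namespace Diagram

section

variable {V : Type*} [Fintype V] {M : SimpleGraph V}

theorem coroot_simpleRoot_ne_one (j k : V) : coroot M k (simpleRoot j) ≠ 1 := by
  by_cases hkj : k = j
  · subst hkj; rw [coroot_self]; norm_num
  · by_cases hadj : M.Adj k j
    · rw [coroot_adj M hadj]; norm_num
    · rw [coroot_not_adj M hkj hadj]; norm_num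

theorem IsPosRoot.exists_coroot_eq_one (hM : FormPos M) {β : V → ℤ} (h : IsPosRoot M β)
    (hβ : ∀ j, β ≠ simpleRoot j) : ∃ k, coroot M k β = 1 := by
  obtain ⟨j, hj⟩ := h.exists_support
  obtain ⟨k, hk, -⟩ := h.exists_descent hM hj (hβ j)
  exact ⟨k, hk⟩

theorem coroot_sub (k j : V) (v : V → ℤ) :
    coroot M k (v - simpleRoot j) = coroot M k v - coroot M k (simpleRoot j) := map_sub _ _ _

theorem coroot_add (k j : V) (v : V → ℤ) :
    coroot M k (v + simpleRoot j) = coroot M k v + coroot M k (simpleRoot j) := map_add _ _ _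

theorem not_adj_of_adj_of_adj (htree : M.IsTree) {a b c : V} (hab : M.Adj a b)
    (hbc : M.Adj b c) : ¬ M.Adj a c := by
  intro hac
  have h1 := htree.dist_ne_of_adj a hbc
  rw [SimpleGraph.dist_eq_one_iff_adj.mpr hab, SimpleGraph.dist_eq_one_iff_adj.mpr hac] at h1
  exact h1 rfl

theorem simpleRoot_orthogonal {j k : V} (h : coroot M k (simpleRoot j) = 0) :
    j ≠ k ∧ ¬ M.Adj j k := by
  refine ⟨?_, fun hadj => ?_⟩
  · rintro rfl; rw [coroot_self] at h; norm_num at h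
  · rw [coroot_adj M hadj.symm] at h; norm_num at h

theorem ne_of_coroot_ne {j k : V} {v : V → ℤ} (h : coroot M j v ≠ coroot M k v) : j ≠ k := by
  rintro rfl; exact h rfl

end

end Diagram

namespace BMW

open Diagram

namespace Rep

variable {V : Type*} [Fintype V] {M : SimpleGraph V} {A : Type*} [Ring A] [Algebra Qlx A]
  (R : Rep M A)

/-- The elements of `e i A e i` attached to pairs of a positive root and an orthogonal node. -/
inductive H (i : V) : (V → ℤ) → V → A → Prop
  | base (j k : V) (hne : j ≠ k) (hadj : ¬ M.Adj j k) : H i (simpleRoot j) k (R.z i j k)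
  | comm (β : V → ℤ) (j k : V) (y : A) (hβ : IsPosRoot M β) (hk : coroot M k β = 0)
      (hj : coroot M j β = 1) (hadj : ¬ M.Adj j k) (h : H i (β - simpleRoot j) k y) : H i β k y
  -- `r_k r_j` sends `β` to `β - α_j - α_k` and `α_k` to `α_j`: the root and the orthogonal node
  -- move together.
  | braid (β : V → ℤ) (j k : V) (y : A) (hβ : IsPosRoot M β) (hk : coroot M k β = 0)
      (hj : coroot M j β = 1) (hadj : M.Adj j k)
      (h : H i (β - simpleRoot j - simpleRoot k) j y) : H i β k y

variable {R} {i : V}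

theorem H.isPosRoot {β : V → ℤ} {k : V} {y : A} (h : R.H i β k y) : IsPosRoot M β := by
  cases h with
  | base j => exact isPosRoot_simpleRoot j
  | comm => assumption
  | braid => assumption

theorem H.orthogonal {β : V → ℤ} {k : V} {y : A} (h : R.H i β k y) : coroot M k β = 0 := by
  cases h with
  | base j k hne hadj => exact coroot_not_adj M (Ne.symm hne) fun h => hadj h.symm
  | comm => assumption
  | braid => assumption

theorem H.exists_eq_z {β : V → ℤ} {k : V} {y : A} (h : R.H i β k y) :
    ∃ j k', j ≠ k' ∧ ¬ M.Adj j k' ∧ y = R.z i j k' := by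
  induction h with
  | base j k hne hadj => exact ⟨j, k, hne, hadj, rfl⟩
  | comm _ _ _ _ _ _ _ _ _ ih => exact ih
  | braid _ _ _ _ _ _ _ _ _ ih => exact ih

variable (R i) in
/-- The last step of a derivation of `H`, by means of the node `j`. -/
def HStep (β : V → ℤ) (k : V) (y : A) (j : V) : Prop :=
  coroot M j β = 1 ∧ ((¬ M.Adj j k ∧ R.H i (β - simpleRoot j) k y) ∨
    (M.Adj j k ∧ R.H i (β - simpleRoot j - simpleRoot k) j y))

theorem H.inv {β : V → ℤ} {k : V} {y : A} (h : R.H i β k y) :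
    (∃ j, β = simpleRoot j ∧ y = R.z i j k) ∨ ∃ j, R.HStep i β k y j := by
  cases h with
  | base j k hne hadj => exact Or.inl ⟨j, rfl, rfl⟩
  | comm β j k y hβ hk hj hadj h => exact Or.inr ⟨j, hj, Or.inl ⟨hadj, h⟩⟩
  | braid β j k y hβ hk hj hadj h => exact Or.inr ⟨j, hj, Or.inr ⟨hadj, h⟩⟩

section

variable (hM : FormPos M)
include hM

variable (R i) in
theorem exists_H {β : V → ℤ} (h : IsPosRoot M β) {k : V} (hk : coroot M k β = 0) :
    ∃ y, R.H i β k y := by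
  suffices ∀ n β k, height β = n → IsPosRoot M β → coroot M k β = 0 → ∃ y, R.H i β k y from
    this _ β k rfl h hk
  intro n
  induction n using Nat.strong_induction_on with
  | _ n ih =>
  intro β k hn h hk
  by_cases hβ : ∃ j, β = simpleRoot j
  · obtain ⟨j, rfl⟩ := hβ
    obtain ⟨h1, h2⟩ := simpleRoot_orthogonal hk
    exact ⟨_, H.base j k h1 h2⟩
  · push Not at hβ
    obtain ⟨j, hj⟩ := h.exists_coroot_eq_one hM hβ
    have h1 := h.sub hM hj
    have h2 := h.height_sub hM hj
    have hjk : j ≠ k := ne_of_coroot_ne (M := M) (v := β) (by omega)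
    by_cases hadj : M.Adj j k
    · have c1 := coroot_adj M hadj
      have c2 := coroot_adj M hadj.symm
      have h3 : coroot M k (β - simpleRoot j) = 1 := by rw [coroot_sub]; omega
      have h4 := h1.height_sub hM h3
      obtain ⟨y, hy⟩ := ih _ (by omega) (β - simpleRoot j - simpleRoot k) j rfl (h1.sub hM h3)
        (by rw [coroot_sub, coroot_sub, coroot_self]; omega)
      exact ⟨y, H.braid β j k y h hk hj hadj hy⟩
    · have c2 := coroot_not_adj M hjk.symm fun h' => hadj h'.symm
      obtain ⟨y, hy⟩ := ih _ (by omega) (β - simpleRoot j) k rfl h1 (by rw [coroot_sub]; omega)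
      exact ⟨y, H.comm β j k y h hk hj hadj hy⟩

variable (hconn : M.Connected) (htree : M.IsTree)
include hconn htree

/-- A diamond argument: two last steps, by `j` and `j'`, are completed to a common lower pair, where
induction on the height applies. The exceptions are `β = α_j + α_j'` and `β = α_j + α_k + α_j'`;
there `z_congr` and `z_swap` close the diamond. -/
theorem HStep.unique {β : V → ℤ} (h : IsPosRoot M β) {k : V} (hk : coroot M k β = 0)
    (ih : ∀ γ k' y y', height γ < height β → R.H i γ k' y → R.H i γ k' y' → y = y')
    {y y' : A} {j j' : V} (hy : R.HStep i β k y j) (hy' : R.HStep i β k y' j') : y = y' := by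
  obtain ⟨hj, hy⟩ := hy
  obtain ⟨hj', hy'⟩ := hy'
  have p1 := h.sub hM hj
  have p1' := h.sub hM hj'
  have t1 := h.height_sub hM hj
  have t1' := h.height_sub hM hj'
  have hjk : j ≠ k := ne_of_coroot_ne (M := M) (v := β) (by omega)
  have hjk' : j' ≠ k := ne_of_coroot_ne (M := M) (v := β) (by omega)
  have t2 : M.Adj j k → height (β - simpleRoot j - simpleRoot k) < height β := fun hadj => by
    have c1 := coroot_adj M hadj.symm
    have := p1.height_sub hM (k := k) (by rw [coroot_sub]; omega)
    omega
  have t2' : M.Adj j' k → height (β - simpleRoot j' - simpleRoot k) < height β := fun hadj => by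
    have c1 := coroot_adj M hadj.symm
    have := p1'.height_sub hM (k := k) (by rw [coroot_sub]; omega)
    omega
  by_cases hjj : j = j'
  · subst hjj
    rcases hy with ⟨hadj, hy⟩ | ⟨hadj, hy⟩ <;> rcases hy' with ⟨hadj', hy'⟩ | ⟨hadj', hy'⟩
    · exact ih _ _ _ _ (by omega) hy hy'
    · exact absurd hadj' hadj
    · exact absurd hadj hadj'
    · exact ih _ _ _ _ (t2 hadj) hy hy'
  by_cases hadjj : M.Adj j j'
  · have c1 := coroot_adj M hadjj
    have c2 := coroot_adj M hadjj.symm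
    have hβ : β - simpleRoot j = simpleRoot j' :=
      p1.eq_of_two_le hM (by rw [coroot_sub]; omega)
    have hβ' : β - simpleRoot j' = simpleRoot j :=
      p1'.eq_of_two_le hM (by rw [coroot_sub]; omega)
    have hsum : coroot M k (simpleRoot j) + coroot M k (simpleRoot j') = 0 := by
      rw [← hk, ← hβ, coroot_sub]; ring
    have hnadj : ¬ M.Adj j k := fun hadj => by
      rw [coroot_adj M hadj.symm, coroot_not_adj M hjk'.symm
        (not_adj_of_adj_of_adj htree hadj.symm hadjj)] at hsum
      norm_num at hsum
    have hnadj' : ¬ M.Adj j' k := fun hadj => by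
      rw [coroot_adj M hadj.symm, coroot_not_adj M hjk.symm
        (not_adj_of_adj_of_adj htree hadj.symm hadjj.symm)] at hsum
      norm_num at hsum
    have e1 : y = R.z i j' k := by
      rcases hy with ⟨-, hy⟩ | ⟨hadj, -⟩
      · exact ih _ _ _ _ (by omega) hy (by rw [hβ]; exact H.base j' k hjk' hnadj')
      · exact absurd hadj hnadj
    have e2 : y' = R.z i j k := by
      rcases hy' with ⟨-, hy'⟩ | ⟨hadj, -⟩
      · exact ih _ _ _ _ (by omega) hy' (by rw [hβ']; exact H.base j k hjk hnadj)
      · exact absurd hadj hnadj'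
    rw [e1, e2]
    exact R.z_congr hconn htree hadjj.symm hnadj' hnadj
  have c1 := coroot_not_adj M hjj hadjj
  have c2 := coroot_not_adj M (Ne.symm hjj) fun h => hadjj h.symm
  -- One step replaces `k` by `j`, the other keeps `k`; both continue to the node `j` at `β - α_j -
  -- α_k - α_j'`.
  have mixed : ∀ {j j' : V} {y y' : A}, coroot M j β = 1 → coroot M j' β = 1 → j ≠ j' →
      j ≠ k → j' ≠ k → ¬ M.Adj j j' → M.Adj j k → ¬ M.Adj j' k →
      R.H i (β - simpleRoot j - simpleRoot k) j y → R.H i (β - simpleRoot j') k y' → y = y' := by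
    intro j j' y y' hj hj' hjj hjk hjk' hadjj hadj hadj' hy hy'
    have p1 := h.sub hM hj
    have p1' := h.sub hM hj'
    have t1 := h.height_sub hM hj
    have t1' := h.height_sub hM hj'
    have c1 := coroot_not_adj M hjj hadjj
    have c2 := coroot_not_adj M (Ne.symm hjj) fun h => hadjj h.symm
    have c3 := coroot_adj M hadj
    have c4 := coroot_adj M hadj.symm
    have c5 := coroot_not_adj M hjk' hadj'
    have c6 := coroot_not_adj M hjk'.symm fun h => hadj' h.symm
    have d1 : coroot M k (β - simpleRoot j) = 1 := by rw [coroot_sub]; omega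
    have p2 := p1.sub hM d1
    have t2 := p1.height_sub hM d1
    have d2 : coroot M j' (β - simpleRoot j - simpleRoot k) = 1 := by
      rw [coroot_sub, coroot_sub]; omega
    have d3 : coroot M j (β - simpleRoot j - simpleRoot k) = 0 := by
      rw [coroot_sub, coroot_sub, coroot_self]; omega
    obtain ⟨u, hu⟩ := R.exists_H i hM (p2.sub hM d2) (k := j) (by rw [coroot_sub]; omega)
    have e1 : y = u := ih _ _ _ _ (by omega) hy
      (H.comm _ j' j u p2 d3 d2 (fun h => hadjj h.symm) hu)
    have e2 : y' = u := ih _ _ _ _ (by omega) hy'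
      (H.braid _ j k u p1' (by rw [coroot_sub]; omega) (by rw [coroot_sub]; omega) hadj (by
        rw [sub_right_comm β, sub_right_comm (β - simpleRoot j)]; exact hu))
    rw [e1, e2]
  rcases hy with ⟨hadj, hy⟩ | ⟨hadj, hy⟩ <;> rcases hy' with ⟨hadj', hy'⟩ | ⟨hadj', hy'⟩
  · have c3 := coroot_not_adj M hjk.symm fun h => hadj h.symm
    have c4 := coroot_not_adj M hjk'.symm fun h => hadj' h.symm
    have d1 : coroot M j' (β - simpleRoot j) = 1 := by rw [coroot_sub]; omega
    have d2 : coroot M j (β - simpleRoot j') = 1 := by rw [coroot_sub]; omega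
    obtain ⟨u, hu⟩ := R.exists_H i hM (p1.sub hM d1) (k := k)
      (by rw [coroot_sub, coroot_sub]; omega)
    have e1 : y = u := ih _ _ _ _ (by omega) hy
      (H.comm _ j' k u p1 (by rw [coroot_sub]; omega) d1 hadj' hu)
    have e2 : y' = u := ih _ _ _ _ (by omega) hy'
      (H.comm _ j k u p1' (by rw [coroot_sub]; omega) d2 hadj (by rw [sub_right_comm]; exact hu))
    rw [e1, e2]
  · exact (mixed hj' hj (Ne.symm hjj) hjk' hjk (fun h => hadjj h.symm) hadj' hadj hy' hy).symm
  · exact mixed hj hj' hjj hjk hjk' hadjj hadj hadj' hy hy'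
  · have c3 := coroot_adj M hadj
    have c4 := coroot_adj M hadj.symm
    have c5 := coroot_adj M hadj'
    have c6 := coroot_adj M hadj'.symm
    have p2 := p1.sub hM (k := k) (by rw [coroot_sub]; omega)
    have p2' := p1'.sub hM (k := k) (by rw [coroot_sub]; omega)
    have hβ : β - simpleRoot j - simpleRoot k = simpleRoot j' :=
      p2.eq_of_two_le hM (by rw [coroot_sub, coroot_sub]; omega)
    have hβ' : β - simpleRoot j' - simpleRoot k = simpleRoot j :=
      p2'.eq_of_two_le hM (by rw [coroot_sub, coroot_sub]; omega)
    have e1 : y = R.z i j' j := ih _ _ _ _ (t2 hadj) hy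
      (by rw [hβ]; exact H.base j' j (Ne.symm hjj) fun h => hadjj h.symm)
    have e2 : y' = R.z i j j' := ih _ _ _ _ (t2' hadj') hy'
      (by rw [hβ']; exact H.base j j' hjj hadjj)
    rw [e1, e2]
    exact (R.z_swap hconn htree hadj hadj'.symm hadjj).symm

theorem H.unique {β : V → ℤ} {k : V} {y y' : A} (hy : R.H i β k y) (hy' : R.H i β k y') :
    y = y' := by
  suffices ∀ n β k y y', height β = n → R.H i β k y → R.H i β k y' → y = y' from
    this _ β k y y' rfl hy hy'
  intro n
  induction n using Nat.strong_induction_on with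
  | _ n ih =>
  intro β k y y' hn hy hy'
  rcases hy.inv with ⟨j, hj, e⟩ | ⟨j, hj⟩ <;> rcases hy'.inv with ⟨j', hj', e'⟩ | ⟨j', hj'⟩
  · rw [e, e', simpleRoot_injective (hj.symm.trans hj')]
  · rw [hj] at hj'; exact absurd hj'.1 (coroot_simpleRoot_ne_one j j')
  · rw [hj'] at hj; exact absurd hj.1 (coroot_simpleRoot_ne_one j' j)
  · exact HStep.unique hM hconn htree hy.isPosRoot hy.orthogonal
      (fun γ k' y y' hlt => ih _ (hn ▸ hlt) γ k' y y' rfl) hj hj'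

end

end Rep

end BMW

/-! ### Transport to the highest root and the braid relations -/

namespace BMW

open Diagram

namespace Rep

section HeckeGenerators

variable {V : Type*} [Fintype V] {M : SimpleGraph V} {A : Type*} [Ring A] [Algebra Qlx A]
  {R : Rep M A} {i : V}

theorem H.up_comm {β : V → ℤ} {k j : V} {y : A} (h : R.H i β k y) (hj : coroot M j β = -1)
    (hadj : ¬ M.Adj j k) : R.H i (β + simpleRoot j) k y := by
  have hk := h.orthogonal
  have hjk : j ≠ k := ne_of_coroot_ne (M := M) (v := β) (by omega)
  have c := coroot_not_adj M hjk.symm fun h => hadj h.symm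
  refine H.comm _ j k y (h.isPosRoot.add hj) (by rw [coroot_add]; omega)
    (by rw [coroot_add, coroot_self]; omega) hadj ?_
  rwa [add_sub_cancel_right]

theorem H.up_braid {β : V → ℤ} {k j : V} {y : A} (h : R.H i β k y) (hj : coroot M j β = -1)
    (hadj : M.Adj j k) : R.H i (β + simpleRoot j + simpleRoot k) j y := by
  have hk := h.orthogonal
  have c := coroot_adj M hadj
  have c' := coroot_adj M hadj.symm
  refine H.braid _ k j y ((h.isPosRoot.add hj).add (by rw [coroot_add]; omega))
    (by rw [coroot_add, coroot_add, coroot_self]; omega)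
    (by rw [coroot_add, coroot_add, coroot_self]; omega) hadj.symm ?_
  rwa [add_sub_cancel_right, add_sub_cancel_right]

/-- A maximal root carrying `y` admits no step up, so it is dominant, and the dominant root is
unique. -/
theorem H.exists_dominant (hM : FormPos M) (hconn : M.Connected) (hsph : IsSpherical M)
    {β₀ : V → ℤ} (hβ₀ : IsDominant M β₀) {β : V → ℤ} {k : V} {y : A} (h : R.H i β k y) :
    ∃ c, R.H i β₀ c y := by
  have hfin : {γ | ∃ c, R.H i γ c y}.Finite :=
    (finite_roots hsph).subset fun γ ⟨_, hγ⟩ => hγ.isPosRoot.mem_roots hM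
  obtain ⟨γ, ⟨c, hγ⟩, hmax⟩ := hfin.exists_maximal ⟨β, k, h⟩
  have hdom : IsDominant M γ := by
    refine ⟨hγ.isPosRoot, fun j => ?_⟩
    by_contra hj
    have hj' : coroot M j γ = -1 := by
      have := hγ.isPosRoot.neg_one_le_coroot hM j
      omega
    have hle : γ ≤ γ + simpleRoot j := le_add_of_nonneg_right (simpleRoot_nonneg j)
    by_cases hadj : M.Adj j c
    · have hle' : γ ≤ γ + simpleRoot j + simpleRoot c :=
        hle.trans (le_add_of_nonneg_right (simpleRoot_nonneg c))
      have : (γ + simpleRoot j + simpleRoot c) j ≤ γ j :=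
        hmax ⟨j, hγ.up_braid hj' hadj⟩ hle' j
      have h0 : 0 ≤ (simpleRoot c : V → ℤ) j := simpleRoot_nonneg c j
      rw [Pi.add_apply, Pi.add_apply, simpleRoot_self] at this
      omega
    · have : (γ + simpleRoot j) j ≤ γ j := hmax ⟨c, hγ.up_comm hj' hadj⟩ hle j
      rw [Pi.add_apply, simpleRoot_self] at this
      omega
  exact ⟨c, by rwa [hβ₀.unique hM hconn hdom]⟩

variable (M) in
/-- The braid relation prescribed by the diagram for a pair of nodes. -/
def BraidRel (k k' : V) (y y' : A) : Prop :=
  (¬ M.Adj k k' → y * y' = y' * y) ∧ (M.Adj k k' → y * (y' * y) = y' * (y * y'))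

theorem BraidRel.symm {k k' : V} {y y' : A} (h : BraidRel M k k' y y') : BraidRel M k' k y' y :=
  ⟨fun h' => (h.1 fun h'' => h' h''.symm).symm, fun h' => (h.2 h'.symm).symm⟩

theorem BraidRel.of_not_adj {k k' a a' : V} {y y' : A} (h : BraidRel M a a' y y')
    (ha : ¬ M.Adj a a') (hk : ¬ M.Adj k k') : BraidRel M k k' y y' :=
  ⟨fun _ => h.1 ha, fun h' => absurd h' hk⟩

section

variable (hM : FormPos M) (hconn : M.Connected) (htree : M.IsTree)
include hM hconn htree

/-- Induction on the height: stepping down through a node `j` carries the two nodes to another pair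
with the same adjacency, until `β` is simple and the relations are those between the `z`. -/
theorem H.braidRel {β : V → ℤ} {k k' : V} {y y' : A} (hy : R.H i β k y) (hy' : R.H i β k' y') :
    BraidRel M k k' y y' := by
  suffices ∀ n β k k' y y', height β = n → R.H i β k y → R.H i β k' y' → BraidRel M k k' y y' from
    this _ β k k' y y' rfl hy hy'
  intro n
  induction n using Nat.strong_induction_on with
  | _ n ih =>
  intro β k k' y y' hn hy hy'
  have h := hy.isPosRoot
  have hk := hy.orthogonal
  have hk' := hy'.orthogonal
  by_cases hkk : k = k'
  · subst hkk
    rw [hy.unique hM hconn htree hy']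
    exact ⟨fun _ => rfl, fun _ => rfl⟩
  by_cases hβ : ∃ j, β = simpleRoot j
  · obtain ⟨j, rfl⟩ := hβ
    obtain ⟨h1, h2⟩ := simpleRoot_orthogonal hk
    obtain ⟨h1', h2'⟩ := simpleRoot_orthogonal hk'
    rw [hy.unique hM hconn htree (H.base j k h1 h2), hy'.unique hM hconn htree (H.base j k' h1' h2')]
    exact ⟨fun h => R.z_comm hconn h2 h2' h, fun h => R.z_braid hconn h2 h2' h⟩
  push Not at hβ
  obtain ⟨j, hj⟩ := h.exists_coroot_eq_one hM hβ
  have p1 := h.sub hM hj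
  have t1 := h.height_sub hM hj
  have hjk : j ≠ k := ne_of_coroot_ne (M := M) (v := β) (by omega)
  have hjk' : j ≠ k' := ne_of_coroot_ne (M := M) (v := β) (by omega)
  have mixed : ∀ {k k' : V} {y y' : A}, R.H i β k y → R.H i β k' y' → k ≠ k' → j ≠ k → j ≠ k' →
      M.Adj j k → ¬ M.Adj j k' → BraidRel M k k' y y' := by
    intro k k' y y' hy hy' hkk hjk hjk' hadj hadj'
    have hk := hy.orthogonal
    have hk' := hy'.orthogonal
    have c1 := coroot_adj M hadj
    have c2 := coroot_adj M hadj.symm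
    have c3 := coroot_not_adj M hjk' hadj'
    have c4 := coroot_not_adj M hjk'.symm fun h => hadj' h.symm
    have d1 : coroot M k (β - simpleRoot j) = 1 := by rw [coroot_sub]; omega
    have d2 : coroot M k' (β - simpleRoot j) = 0 := by rw [coroot_sub]; omega
    have p2 := p1.sub hM d1
    have t2 := p1.height_sub hM d1
    have d3 : coroot M j (β - simpleRoot j - simpleRoot k) = 0 := by
      rw [coroot_sub, coroot_sub, coroot_self]; omega
    -- The pair `(k, k')` becomes `(j, k)` if its nodes are adjacent and `(j, k')` if not.
    by_cases hkadj : M.Adj k k'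
    · have c5 := coroot_adj M hkadj
      have c6 := coroot_adj M hkadj.symm
      have d4 : coroot M k' (β - simpleRoot j - simpleRoot k) = 1 := by rw [coroot_sub]; omega
      have p3 := p2.sub hM d4
      have t3 := p2.height_sub hM d4
      obtain ⟨u, hu⟩ := R.exists_H i hM p3 (k := j) (by rw [coroot_sub]; omega)
      obtain ⟨u', hu'⟩ := R.exists_H i hM p3 (k := k)
        (by rw [coroot_sub, coroot_sub, coroot_self]; omega)
      have e1 := hy.unique hM hconn htree (H.braid β j k u h hk hj hadj
        (H.comm _ k' j u p2 d3 d4 (fun h => hadj' h.symm) hu))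
      have e2 := hy'.unique hM hconn htree (H.comm β j k' u' h hk' hj hadj'
        (H.braid _ k k' u' p1 d2 d1 hkadj hu'))
      rw [e1, e2]
      have := ih _ (by omega) _ j k u u' rfl hu hu'
      exact ⟨fun h => absurd hkadj h, fun _ => this.2 hadj⟩
    · have c5 := coroot_not_adj M hkk hkadj
      have c6 := coroot_not_adj M hkk.symm fun h => hkadj h.symm
      obtain ⟨u, hu⟩ := R.exists_H i hM p2 (k := j) d3
      obtain ⟨u', hu'⟩ := R.exists_H i hM p2 (k := k') (by rw [coroot_sub]; omega)
      have e1 := hy.unique hM hconn htree (H.braid β j k u h hk hj hadj hu)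
      have e2 := hy'.unique hM hconn htree (H.comm β j k' u' h hk' hj hadj'
        (H.comm _ k k' u' p1 d2 d1 hkadj hu'))
      rw [e1, e2]
      exact (ih _ (by omega) _ j k' u u' rfl hu hu').of_not_adj hadj' hkadj
  by_cases hadj : M.Adj j k <;> by_cases hadj' : M.Adj j k'
  -- A tree has no triangle, so `k` and `k'` are not adjacent. At `β - α_j - α_k - α_k' - α_j` the
  -- pair has become `(k', k)`.
  · have hkadj := not_adj_of_adj_of_adj htree hadj.symm hadj'
    have c1 := coroot_adj M hadj
    have c2 := coroot_adj M hadj.symm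
    have c3 := coroot_adj M hadj'
    have c4 := coroot_adj M hadj'.symm
    have c5 := coroot_not_adj M hkk hkadj
    have c6 := coroot_not_adj M (Ne.symm hkk) fun h => hkadj h.symm
    have d1 : coroot M k (β - simpleRoot j) = 1 := by rw [coroot_sub]; omega
    have d1' : coroot M k' (β - simpleRoot j) = 1 := by rw [coroot_sub]; omega
    have p2 := p1.sub hM d1
    have p2' := p1.sub hM d1'
    have t2 := p1.height_sub hM d1
    have d2 : coroot M k' (β - simpleRoot j - simpleRoot k) = 1 := by rw [coroot_sub]; omega
    have d2' : coroot M k (β - simpleRoot j - simpleRoot k') = 1 := by rw [coroot_sub]; omega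
    have p3 := p2.sub hM d2
    have t3 := p2.height_sub hM d2
    have d3 : coroot M j (β - simpleRoot j - simpleRoot k - simpleRoot k') = 1 := by
      rw [coroot_sub, coroot_sub, coroot_sub, coroot_self]; omega
    have p4 := p3.sub hM d3
    have t4 := p3.height_sub hM d3
    obtain ⟨u, hu⟩ := R.exists_H i hM p4 (k := k')
      (by rw [coroot_sub, coroot_sub, coroot_sub, coroot_sub, coroot_self]; omega)
    obtain ⟨u', hu'⟩ := R.exists_H i hM p4 (k := k)
      (by rw [coroot_sub, coroot_sub, coroot_sub, coroot_sub, coroot_self]; omega)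
    have e1 := hy.unique hM hconn htree (H.braid β j k u h hk hj hadj
      (H.braid _ k' j u p2 (by rw [coroot_sub, coroot_sub, coroot_self]; omega) d2 hadj'.symm hu))
    have e2 := hy'.unique hM hconn htree (H.braid β j k' u' h hk' hj hadj'
      (H.braid _ k j u' p2' (by rw [coroot_sub, coroot_sub, coroot_self]; omega) d2' hadj.symm
        (by rw [sub_right_comm (β - simpleRoot j)]; exact hu')))
    rw [e1, e2]
    exact (ih _ (by omega) _ k' k u u' rfl hu hu').of_not_adj (fun h => hkadj h.symm) hkadj
  · exact mixed hy hy' hkk hjk hjk' hadj hadj'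
  · exact (mixed hy' hy (Ne.symm hkk) hjk' hjk hadj' hadj).symm
  · have c1 := coroot_not_adj M hjk.symm fun h => hadj h.symm
    have c2 := coroot_not_adj M hjk'.symm fun h => hadj' h.symm
    obtain ⟨u, hu⟩ := R.exists_H i hM p1 (k := k) (by rw [coroot_sub]; omega)
    obtain ⟨u', hu'⟩ := R.exists_H i hM p1 (k := k') (by rw [coroot_sub]; omega)
    rw [hy.unique hM hconn htree (H.comm β j k u h hk hj hadj hu),
      hy'.unique hM hconn htree (H.comm β j k' u' h hk' hj hadj' hu')]
    exact ih _ (by omega) _ k k' u u' rfl hu hu'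

end

end HeckeGenerators

/-! ### The image of the Hecke algebra of type `C` -/

section HeckeSpan

variable {V : Type*} [Fintype V] {M : SimpleGraph V} {A : Type*} [Ring A] [Algebra Qlx A]
  (R : Rep M A)

/-- The product of the `f k` along a reduced word of `w`. -/
noncomputable def reducedProd (f : V → A) (w : W M) : A := ((reducedWord M w).map f).prod

theorem reducedProd_wordProd {f : V → A} (hf : ∀ k k', BraidRel M k k' (f k) (f k')) {ω : List V}
    (hω : (cox M).IsReduced ω) : reducedProd f ((cox M).wordProd ω) = (ω.map f).prod :=
  prod_map_eq_of_isReduced M f (fun k k' => (hf k k').1) (fun k k' => (hf k k').2) _ _ _ rfl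
    (reducedWord_isReduced M _) hω (wordProd_reducedWord M _)

theorem reducedProd_simple_mul {f : V → A} (hf : ∀ k k', BraidRel M k k' (f k) (f k')) {k : V}
    {w : W M} (h : (cox M).length ((cox M).simple k * w) = (cox M).length w + 1) :
    reducedProd f ((cox M).simple k * w) = f k * reducedProd f w := by
  obtain ⟨ω, hω, rfl⟩ := (cox M).exists_isReduced w
  rw [← CoxeterSystem.wordProd_cons] at h ⊢
  have hr : (cox M).IsReduced (k :: ω) := by
    rw [CoxeterSystem.IsReduced, h, hω.eq, List.length_cons]
  rw [reducedProd_wordProd hf hr, reducedProd_wordProd hf hω, List.map_cons, List.prod_cons]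

theorem reducedProd_one {f : V → A} (hf : ∀ k k', BraidRel M k k' (f k) (f k')) :
    reducedProd f (1 : W M) = 1 := by
  have := reducedProd_wordProd hf (ω := []) (by simp [CoxeterSystem.IsReduced])
  simpa using this

open Classical in
/-- The images of the generators of the Hecke algebra, attached to a root `β`. -/
noncomputable def hecke (i : V) (β : V → ℤ) (k : V) : A :=
  if h : ∃ y, R.H i β k y then h.choose else 0

/-- The span of the images of the standard basis of the Hecke algebra of the nodes in `C`. -/
noncomputable def heckeSpan (i : V) (β : V → ℤ) : Submodule Qlx A :=
  Submodule.span Qlx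
    (Set.range fun w : parabolic M (nodesC M) => reducedProd (R.hecke i β) w.1 * R.e i)

variable (hM : FormPos M) (hconn : M.Connected) (htree : M.IsTree)
include hM

theorem hecke_spec (i : V) {β : V → ℤ} (hβ : IsPosRoot M β) {k : V} (hk : coroot M k β = 0) :
    R.H i β k (R.hecke i β k) := by
  have := R.exists_H i hM hβ hk
  rw [hecke, dif_pos this]
  exact this.choose_spec

omit hM in
theorem hecke_eq_zero (i : V) {β : V → ℤ} {k : V} (hk : coroot M k β ≠ 0) :
    R.hecke i β k = 0 := by
  rw [hecke, dif_neg]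
  rintro ⟨y, hy⟩
  exact hk hy.orthogonal

include hconn

theorem e_mul_hecke (i : V) {β : V → ℤ} (hβ : IsPosRoot M β) (k : V) :
    R.e i * R.hecke i β k = Qlx.x • R.hecke i β k := by
  by_cases hk : coroot M k β = 0
  · obtain ⟨a, b, -, -, hz⟩ := (R.hecke_spec hM i hβ hk).exists_eq_z
    rw [hz, R.e_mul_z hconn]
  · rw [R.hecke_eq_zero i hk, mul_zero, smul_zero]

theorem e_mul_of_mem_heckeSpan (i : V) {β : V → ℤ} (hβ : IsPosRoot M β) {y : A}
    (hy : y ∈ R.heckeSpan i β) : R.e i * y = Qlx.x • y := by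
  refine Submodule.span_induction (p := fun y _ => R.e i * y = Qlx.x • y) ?_ ?_ ?_ ?_ hy
  · rintro _ ⟨w, rfl⟩
    show R.e i * (reducedProd (R.hecke i β) w.1 * R.e i) =
      Qlx.x • (reducedProd (R.hecke i β) w.1 * R.e i)
    rw [reducedProd]
    cases reducedWord M w.1 with
    | nil => simp only [List.map_nil, List.prod_nil, one_mul, e_sq]
    | cons k ω =>
      simp only [List.map_cons, List.prod_cons]
      rw [mul_assoc, ← mul_assoc, R.e_mul_hecke hM hconn i hβ, smul_mul_assoc]
  · rw [mul_zero, smul_zero]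
  · intro y y' _ _ h h'; rw [mul_add, h, h', smul_add]
  · intro c y _ h; rw [mul_smul_comm, h, smul_comm]

include htree

/-- The default value `0` at nodes not orthogonal to `β` satisfies every braid relation, so
Matsumoto's theorem can be used in `W` itself instead of `W_C`. -/
theorem hecke_braidRel (i : V) {β : V → ℤ} (hβ : IsPosRoot M β) (k k' : V) :
    BraidRel M k k' (R.hecke i β k) (R.hecke i β k') := by
  by_cases hk : coroot M k β = 0
  · by_cases hk' : coroot M k' β = 0
    · exact (R.hecke_spec hM i hβ hk).braidRel hM hconn htree (R.hecke_spec hM i hβ hk')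
    · rw [R.hecke_eq_zero i hk']; exact ⟨fun _ => by simp, fun _ => by simp⟩
  · rw [R.hecke_eq_zero i hk]; exact ⟨fun _ => by simp, fun _ => by simp⟩

theorem e_mem_heckeSpan (i : V) {β : V → ℤ} (hβ : IsPosRoot M β) :
    R.e i ∈ R.heckeSpan i β := by
  refine Submodule.subset_span ⟨1, ?_⟩
  show reducedProd (R.hecke i β) (1 : W M) * R.e i = R.e i
  rw [reducedProd_one (R.hecke_braidRel hM hconn htree i hβ), one_mul]

variable (horth : ∀ i j, i ≠ j → ¬ M.Adj i j → R.e i * R.e j = 0) (hsph : IsSpherical M)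
include horth hsph

/-- The usual rule for a generator times a standard basis element: if the length grows, the product
is another basis element; otherwise a factor splits off and `z_sq` applies. -/
theorem hecke_mul_mem (i : V) {β : V → ℤ} (hβ : IsDominant M β) {k : V}
    (hk : coroot M k β = 0) {y : A} (hy : y ∈ R.heckeSpan i β) :
    R.hecke i β k * y ∈ R.heckeSpan i β := by
  have hbr := R.hecke_braidRel hM hconn htree i hβ.1
  have hmem : (cox M).simple k ∈ parabolic M (nodesC M) :=
    Subgroup.subset_closure ⟨k, (hβ.mem_nodesC_iff hM hconn hsph).mpr hk, rfl⟩
  have hgen : ∀ w : parabolic M (nodesC M), reducedProd (R.hecke i β) w.1 * R.e i ∈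
      R.heckeSpan i β := fun w => Submodule.subset_span ⟨w, rfl⟩
  refine Submodule.span_induction (p := fun y _ => R.hecke i β k * y ∈ R.heckeSpan i β) ?_ ?_ ?_ ?_ hy
  · rintro _ ⟨w, rfl⟩
    show R.hecke i β k * (reducedProd (R.hecke i β) w.1 * R.e i) ∈ R.heckeSpan i β
    have hgen' := hgen ⟨(cox M).simple k * w.1, mul_mem hmem w.2⟩
    rcases (cox M).length_simple_mul w.1 k with hl | hl
    · rw [← mul_assoc, ← reducedProd_simple_mul hbr hl]
      exact hgen'
    · have hw : (cox M).simple k * ((cox M).simple k * w.1) = w.1 :=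
        CoxeterSystem.simple_mul_simple_cancel_left _ _
      have e1 : reducedProd (R.hecke i β) w.1 =
          R.hecke i β k * reducedProd (R.hecke i β) ((cox M).simple k * w.1) := by
        rw [← reducedProd_simple_mul hbr (by rw [hw]; exact hl.symm), hw]
      obtain ⟨a, b, hab, hadj, hz⟩ := (R.hecke_spec hM i hβ.1 hk).exists_eq_z
      have hsq := R.z_sq hconn horth (i := i) hab hadj
      rw [← hz] at hsq
      rw [e1, mul_assoc, ← mul_assoc (R.hecke i β k) (R.hecke i β k), hsq, sub_mul,
        smul_mul_assoc, smul_mul_assoc, R.e_mul_of_mem_heckeSpan hM hconn i hβ.1 hgen',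
        ← mul_assoc (R.hecke i β k), ← e1, smul_smul]
      exact sub_mem (Submodule.smul_mem _ _ hgen') (Submodule.smul_mem _ _ (hgen w))
  · rw [mul_zero]; exact zero_mem _
  · intro y y' _ _ h h'; rw [mul_add]; exact add_mem h h'
  · intro c y _ h; rw [mul_smul_comm]; exact Submodule.smul_mem _ c h

/-- Transported to the highest root, `z` is one of the Hecke generators. This is the stability
required of `P` in the filtration. -/
theorem z_mul_mem (i : V) {β : V → ℤ} (hβ : IsDominant M β) {j k : V} (hne : j ≠ k)
    (hadj : ¬ M.Adj j k) {y : A} (hy : y ∈ R.heckeSpan i β) :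
    R.z i j k * y ∈ R.heckeSpan i β := by
  obtain ⟨c, hc⟩ := (H.base (R := R) (i := i) j k hne hadj).exists_dominant hM hconn hsph hβ
  rw [hc.unique hM hconn htree (R.hecke_spec hM i hβ.1 hc.orthogonal)]
  exact R.hecke_mul_mem hM hconn htree horth hsph i hβ hc.orthogonal hy

end HeckeSpan

end Rep

end BMW

/-! ### The filtration of the left ideal by height -/

namespace BMW

open Diagram

namespace Rep

open Qlx

section Filtration

variable {V : Type*} [Fintype V] {M : SimpleGraph V} {A : Type*} [Ring A] [Algebra Qlx A]
  (R : Rep M A)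

theorem gInv_mul (k : V) (y : A) : R.gInv k * y = R.g k * y + m • y - m • (R.e k * y) := by
  rw [gInv, sub_mul, add_mul, smul_mul_assoc, smul_mul_assoc, one_mul]

/-- The element of `A e i` attached to a positive root. -/
noncomputable def b (i : V) (β : V → ℤ) : A := R.word (rootWord M i β) * R.e i

theorem b_simpleRoot (i j : V) : R.b i (simpleRoot j) = R.p i j := by
  rw [b, rootWord_simpleRoot, p]

theorem exists_b_eq (hM : FormPos M) (i : V) {β : V → ℤ} (h : IsPosRoot M β)
    (hβ : ∀ j, β ≠ simpleRoot j) :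
    ∃ k, coroot M k β = 1 ∧ R.b i β = R.g k * R.b i (β - simpleRoot k) := by
  obtain ⟨k, hk, -, hw⟩ := exists_rootWord_eq_cons hM i h hβ
  exact ⟨k, hk, by rw [b, hw, word_cons, mul_assoc, b]⟩

theorem ne_simpleRoot_of_coroot {β : V → ℤ} {k : V} (hk : coroot M k β = 1) (j : V) :
    β ≠ simpleRoot j := by
  rintro rfl
  exact coroot_simpleRoot_ne_one j k hk

variable (P : Submodule Qlx A)

/-- The sum of the spaces `b β P` over the positive roots `β` of height at most `n`. -/
noncomputable def filt (i : V) (n : ℕ) : Submodule Qlx A :=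
  Submodule.span Qlx {y | ∃ β, IsPosRoot M β ∧ height β ≤ n ∧ ∃ c ∈ P, y = R.b i β * c}

/-- The space `e k ⋯ e i P`. -/
noncomputable def nodeSpace (i k : V) : Submodule Qlx A := P.map (LinearMap.mulLeft Qlx (R.p i k))

variable {P} {i : V}

theorem mem_filt {β : V → ℤ} (h : IsPosRoot M β) {n : ℕ} (hn : height β ≤ n) {c : A} (hc : c ∈ P) :
    R.b i β * c ∈ R.filt P i n := Submodule.subset_span ⟨β, h, hn, c, hc, rfl⟩

theorem filt_mono {n n' : ℕ} (h : n ≤ n') : R.filt P i n ≤ R.filt P i n' := by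
  refine Submodule.span_mono ?_
  rintro _ ⟨β, h1, h2, h3⟩
  exact ⟨β, h1, h2.trans h, h3⟩

theorem mul_filt {n : ℕ} {a : A} {N : Submodule Qlx A}
    (h : ∀ β, IsPosRoot M β → height β ≤ n → ∀ c ∈ P, a * (R.b i β * c) ∈ N) {y : A}
    (hy : y ∈ R.filt P i n) : a * y ∈ N := by
  refine Submodule.span_induction (p := fun y _ => a * y ∈ N) ?_ ?_ ?_ ?_ hy
  · rintro _ ⟨β, h1, h2, c, hc, rfl⟩
    exact h β h1 h2 c hc
  · rw [mul_zero]; exact zero_mem _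
  · intro y y' _ _ h h'; rw [mul_add]; exact add_mem h h'
  · intro c y _ h; rw [mul_smul_comm]; exact Submodule.smul_mem _ c h

theorem mem_nodeSpace {k : V} {c : A} (hc : c ∈ P) : R.p i k * c ∈ R.nodeSpace P i k :=
  Submodule.mem_map_of_mem hc

theorem nodeSpace_le {k : V} {n : ℕ} (hn : 1 ≤ n) : R.nodeSpace P i k ≤ R.filt P i n := by
  rintro _ ⟨c, hc, rfl⟩
  rw [LinearMap.mulLeft_apply, ← b_simpleRoot]
  exact R.mem_filt (isPosRoot_simpleRoot k) (by rwa [height_simpleRoot]) hc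

theorem filt_zero {y : A} (hy : y ∈ R.filt P i 0) : y = 0 := by
  have : {y | ∃ β, IsPosRoot M β ∧ height β ≤ 0 ∧ ∃ c ∈ P, y = R.b i β * c} = ∅ := by
    refine Set.eq_empty_of_forall_notMem ?_
    rintro _ ⟨β, h, h0, -⟩
    have := h.height_pos
    omega
  rw [filt, this, Submodule.span_empty] at hy
  exact hy

variable (hM : FormPos M) (hconn : M.Connected) (htree : M.IsTree)

include hconn in
theorem e_mul_nodeSpace_self {k : V} {y : A} (hy : y ∈ R.nodeSpace P i k) :
    R.e k * y ∈ R.nodeSpace P i k := by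
  obtain ⟨c, hc, rfl⟩ := hy
  rw [LinearMap.mulLeft_apply, ← mul_assoc, R.e_mul_p hconn, smul_mul_assoc]
  exact Submodule.smul_mem _ _ (R.mem_nodeSpace hc)

include hconn htree in
theorem e_mul_nodeSpace {j k : V} (h : M.Adj k j) {y : A} (hy : y ∈ R.nodeSpace P i j) :
    R.e k * y ∈ R.nodeSpace P i k := by
  obtain ⟨c, hc, rfl⟩ := hy
  rw [LinearMap.mulLeft_apply, ← mul_assoc, R.e_mul_p_adj hconn htree h]
  exact R.mem_nodeSpace hc

/-- The comparison of the different steps down from a root of height at most `n`. -/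
def StepProp (R : Rep M A) (P : Submodule Qlx A) (i : V) (n : ℕ) : Prop :=
  ∀ β k, IsPosRoot M β → height β ≤ n → coroot M k β = 1 → ∀ c ∈ P,
    R.b i β * c - R.g k * (R.b i (β - simpleRoot k) * c) ∈ R.filt P i (height β - 1)

/-- The action of the `e k` on the filtration. -/
def EProp (R : Rep M A) (P : Submodule Qlx A) (i : V) (n : ℕ) : Prop :=
  ∀ k, ∀ y ∈ R.filt P i n, R.e k * y ∈ R.nodeSpace P i k

/-- The action of `g k` on the components of the filtration that it does not raise. -/
def StableProp (R : Rep M A) (P : Submodule Qlx A) (i : V) (n : ℕ) : Prop :=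
  ∀ β k, IsPosRoot M β → height β ≤ n → 0 ≤ coroot M k β → ∀ c ∈ P,
    R.g k * (R.b i β * c) ∈ R.filt P i (height β)

/-- The action of the `g k` on the filtration. -/
def GProp (R : Rep M A) (P : Submodule Qlx A) (i : V) (n : ℕ) : Prop :=
  ∀ n' ≤ n, ∀ k, ∀ y ∈ R.filt P i n', R.g k * y ∈ R.filt P i (n' + 1)

variable {R}

theorem GProp.gInv {n : ℕ} (hG : GProp R P i n) (hE : EProp R P i n) {n' : ℕ} (hn : n' ≤ n) (k : V)
    {y : A} (hy : y ∈ R.filt P i n') : R.gInv k * y ∈ R.filt P i (n' + 1) := by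
  rw [gInv_mul]
  refine sub_mem (add_mem (hG n' hn k y hy) (Submodule.smul_mem _ _ (R.filt_mono n'.le_succ hy)))
    (Submodule.smul_mem _ _ ?_)
  exact R.nodeSpace_le (by omega) (hE k y (R.filt_mono hn hy))

theorem StableProp.gInv {n : ℕ} (hS : StableProp R P i n) (hE : EProp R P i n) {β : V → ℤ}
    (h : IsPosRoot M β) (hn : height β ≤ n) {k : V} (hk : coroot M k β = 0) {c : A} (hc : c ∈ P) :
    R.gInv k * (R.b i β * c) ∈ R.filt P i (height β) := by
  rw [gInv_mul]
  refine sub_mem (add_mem (hS β k h hn hk.ge c hc) (Submodule.smul_mem _ _ (R.mem_filt h le_rfl hc)))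
    (Submodule.smul_mem _ _ ?_)
  exact R.nodeSpace_le h.height_pos (hE k _ (R.mem_filt h hn hc))

include hM hconn htree

/-- `b β` is built with one chosen step `j`. If `j` and `k` are not adjacent, both steps are
compared at `β - α_j - α_k`, where `g_j` and `g_k` commute. If they are adjacent, `β = α_j + α_k`
and the comparison is a rank two identity derived from `g_e_e`. -/
theorem StepProp.succ {n : ℕ} (hU : StepProp R P i (n + 1)) (hG : GProp R P i n) :
    StepProp R P i (n + 2) := by
  intro β k h hn hk c hc
  obtain ⟨j, hj, hb⟩ := R.exists_b_eq hM i h (ne_simpleRoot_of_coroot hk)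
  have p1 := h.sub hM hk
  have t1 := h.height_sub hM hk
  have q1 := h.sub hM hj
  have s1 := h.height_sub hM hj
  rw [hb]
  by_cases hjk : j = k
  · subst hjk
    rw [mul_assoc, sub_self]; exact zero_mem _
  by_cases hadj : M.Adj j k
  · have c1 := coroot_adj M hadj
    have c2 := coroot_adj M hadj.symm
    have e1 : β - simpleRoot j = simpleRoot k := q1.eq_of_two_le hM (by rw [coroot_sub]; omega)
    have e2 : β - simpleRoot k = simpleRoot j := p1.eq_of_two_le hM (by rw [coroot_sub]; omega)
    have h1 : R.g j * R.p i k = R.g k * R.p i j - m • R.p i k + m • R.p i j := by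
      apply smul_right_injective A x_ne_zero
      show x • _ = x • _
      rw [← R.e_mul_p_adj hconn htree hadj.symm, ← mul_smul_comm, ← mul_smul_comm,
        ← R.e_mul_p hconn, ← mul_assoc (R.e k), ← mul_assoc, R.g_e_e hadj, add_mul, sub_mul,
        smul_mul_assoc, smul_mul_assoc, mul_assoc, mul_assoc, R.e_mul_p hconn]
      simp only [mul_smul_comm]
      module
    rw [e2, height_simpleRoot] at t1
    rw [e1, e2, b_simpleRoot, b_simpleRoot, h1, t1]
    have h2 : (R.g k * R.p i j - m • R.p i k + m • R.p i j) * c - R.g k * (R.p i j * c) =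
        m • (R.p i j * c) - m • (R.p i k * c) := by
      rw [add_mul, sub_mul, smul_mul_assoc, smul_mul_assoc, mul_assoc]
      abel
    rw [h2]
    exact sub_mem (Submodule.smul_mem _ _ (R.nodeSpace_le le_rfl (R.mem_nodeSpace hc)))
      (Submodule.smul_mem _ _ (R.nodeSpace_le le_rfl (R.mem_nodeSpace hc)))
  · have c1 := coroot_not_adj M hjk hadj
    have c2 := coroot_not_adj M (Ne.symm hjk) fun h => hadj h.symm
    have d1 : coroot M k (β - simpleRoot j) = 1 := by rw [coroot_sub]; omega
    have d2 : coroot M j (β - simpleRoot k) = 1 := by rw [coroot_sub]; omega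
    have f1 := hU _ k q1 (by omega) d1 c hc
    have f2 := hU _ j p1 (by omega) d2 c hc
    have g1 := hG _ (by omega) j _ f1
    have g2 := hG _ (by omega) k _ f2
    have u1 := q1.height_sub hM d1
    have u2 := q1.height_pos
    rw [show height (β - simpleRoot j) - 1 + 1 = height β - 1 by omega] at g1
    rw [show height (β - simpleRoot k) - 1 + 1 = height β - 1 by omega] at g2
    convert sub_mem g1 g2 using 1
    rw [sub_right_comm β, mul_sub, mul_sub, ← mul_assoc (R.g j) (R.g k), R.g_comm j k hadj]
    simp only [mul_assoc]
    abel

variable (hP : ∀ j k, j ≠ k → ¬ M.Adj j k → ∀ c ∈ P, R.z i j k * c ∈ P)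
  (horth : ∀ i j, i ≠ j → ¬ M.Adj i j → R.e i * R.e j = 0)

include hP

omit hM htree in
theorem g_mul_nodeSpace {j k : V} (h : ¬ M.Adj j k) {y : A} (hy : y ∈ R.nodeSpace P i k) :
    R.g j * y ∈ R.nodeSpace P i k := by
  obtain ⟨c, hc, rfl⟩ := hy
  rw [LinearMap.mulLeft_apply, ← mul_assoc]
  by_cases hjk : j = k
  · subst hjk
    rw [R.g_mul_p hconn, smul_mul_assoc]
    exact Submodule.smul_mem _ _ (R.mem_nodeSpace hc)
  · have h' : ¬ M.Adj k j := fun h' => h h'.symm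
    rw [← R.p_mul_z hconn h', mul_assoc]
    exact R.mem_nodeSpace (hP k j (Ne.symm hjk) h' c hc)

include horth

omit htree hM in
theorem gInv_mul_nodeSpace {j k : V} (hjk : j ≠ k) (h : ¬ M.Adj j k) {y : A}
    (hy : y ∈ R.nodeSpace P i k) : R.gInv j * y ∈ R.nodeSpace P i k := by
  have h0 : R.e j * y = 0 := by
    obtain ⟨c, hc, rfl⟩ := hy
    rw [LinearMap.mulLeft_apply, ← mul_assoc, R.e_mul_p_zero hconn horth hjk h, zero_mul]
  rw [gInv_mul, h0, smul_zero, sub_zero]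
  exact add_mem (g_mul_nodeSpace hconn hP h hy) (Submodule.smul_mem _ _ hy)

/-- The hard case of `EProp.succ`: `γ + α_j` may be too high for the induction. The next letter `t`
of `b γ` is split off and `e_k g_j g_t` rewritten, according to the adjacency of `t` with `j` and
`k`, until an `e` acts within height `n`. -/
theorem EProp.aux {n : ℕ} (hU : StepProp R P i (n + 1)) (hE : EProp R P i n)
    (hS : StableProp R P i n) (hG : GProp R P i n) {γ : V → ℤ} (h : IsPosRoot M γ)
    (hn : height γ ≤ n) {j k : V} (hadj : M.Adj j k) (hk : coroot M k γ = 0)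
    (hj : coroot M j γ = -1) {c : A} (hc : c ∈ P) :
    R.e k * (R.g j * (R.b i γ * c)) ∈ R.nodeSpace P i k := by
  by_cases hγ : ∃ t, γ = simpleRoot t
  · obtain ⟨t, rfl⟩ := hγ
    obtain ⟨h1, h2⟩ := simpleRoot_orthogonal hk
    have hjt : M.Adj j t := by
      by_contra hjt
      by_cases hjt' : j = t
      · subst hjt'; rw [coroot_self] at hj; norm_num at hj
      · rw [coroot_not_adj M hjt' hjt] at hj; norm_num at hj
    rw [← mul_assoc, R.e_g hadj, mul_assoc, mul_assoc, b_simpleRoot]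
    refine R.e_mul_nodeSpace hconn htree hadj.symm (R.e_mul_nodeSpace hconn htree hjt ?_)
    exact gInv_mul_nodeSpace hconn hP horth h1.symm (fun h => h2 h.symm) (R.mem_nodeSpace hc)
  push Not at hγ
  obtain ⟨t, ht, hb⟩ := R.exists_b_eq hM i h hγ
  have htj : t ≠ j := ne_of_coroot_ne (M := M) (v := γ) (by omega)
  have htk : t ≠ k := ne_of_coroot_ne (M := M) (v := γ) (by omega)
  have p1 := h.sub hM ht
  have t1 := h.height_sub hM ht
  rw [hb, mul_assoc]
  have m1 : R.b i (γ - simpleRoot t) * c ∈ R.filt P i (n - 1) := R.mem_filt p1 (by omega) hc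
  have hn1 : n - 1 + 1 = n := by omega
  have g1 := fun a y (hy : y ∈ R.filt P i (n - 1)) => hn1 ▸ hG (n - 1) (by omega) a y hy
  by_cases hatj : M.Adj t j
  · have hatk := not_adj_of_adj_of_adj htree hatj hadj
    have c1 := coroot_not_adj M htk.symm fun h => hatk h.symm
    have c2 := coroot_adj M hatj.symm
    -- Letters become `e`s at the cost of inverses. As `γ - α_t` is orthogonal to `α_k`, `g_k⁻¹`
    -- does not raise the height; only `g_j⁻¹` may.
    have e1 : R.e k * (R.g j * (R.g t * (R.b i (γ - simpleRoot t) * c))) =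
        R.e k * (R.e j * (R.e t * (R.gInv j * (R.gInv k * (R.b i (γ - simpleRoot t) * c))))) := by
      rw [← mul_assoc, R.e_g hadj, mul_assoc, mul_assoc, ← mul_assoc (R.gInv k),
        R.gInv_g_comm fun h => hatk h.symm, mul_assoc, ← mul_assoc (R.e j), R.e_g hatj]
      simp only [mul_assoc]
    rw [e1]
    refine R.e_mul_nodeSpace hconn htree hadj.symm (R.e_mul_nodeSpace hconn htree hatj.symm ?_)
    refine hE t _ ?_
    have h1 := hS.gInv hE p1 (k := k) (by omega) (by rw [coroot_sub]; omega) hc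
    refine R.filt_mono (by omega) (hG.gInv hE (by omega) j h1)
  · by_cases hatk : M.Adj t k
    · have c1 := coroot_adj M hatk.symm
      have c2 := coroot_not_adj M htj.symm fun h => hatj h.symm
      have c3 := coroot_adj M hadj
      have d1 : coroot M k (γ - simpleRoot t) = 1 := by rw [coroot_sub]; omega
      have p2 := p1.sub hM d1
      have t2 := p1.height_sub hM d1
      have t3 := p2.height_pos
      have hn2 : n - 2 + 1 = n - 1 := by omega
      have g2 := fun a y (hy : y ∈ R.filt P i (n - 2)) => hn2 ▸ hG (n - 2) (by omega) a y hy
      have d2 : coroot M j (γ - simpleRoot t - simpleRoot k) = 0 := by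
        rw [coroot_sub, coroot_sub]; omega
      have f1 := R.filt_mono (show height (γ - simpleRoot t) - 1 ≤ n - 2 by omega)
        (hU _ k p1 (by omega) d1 c hc)
      have f2 := hE k _ (g1 j _ (g2 t _ f1))
      rw [mul_sub, mul_sub, mul_sub] at f2
      refine (Submodule.sub_mem_iff_left _ ?_).mp f2
      -- `e_k g_t = e_k e_t g_k⁻¹`, and the braid relation exchanges this inverse for `g_j⁻¹` on the
      -- right, which does not raise the height because `γ - α_t - α_k` is orthogonal to `α_j`.
      have e1 : ∀ y, R.e k * (R.g j * (R.g t * (R.g k * y))) =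
          R.e k * (R.e t * (R.g j * (R.g k * (R.gInv j * y)))) := fun y => by
        rw [← mul_assoc (R.g j), ← R.g_comm t j hatj, mul_assoc, ← mul_assoc (R.e k),
          R.e_g hatk, mul_assoc, mul_assoc, R.gInv_g_g hadj.symm]
      rw [e1]
      refine R.e_mul_nodeSpace hconn htree hatk.symm (hE t _ (g1 j _ (g2 k _ ?_)))
      exact R.filt_mono (by omega) (hS.gInv hE p2 (by omega) d2 hc)
    · rw [← mul_assoc (R.g j), R.g_comm j t fun h => hatj h.symm, mul_assoc, ← mul_assoc (R.e k),
        R.e_g_comm fun h => hatk h.symm, mul_assoc]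
      exact g_mul_nodeSpace hconn hP hatk (hE k _ (g1 j _ m1))

/-- For pairing `1`, `b β` is `g_k` times a lower element up to lower terms, and `e_k g_k = l⁻¹
e_k`. Otherwise the chosen letter `j` commutes with `e_k`, or `e_k g_j g_k = e_k e_j` applies
(pairing `0`), or `EProp.aux` does (pairing `-1`). -/
theorem EProp.succ {n : ℕ} (hU : StepProp R P i (n + 1)) (hE : EProp R P i n)
    (hS : StableProp R P i n) (hG : GProp R P i n) : EProp R P i (n + 1) := by
  intro k y hy
  refine R.mul_filt (fun β h hn c hc => ?_) hy
  by_cases hβ : ∃ j, β = simpleRoot j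
  · obtain ⟨j, rfl⟩ := hβ
    rw [b_simpleRoot]
    by_cases hkj : k = j
    · subst hkj
      exact R.e_mul_nodeSpace_self hconn (R.mem_nodeSpace hc)
    · by_cases hadj : M.Adj k j
      · exact R.e_mul_nodeSpace hconn htree hadj (R.mem_nodeSpace hc)
      · rw [← mul_assoc, R.e_mul_p_zero hconn horth hkj hadj, zero_mul]
        exact zero_mem _
  push Not at hβ
  have main : coroot M k β ≠ 1 → R.e k * (R.b i β * c) ∈ R.nodeSpace P i k := fun hk => by
    obtain ⟨j, hj, hb⟩ := R.exists_b_eq hM i h hβ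
    have hjk : j ≠ k := ne_of_coroot_ne (M := M) (v := β) (by omega)
    have p1 := h.sub hM hj
    have t1 := h.height_sub hM hj
    rw [hb, mul_assoc]
    by_cases hadj : M.Adj j k
    · have c1 := coroot_adj M hadj
      have c2 := coroot_adj M hadj.symm
      rcases h.coroot_cases hM k with h1 | h1 | h1 | h1
      · exact EProp.aux hM hconn htree hP horth hU hE hS hG p1 (by omega) hadj
          (by rw [coroot_sub]; omega) (by rw [coroot_sub, coroot_self]; omega) hc
      · have d1 : coroot M k (β - simpleRoot j) = 1 := by rw [coroot_sub]; omega
        have p2 := p1.sub hM d1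
        have t2 := p1.height_sub hM d1
        have f1 := hU _ k p1 (by omega) d1 c hc
        have f2 := hE k _ (R.filt_mono (by omega) (hG _ (by omega) j _ f1))
        rw [mul_sub, mul_sub] at f2
        refine (Submodule.sub_mem_iff_left _ ?_).mp f2
        rw [← mul_assoc (R.g j), ← mul_assoc, R.e_g_g hadj, mul_assoc]
        exact R.e_mul_nodeSpace hconn htree hadj.symm (hE j _ (R.mem_filt p2 (by omega) hc))
      · exact absurd h1 hk
      · exact absurd h1 (hβ k)
    · rw [← mul_assoc, R.e_g_comm fun h => hadj h.symm, mul_assoc]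
      exact g_mul_nodeSpace hconn hP hadj (hE k _ (R.mem_filt p1 (by omega) hc))
  by_cases hk : coroot M k β = 1
  · have p1 := h.sub hM hk
    have t1 := h.height_sub hM hk
    have f1 := hE k _ (R.filt_mono (by omega) (hU β k h hn hk c hc))
    rw [mul_sub] at f1
    refine (Submodule.sub_mem_iff_left _ ?_).mp f1
    rw [← mul_assoc, R.e_mul_g, smul_mul_assoc]
    exact Submodule.smul_mem _ _ (hE k _ (R.mem_filt p1 (by omega) hc))
  · exact main hk

omit horth

/-- For pairing `1` the quadratic relation for `g_k` applies. For pairing `0`, `g_k` passes the next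
letter by commutation or as `g_k g_j g_k = g_j g_k g_j`, where the innermost `g_j` meets a root
orthogonal to `α_j`. -/
theorem StableProp.succ {n : ℕ} (hU : StepProp R P i (n + 1)) (hE : EProp R P i (n + 1))
    (hS : StableProp R P i n) (hG : GProp R P i n) : StableProp R P i (n + 1) := by
  intro β k h hn hk c hc
  by_cases hβ : ∃ j, β = simpleRoot j
  · obtain ⟨j, rfl⟩ := hβ
    have hadj : ¬ M.Adj k j := fun hadj => by rw [coroot_adj M hadj] at hk; norm_num at hk
    rw [b_simpleRoot]
    exact R.nodeSpace_le h.height_pos (g_mul_nodeSpace hconn hP hadj (R.mem_nodeSpace hc))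
  push Not at hβ
  rcases h.coroot_cases hM k with h1 | h1 | h1 | h1
  · omega
  · obtain ⟨j, hj, hb⟩ := R.exists_b_eq hM i h hβ
    have hjk : j ≠ k := ne_of_coroot_ne (M := M) (v := β) (by omega)
    have p1 := h.sub hM hj
    have t1 := h.height_sub hM hj
    rw [hb, mul_assoc]
    by_cases hadj : M.Adj j k
    · have c1 := coroot_adj M hadj
      have c2 := coroot_adj M hadj.symm
      have d1 : coroot M k (β - simpleRoot j) = 1 := by rw [coroot_sub]; omega
      have p2 := p1.sub hM d1
      have t2 := p1.height_sub hM d1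
      have t3 := p2.height_pos
      have d2 : coroot M j (β - simpleRoot j - simpleRoot k) = 0 := by
        rw [coroot_sub, coroot_sub, coroot_self]; omega
      have f1 := hU _ k p1 (by omega) d1 c hc
      have f2 := R.filt_mono (n' := height β) (by omega)
        (hG _ (by omega) k _ (hG _ (by omega) j _ f1))
      rw [mul_sub, mul_sub] at f2
      refine (Submodule.sub_mem_iff_left _ ?_).mp f2
      have e1 : ∀ y, R.g k * (R.g j * (R.g k * y)) = R.g j * (R.g k * (R.g j * y)) := fun y => by
        have := congrArg (· * y) (R.g_braid k j hadj.symm)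
        simpa only [mul_assoc] using this
      rw [e1]
      have f3 := hS _ j p2 (by omega) d2.ge c hc
      exact R.filt_mono (by omega) (hG _ (by omega) j _ (hG _ (by omega) k _ f3))
    · have c2 := coroot_not_adj M hjk.symm fun h => hadj h.symm
      rw [← mul_assoc, ← R.g_comm j k hadj, mul_assoc]
      have f1 := hS _ k p1 (by omega) (by rw [coroot_sub]; omega) c hc
      exact R.filt_mono (by omega) (hG _ (by omega) j _ f1)
  · have p1 := h.sub hM h1
    have t1 := h.height_sub hM h1
    have m1 : R.b i (β - simpleRoot k) * c ∈ R.filt P i (height β - 1) :=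
      R.mem_filt p1 (by omega) hc
    have f1 := hU β k h hn h1 c hc
    have f2 := R.filt_mono (n' := height β) (by omega) (hG _ (by omega) k _ f1)
    rw [mul_sub] at f2
    refine (Submodule.sub_mem_iff_left _ ?_).mp f2
    rw [← mul_assoc, R.g_sq, add_mul, sub_mul, one_mul, smul_mul_assoc, smul_mul_assoc]
    refine add_mem (sub_mem (R.filt_mono (by omega) m1) (Submodule.smul_mem _ _ ?_))
      (Submodule.smul_mem _ _ ?_)
    · exact R.filt_mono (by omega) (hG _ (by omega) k _ m1)
    · exact R.nodeSpace_le h.height_pos (hE k _ (R.filt_mono (by omega) m1))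
  · exact absurd h1 (hβ k)

omit hP hconn htree in
-- If `β + α_k` is a root, comparison of steps shows that `g_k b β` is `b (β + α_k)` up to lower
-- terms. This is why `StepProp` runs one height ahead.
theorem GProp.succ {n : ℕ} (hU : StepProp R P i (n + 2)) (hS : StableProp R P i (n + 1)) :
    GProp R P i (n + 1) := by
  intro n' hn' k y hy
  refine R.mul_filt (fun β h hn c hc => ?_) hy
  by_cases hk : 0 ≤ coroot M k β
  · exact R.filt_mono (by omega) (hS β k h (by omega) hk c hc)
  · have hk' : coroot M k β = -1 := by
      have := h.neg_one_le_coroot hM k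
      omega
    have p1 := h.add hk'
    have t1 := height_add_simpleRoot h.nonneg k
    have f1 := hU _ k p1 (by omega) (by rw [coroot_add, coroot_self]; omega) c hc
    rw [add_sub_cancel_right] at f1
    have f2 := R.filt_mono (n' := n' + 1) (by omega) f1
    exact (Submodule.sub_mem_iff_right _ (R.mem_filt p1 (by omega) hc)).mp f2

include horth

/-- The four statements feed each other at neighbouring heights. Height zero is void, and at height
one no step down exists. -/
theorem filtration_props (n : ℕ) : StepProp R P i (n + 1) ∧ EProp R P i n ∧ StableProp R P i n ∧
    GProp R P i n := by
  induction n with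
  | zero =>
    refine ⟨fun β k h hn hk => ?_, fun k y hy => ?_, fun β k h hn => ?_, fun n' hn' k y hy => ?_⟩
    · have := h.height_sub hM hk
      have := (h.sub hM hk).height_pos
      omega
    · rw [R.filt_zero hy, mul_zero]; exact zero_mem _
    · have := h.height_pos
      omega
    · obtain rfl : n' = 0 := by omega
      rw [R.filt_zero hy, mul_zero]; exact zero_mem _
  | succ n ih =>
    obtain ⟨hU, hE, hS, hG⟩ := ih
    have hU' := StepProp.succ hM hconn htree hU hG
    have hE' := EProp.succ hM hconn htree hP horth hU hE hS hG
    have hS' := StableProp.succ hM hconn htree hP hU hE' hS hG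
    exact ⟨hU', hE', hS', GProp.succ hM hU' hS'⟩

end Filtration

end Rep

end BMW

/-! ### The left ideal of `e i` and its corner -/

namespace BMW

open Diagram

namespace Rep

section Map

variable {V : Type*} {M : SimpleGraph V} {A A' : Type*} [Ring A] [Algebra Qlx A] [Ring A']
  [Algebra Qlx A'] (R : Rep M A) (f : A →ₐ[Qlx] A')

/-- The image of a representation under an algebra homomorphism. -/
noncomputable def map : Rep M A' where
  g k := f (R.g k)
  e k := f (R.e k)
  g_comm i j h := by rw [← map_mul, R.g_comm i j h, map_mul]
  g_braid i j h := by simp only [← map_mul, R.g_braid i j h]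
  e_def i := by
    rw [← map_smul, R.e_def, map_smul, map_sub, map_add, map_smul, map_mul, map_one]
  g_mul_e i := by rw [← map_mul, R.g_mul_e, map_smul]
  e_g_e i j h := by simp only [← map_mul, R.e_g_e i j h, map_smul]

theorem map_word (ω : List V) : (R.map f).word ω = f (R.word ω) := by
  rw [word, word, map_list_prod, List.map_map]; rfl

theorem map_z (i j k : V) : (R.map f).z i j k = f (R.z i j k) := by
  rw [z, z, map_smul, map_mul, map_mul, p, p, q, q, map_mul, map_mul, map_word, map_word]; rfl

end Map

section Generation

variable {V : Type*} [Fintype V] {M : SimpleGraph V} {A : Type*} [Ring A] [Algebra Qlx A]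
  (R : Rep M A)

/-- The sum of the spaces `b β P` over all positive roots. -/
noncomputable def filtTop (P : Submodule Qlx A) (i : V) : Submodule Qlx A :=
  Submodule.span Qlx {y | ∃ β, IsPosRoot M β ∧ ∃ c ∈ P, y = R.b i β * c}

theorem filt_le_filtTop {P : Submodule Qlx A} {i : V} (n : ℕ) :
    R.filt P i n ≤ R.filtTop P i := by
  refine Submodule.span_mono ?_
  rintro _ ⟨β, h1, -, h3⟩
  exact ⟨β, h1, h3⟩

theorem mul_mem_of_mem_adjoin {N : Submodule Qlx A} (hN : ∀ k, ∀ y ∈ N, R.g k * y ∈ N) {a : A}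
    (ha : a ∈ Algebra.adjoin Qlx (Set.range R.g)) : ∀ y ∈ N, a * y ∈ N := by
  induction ha using Algebra.adjoin_induction with
  | mem a ha => obtain ⟨k, rfl⟩ := ha; exact hN k
  | algebraMap c => intro y hy; rw [← Algebra.smul_def]; exact Submodule.smul_mem _ _ hy
  | add a a' _ _ h h' => intro y hy; rw [add_mul]; exact add_mem (h y hy) (h' y hy)
  | mul a a' _ _ h h' => intro y hy; rw [mul_assoc]; exact h _ (h' y hy)

variable (hM : FormPos M) (hconn : M.Connected) (hsph : IsSpherical M)
  (horth : ∀ i j, i ≠ j → ¬ M.Adj i j → R.e i * R.e j = 0) {i : V} {β : V → ℤ}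
  (hβ : IsDominant M β)
include hM hconn hsph horth hβ

theorem g_mul_filtTop (k : V) : ∀ y ∈ R.filtTop (R.heckeSpan i β) i,
    R.g k * y ∈ R.filtTop (R.heckeSpan i β) i := by
  have htree := isTree hM hconn
  intro y hy
  refine Submodule.span_induction
    (p := fun y _ => R.g k * y ∈ R.filtTop (R.heckeSpan i β) i) ?_ ?_ ?_ ?_ hy
  · rintro _ ⟨γ, hγ, c, hc, rfl⟩
    exact R.filt_le_filtTop _ ((filtration_props hM hconn htree
      (fun j k hne hadj c hc => R.z_mul_mem hM hconn htree horth hsph i hβ hne hadj hc) horth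
      (height γ)).2.2.2 _ le_rfl k _ (R.mem_filt hγ le_rfl hc))
  · rw [mul_zero]; exact zero_mem _
  · intro y y' _ _ h h'; rw [mul_add]; exact add_mem h h'
  · intro c y _ h; rw [mul_smul_comm]; exact Submodule.smul_mem _ c h

theorem e_mul_filtTop : ∀ y ∈ R.filtTop (R.heckeSpan i β) i, R.e i * y ∈ R.heckeSpan i β := by
  have htree := isTree hM hconn
  intro y hy
  refine Submodule.span_induction
    (p := fun y _ => R.e i * y ∈ R.heckeSpan i β) ?_ ?_ ?_ ?_ hy
  · rintro _ ⟨γ, hγ, c, hc, rfl⟩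
    obtain ⟨c', hc', h⟩ := (filtration_props hM hconn htree
      (fun j k hne hadj c hc => R.z_mul_mem hM hconn htree horth hsph i hβ hne hadj hc) horth
      (height γ)).2.1 i _ (R.mem_filt hγ le_rfl hc)
    rw [← h, LinearMap.mulLeft_apply, p_self, R.e_mul_of_mem_heckeSpan hM hconn i hβ.1 hc']
    exact Submodule.smul_mem _ _ hc'
  · rw [mul_zero]; exact zero_mem _
  · intro y y' _ _ h h'; rw [mul_add]; exact add_mem h h'
  · intro c y _ h; rw [mul_smul_comm]; exact Submodule.smul_mem _ c h

variable (hgen : Algebra.adjoin Qlx (Set.range R.g) = ⊤)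
include hgen

theorem mul_e_mem_filtTop (a : A) : a * R.e i ∈ R.filtTop (R.heckeSpan i β) i := by
  refine R.mul_mem_of_mem_adjoin (R.g_mul_filtTop hM hconn hsph horth hβ)
    (hgen ▸ Algebra.mem_top) _ ?_
  have h : Qlx.x • R.e i ∈ R.filtTop (R.heckeSpan i β) i := by
    rw [← e_sq]
    refine Submodule.subset_span ⟨simpleRoot i, isPosRoot_simpleRoot i, R.e i,
      R.e_mem_heckeSpan hM hconn (isTree hM hconn) i hβ.1, ?_⟩
    rw [b_simpleRoot, p_self]
  exact (Submodule.smul_mem_iff _ Qlx.x_ne_zero).mp h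

/-- Here `x ^ 2 • y = e_i y e_i`; the product `y e_i` lies in the sum of the `b β P`, which `e_i`
multiplies into `P`. -/
theorem mem_heckeSpan_of_e_mul {y : A} (h : R.e i * y = Qlx.x • y) (h' : y * R.e i = Qlx.x • y) :
    y ∈ R.heckeSpan i β := by
  have h1 := R.e_mul_filtTop hM hconn hsph horth hβ (y * R.e i)
    (R.mul_e_mem_filtTop hM hconn hsph horth hβ hgen y)
  rw [h', mul_smul_comm, h] at h1
  exact (Submodule.smul_mem_iff _ Qlx.x_ne_zero).mp ((Submodule.smul_mem_iff _ Qlx.x_ne_zero).mp h1)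

end Generation

end Rep

/-! ### The anti-involution and the quotient algebra by `I₂` -/

section Standard

variable {V : Type*} (M : SimpleGraph V)

/-- The generators of the BMW algebra. -/
noncomputable def stdRep : Rep M (Alg M) where
  g := g M
  e := e M
  g_comm i j h := by
    simpa only [g, e, map_mul] using proj_rel M (Rel.B1 i j h)
  g_braid i j h := by
    simpa only [g, e, map_mul, mul_assoc] using proj_rel M (Rel.B2 i j h)
  e_def i := by
    simpa only [g, e, map_mul, map_smul, map_sub, map_add, map_one, pow_two] using
      proj_rel M (Rel.D1 i)
  g_mul_e i := by
    simpa only [g, e, map_mul, map_smul] using proj_rel M (Rel.R1 i)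
  e_g_e i j h := by
    simpa only [g, e, map_mul, map_smul, mul_assoc] using proj_rel M (Rel.R2 i j h)

theorem adjoin_g : Algebra.adjoin Qlx (Set.range (g M)) = ⊤ := by
  have h1 : (proj M).range = ⊤ :=
    (AlgHom.range_eq_top _).mpr (RingQuot.mkAlgHom_surjective Qlx (Rel M))
  rw [← h1, ← Algebra.map_top, ← FreeAlgebra.adjoin_range_ι, AlgHom.map_adjoin]
  refine le_antisymm (Algebra.adjoin_mono ?_) (Algebra.adjoin_le ?_)
  · rintro _ ⟨k, rfl⟩
    exact ⟨_, ⟨Gen.g k, rfl⟩, rfl⟩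
  · rintro _ ⟨_, ⟨s, rfl⟩, rfl⟩
    have hg : ∀ k, g M k ∈ Algebra.adjoin Qlx (Set.range (g M)) :=
      fun k => Algebra.subset_adjoin ⟨k, rfl⟩
    cases s with
    | g k => exact hg k
    | e k =>
      show e M k ∈ _
      rw [e_eq]
      exact Subalgebra.smul_mem _ (Subalgebra.smul_mem _ (sub_mem (add_mem (pow_mem (hg k) 2)
        (Subalgebra.smul_mem _ (hg k) _)) (one_mem _)) _) _

/-- The anti-involution of `B` as a linear map. -/
noncomputable def opLin : Alg M →ₗ[Qlx] Alg M :=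
  (MulOpposite.opLinearEquiv Qlx).symm.toLinearMap ∘ₗ (opHom M).toLinearMap

theorem opLin_apply (a : Alg M) : opLin M a = op M a := rfl

theorem op_smul (c : Qlx) (a : Alg M) : op M (c • a) = c • op M a := by
  rw [← opLin_apply, map_smul, opLin_apply]

theorem op_add (a b : Alg M) : op M (a + b) = op M a + op M b := by
  rw [← opLin_apply, map_add, opLin_apply, opLin_apply]

theorem op_one : op M 1 = 1 := by rw [op, map_one, MulOpposite.unop_one]

theorem op_op (a : Alg M) : op M (op M a) = a := by
  have ha : a ∈ Algebra.adjoin Qlx (Set.range (g M)) := adjoin_g M ▸ Algebra.mem_top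
  induction ha using Algebra.adjoin_induction with
  | mem a ha => obtain ⟨k, rfl⟩ := ha; rw [op_g, op_g]
  | algebraMap c => rw [Algebra.algebraMap_eq_smul_one, op_smul, op_one, op_smul, op_one]
  | add a a' _ _ h h' => rw [op_add, op_add, h, h']
  | mul a a' _ _ h h' => rw [op_mul, op_mul, h, h']

theorem op_e (i : V) : op M (e M i) = e M i := by
  rw [e_eq, op_smul, op_smul, ← opLin_apply, map_sub, map_add, map_smul, opLin_apply, opLin_apply,
    opLin_apply, pow_two, op_mul, op_g, op_one]

/-- The two-sided ideal `I₂`. -/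
noncomputable def orthIdeal : TwoSidedIdeal (Alg M) :=
  TwoSidedIdeal.span {b : Alg M | ∃ i j : V, i ≠ j ∧ ¬ M.Adj i j ∧ b = e M i * e M j}

theorem mem_idealTwo {a : Alg M} : a ∈ idealTwo M ↔ a ∈ orthIdeal M := Iff.rfl

theorem op_mem_orthIdeal {a : Alg M} (h : a ∈ orthIdeal M) : op M a ∈ orthIdeal M := by
  rw [orthIdeal, TwoSidedIdeal.mem_span_iff_mem_addSubgroup_closure] at h
  induction h using AddSubgroup.closure_induction with
  | mem a ha =>
    obtain ⟨_, ⟨a, -, _, ⟨i, j, hij, hadj, rfl⟩, rfl⟩, b, -, rfl⟩ := ha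
    simp only [op_mul, op_e]
    exact (orthIdeal M).mul_mem_left _ _ ((orthIdeal M).mul_mem_right _ _
      (TwoSidedIdeal.subset_span ⟨j, i, hij.symm, fun h => hadj h.symm, rfl⟩))
  | zero => rw [← opLin_apply, map_zero]; exact zero_mem _
  | add a a' _ _ h h' => rw [op_add]; exact add_mem h h'
  | neg a _ h => rw [← opLin_apply, map_neg, opLin_apply]; exact neg_mem h

/-- Reduction modulo `I₂`, as a homomorphism of algebras. -/
noncomputable def quot : Alg M →ₐ[Qlx] (orthIdeal M).ringCon.Quotient :=
  RingCon.mkₐ Qlx (orthIdeal M).ringCon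

theorem quot_surjective : Function.Surjective (quot M) := RingCon.mkₐ_surjective _

theorem quot_eq_zero {a : Alg M} : quot M a = 0 ↔ a ∈ orthIdeal M := by
  rw [TwoSidedIdeal.mem_iff, ← RingCon.eq]
  rfl

/-- The relations are used in the quotient algebra, the result concerns the quotient module; the
kernels agree. -/
theorem quot_eq_iff {a b : Alg M} : quot M a = quot M b ↔ modTwo M a = modTwo M b := by
  rw [← sub_eq_zero, ← map_sub, quot_eq_zero, ← mem_idealTwo, modTwo, Submodule.mkQ_apply,
    Submodule.mkQ_apply, Submodule.Quotient.eq]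

theorem map_modTwo_le {N N' : Submodule Qlx (Alg M)}
    (h : N.map (quot M).toLinearMap ≤ N'.map (quot M).toLinearMap) :
    N.map (modTwo M) ≤ N'.map (modTwo M) := by
  rintro _ ⟨a, ha, rfl⟩
  obtain ⟨b, hb, hab⟩ := h (Submodule.mem_map_of_mem ha)
  exact ⟨b, hb, (quot_eq_iff M).mp hab⟩

theorem rank_map_modTwo_le {ι : Type*} [Finite ι] {N : Submodule Qlx (Alg M)}
    (f : ι → (orthIdeal M).ringCon.Quotient)
    (h : N.map (quot M).toLinearMap ≤ Submodule.span Qlx (Set.range f)) :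
    Module.rank Qlx (N.map (modTwo M)) ≤ (Nat.card ι : Cardinal) := by
  choose s hs using quot_surjective M
  have h1 : N.map (modTwo M) ≤ Submodule.span Qlx (Set.range (modTwo M ∘ s ∘ f)) := by
    rw [Set.range_comp, ← Submodule.map_span]
    refine map_modTwo_le M (h.trans ?_)
    rw [Submodule.map_span, ← Set.range_comp]
    refine Submodule.span_mono ?_
    rintro _ ⟨t, rfl⟩
    exact ⟨t, hs (f t)⟩
  refine (Submodule.rank_mono h1).trans ((rank_span_le _).trans ?_)
  rw [← Nat.cast_card]
  exact_mod_cast Finite.card_range_le _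

end Standard

end BMW

/-! ### The subalgebra `Z_i` -/

namespace BMW

open Diagram

section Conjugators

variable {V : Type*} [Fintype V] (M : SimpleGraph V)

theorem hat_wordProd {ω : List V} (h : (cox M).IsReduced ω) :
    hat M ((cox M).wordProd ω) = (stdRep M).word ω :=
  prod_map_eq_of_isReduced M (g M) (fun k k' => (stdRep M).g_comm k k')
    (fun k k' => (stdRep M).g_braid k k') _ _ _ rfl (reducedWord_isReduced M _) h
    (wordProd_reducedWord M _)

variable {M}

/-- A minimal `v` cannot end in `i`, since `v r_i` is a conjugator too. So `v r_i = r_j v` has two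
reduced words, with equal products in `B`, and `semiconj_e` passes from `g` to `e`. -/
theorem hat_mul_e {i j : V} {v : W M} (h : IsConjugator M i j v) :
    hat M v * e M i = e M j * hat M v := by
  obtain ⟨ω, hω, rfl⟩ := (cox M).exists_isReduced v
  have h1 : (cox M).wordProd (ω ++ [i]) = (cox M).wordProd (j :: ω) := by
    rw [CoxeterSystem.wordProd_append, CoxeterSystem.wordProd_singleton,
      CoxeterSystem.wordProd_cons, ← h.1, inv_mul_cancel_right]
  have h2 : (cox M).length ((cox M).wordProd ω * (cox M).simple i) =
      (cox M).length ((cox M).wordProd ω) + 1 := by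
    refine ((cox M).length_mul_simple _ i).resolve_right fun h3 => ?_
    have h4 := h.2 ((cox M).wordProd ω * (cox M).simple i) (by
      rw [← h.1, mul_inv_rev, CoxeterSystem.inv_simple]
      simp only [mul_assoc, CoxeterSystem.simple_mul_simple_cancel_left])
    omega
  have hr : (cox M).IsReduced (ω ++ [i]) := by
    rw [CoxeterSystem.IsReduced, CoxeterSystem.wordProd_append, CoxeterSystem.wordProd_singleton,
      h2, hω.eq, List.length_append, List.length_singleton]
  have hr' : (cox M).IsReduced (j :: ω) := by
    rw [CoxeterSystem.IsReduced, ← h1, hr.eq, List.length_append, List.length_singleton,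
      List.length_cons]
  have h5 := hat_wordProd M hr
  rw [h1, hat_wordProd M hr', Rep.word_append, Rep.word_cons, Rep.word_cons, Rep.word_nil,
    mul_one] at h5
  rw [hat_wordProd M hω]
  exact (stdRep M).semiconj_e h5.symm

theorem isConjugator_one (i : V) : IsConjugator M i i 1 :=
  ⟨by simp, fun v _ => by simp⟩

theorem hat_one : hat M 1 = 1 := by
  have := hat_wordProd M (ω := []) (by simp [CoxeterSystem.IsReduced])
  simpa using this

variable {i : V}

/-- The generator with `j = k = i` is `g_i e_i = l⁻¹ e_i`. -/
theorem e_mem_Z : e M i ∈ Z M i := by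
  have h : hat M 1 * g M i * hat M 1 * e M i ∈ Z M i :=
    NonUnitalAlgebra.subset_adjoin _ ⟨i, i, 1, 1, M.loopless.irrefl i, isConjugator_one i,
      isConjugator_one i, rfl⟩
  rw [hat_one, one_mul, mul_one] at h
  have h1 := SMulMemClass.smul_mem Qlx.l h
  rwa [show g M i * e M i = Qlx.l⁻¹ • e M i from (stdRep M).g_mul_e i, smul_smul,
    mul_inv_cancel₀ Qlx.l_ne_zero, one_smul] at h1

theorem generator_eq {j k : V} {u v : W M} (h : ¬ M.Adj j k) (hu : IsConjugator M j i u)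
    (hv : IsConjugator M i j v) :
    hat M u * g M k * hat M v * e M i = e M i * (hat M u * g M k * hat M v) := by
  rw [mul_assoc _ (hat M v), hat_mul_e hv, ← mul_assoc, mul_assoc _ (g M k),
    ← show e M j * g M k = g M k * e M j from (stdRep M).e_g_comm h, ← mul_assoc (hat M u),
    hat_mul_e hu]
  simp only [mul_assoc]

theorem e_mul_Z {z : Alg M} (hz : z ∈ Z M i) :
    e M i * z = Qlx.x • z ∧ z * e M i = Qlx.x • z := by
  have hsq : e M i * e M i = Qlx.x • e M i := (stdRep M).e_sq i
  induction hz using NonUnitalAlgebra.adjoin_induction with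
  | mem z hz =>
    obtain ⟨j, k, u, v, h, hu, hv, rfl⟩ := hz
    constructor
    · rw [generator_eq h hu hv, ← mul_assoc, hsq, smul_mul_assoc]
    · rw [mul_assoc, hsq, mul_smul_comm]
  | add a b _ _ ha hb => rw [mul_add, add_mul, ha.1, ha.2, hb.1, hb.2, smul_add]; exact ⟨rfl, rfl⟩
  | zero => rw [mul_zero, zero_mul, smul_zero]; exact ⟨rfl, rfl⟩
  | mul a b _ _ ha hb =>
    rw [← mul_assoc, ha.1, mul_assoc, hb.2, smul_mul_assoc, mul_smul_comm]; exact ⟨rfl, rfl⟩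
  | smul c a _ ha =>
    rw [mul_smul_comm, smul_mul_assoc, ha.1, ha.2, smul_comm]; exact ⟨rfl, rfl⟩

end Conjugators

/-! ### Spanning sets and dimensions modulo `I₂` -/

section Quotient

variable {V : Type*} [Fintype V] {M : SimpleGraph V}

variable (M) in
/-- The generators of the quotient of the BMW algebra by `I₂`. -/
noncomputable def quotRep : Rep M (orthIdeal M).ringCon.Quotient := (stdRep M).map (quot M)

theorem quotRep_e (i : V) : (quotRep M).e i = quot M (e M i) := rfl

theorem quotRep_orth (i j : V) (h : i ≠ j) (h' : ¬ M.Adj i j) :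
    (quotRep M).e i * (quotRep M).e j = 0 := by
  rw [quotRep_e, quotRep_e, ← map_mul, quot_eq_zero]
  exact TwoSidedIdeal.subset_span ⟨i, j, h, h', rfl⟩

theorem adjoin_quotRep : Algebra.adjoin Qlx (Set.range (quotRep M).g) = ⊤ := by
  have h1 : Set.range (quotRep M).g = quot M '' Set.range (g M) := by
    rw [← Set.range_comp]; rfl
  rw [h1, ← AlgHom.map_adjoin, adjoin_g, Algebra.map_top, AlgHom.range_eq_top]
  exact quot_surjective M

variable (hM : FormPos M) (hconn : M.Connected) (hsph : IsSpherical M) {i : V} {β : V → ℤ}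
  (hβ : IsDominant M β)

include hM hconn in
-- `z` is `x⁻¹` times a generator of `Z_i`: the node word gives a minimal conjugator and its reverse
-- one in the other direction.
theorem z_mem_Z {j k : V} (h : ¬ M.Adj j k) : (stdRep M).z i j k ∈ Z M i := by
  have hv := isConjugator_nodeWord hM hconn i j
  have hu := hv.inv
  have hr := isReduced_nodeWord hM hconn i j
  have hgen : hat M ((cox M).wordProd (nodeWord M i j))⁻¹ * g M k *
      hat M ((cox M).wordProd (nodeWord M i j)) * e M i ∈ Z M i :=
    NonUnitalAlgebra.subset_adjoin _ ⟨j, k, _, _, h, hu, hv, rfl⟩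
  have hu' := hat_mul_e hu
  rw [← CoxeterSystem.wordProd_reverse, hat_wordProd M hr.reverse] at hgen hu'
  rw [hat_wordProd M hr] at hgen
  have hq : (stdRep M).q i j = (stdRep M).word (nodeWord M i j).reverse * (stdRep M).e j :=
    hu'.symm
  have hz : (stdRep M).z i j k = Qlx.x⁻¹ • ((stdRep M).word (nodeWord M i j).reverse * g M k *
      (stdRep M).word (nodeWord M i j) * e M i) := by
    rw [Rep.z, hq, mul_assoc, ← mul_assoc ((stdRep M).e j), (stdRep M).e_g_comm h, mul_assoc,
      (stdRep M).e_mul_p hconn, mul_smul_comm, mul_smul_comm, smul_smul,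
      mul_assoc Qlx.x⁻¹, inv_mul_cancel₀ Qlx.x_ne_zero, mul_one, Rep.p]
    simp only [mul_assoc]
    rfl
  rw [hz]
  exact SMulMemClass.smul_mem _ hgen

include hM hconn hsph hβ in
theorem quot_mem_heckeSpan {y : Alg M} (h : e M i * y = Qlx.x • y) (h' : y * e M i = Qlx.x • y) :
    quot M y ∈ (quotRep M).heckeSpan i β :=
  (quotRep M).mem_heckeSpan_of_e_mul hM hconn hsph quotRep_orth hβ adjoin_quotRep
    (by rw [quotRep_e, ← map_mul, h, map_smul]) (by rw [quotRep_e, ← map_mul, h', map_smul])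

include hM hconn hβ in
theorem exists_quot_eq_hecke (k : V) : ∃ z ∈ Z M i, quot M z = (quotRep M).hecke i β k := by
  by_cases hk : coroot M k β = 0
  · obtain ⟨a, b, -, hab, hz⟩ := ((quotRep M).hecke_spec hM i hβ.1 hk).exists_eq_z
    exact ⟨_, z_mem_Z hM hconn hab, by rw [hz, quotRep, Rep.map_z]⟩
  · exact ⟨0, zero_mem _, by rw [(quotRep M).hecke_eq_zero i hk, map_zero]⟩

include hM hconn hsph hβ in
-- Elements of `Z_i` absorb `e_i` on both sides up to `x`, hence land in the span. Conversely each
-- nonzero Hecke generator is the image of a `z` in `Z_i`, and `e_i` lies in `Z_i`.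
theorem map_quot_Z :
    (Z M i).toSubmodule.map (quot M).toLinearMap = (quotRep M).heckeSpan i β := by
  refine le_antisymm ?_ (Submodule.span_le.mpr ?_)
  · rintro _ ⟨z, hz, rfl⟩
    have := e_mul_Z hz
    exact quot_mem_heckeSpan hM hconn hsph hβ this.1 this.2
  · rintro _ ⟨w, rfl⟩
    show ((reducedWord M w.1).map ((quotRep M).hecke i β)).prod * (quotRep M).e i ∈ _
    generalize reducedWord M w.1 = ω
    induction ω with
    | nil => exact ⟨e M i, e_mem_Z, by simp [quotRep_e]⟩
    | cons k ω ih =>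
      obtain ⟨z, hz, h⟩ := exists_quot_eq_hecke (i := i) hM hconn hβ k
      obtain ⟨z', hz', h'⟩ := ih
      refine ⟨z * z', (Z M i).mul_mem hz hz', ?_⟩
      rw [List.map_cons, List.prod_cons, mul_assoc, ← h', ← h]
      exact map_mul (quot M) z z'

include hM hconn hsph hβ in
theorem exists_quot_mul_e (a : Alg M) :
    ∃ s ∈ Submodule.span Qlx {y : Alg M | ∃ γ, IsPosRoot M γ ∧ ∃ z ∈ Z M i,
      y = (stdRep M).word (rootWord M i γ) * z}, quot M s = quot M (a * e M i) := by
  have h := (quotRep M).mul_e_mem_filtTop hM hconn hsph quotRep_orth hβ adjoin_quotRep (quot M a)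
    (i := i)
  rw [quotRep_e, ← map_mul] at h
  refine (Submodule.span_le (p := Submodule.map (quot M).toLinearMap (Submodule.span Qlx
    {y : Alg M | ∃ γ, IsPosRoot M γ ∧ ∃ z ∈ Z M i,
      y = (stdRep M).word (rootWord M i γ) * z}))).mpr ?_ h
  rintro _ ⟨γ, hγ, c, hc, rfl⟩
  rw [← map_quot_Z hM hconn hsph hβ] at hc
  obtain ⟨z, hz, rfl⟩ := hc
  refine ⟨Qlx.x • ((stdRep M).word (rootWord M i γ) * z),
    Submodule.smul_mem _ _ (Submodule.subset_span ⟨γ, hγ, z, hz, rfl⟩), ?_⟩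
  rw [Rep.b, quotRep, Rep.map_word, mul_assoc]
  show quot M _ = quot M _ * (quot M (e M i) * quot M z)
  rw [← map_mul, ← map_mul, (e_mul_Z hz).1, mul_smul_comm]

include hconn in
-- `p q = x e_j` has `e_i` in its middle, so a single `e_i` generates `I₁`.
theorem exists_e_eq (i j : V) : ∃ a b, e M j = a * e M i * b := by
  refine ⟨(stdRep M).word (nodeWord M i j), (stdRep M).word (nodeWord M i j).reverse, ?_⟩
  apply smul_right_injective (Alg M) Qlx.x_ne_zero
  have h := (stdRep M).p_mul_q hconn i j
  rw [Rep.p, Rep.q, mul_assoc, ← mul_assoc ((stdRep M).e i), (stdRep M).e_sq, smul_mul_assoc,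
    mul_smul_comm, ← mul_assoc] at h
  exact h.symm

include hM hconn hsph hβ in
-- `x a e_i b = (a e_i)(e_i b)`, and `e_i b` comes from the left ideal of `e_i` by the
-- anti-involution. Whether `Z_i` is stable under the anti-involution does not matter: the middle
-- factor absorbs `e_i` on both sides, which puts it into the Hecke span.
theorem map_quot_idealOne_le : (idealOne M).map (quot M).toLinearMap ≤
    Submodule.span Qlx {y | ∃ γ γ', IsPosRoot M γ ∧ IsPosRoot M γ' ∧
      ∃ c ∈ (quotRep M).heckeSpan i β, y = quot M ((stdRep M).word (rootWord M i γ)) * c *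
        quot M (op M ((stdRep M).word (rootWord M i γ')))} := by
  set T := Submodule.span Qlx {y | ∃ γ γ', IsPosRoot M γ ∧ IsPosRoot M γ' ∧
      ∃ c ∈ (quotRep M).heckeSpan i β, y = quot M ((stdRep M).word (rootWord M i γ)) * c *
        quot M (op M ((stdRep M).word (rootWord M i γ')))}
  have hS : ∀ s s', s ∈ Submodule.span Qlx {y : Alg M | ∃ γ, IsPosRoot M γ ∧ ∃ z ∈ Z M i,
      y = (stdRep M).word (rootWord M i γ) * z} →
      s' ∈ Submodule.span Qlx {y : Alg M | ∃ γ, IsPosRoot M γ ∧ ∃ z ∈ Z M i,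
      y = (stdRep M).word (rootWord M i γ) * z} → quot M (s * op M s') ∈ T := by
    intro s s' hs hs'
    have h1 := Submodule.mul_mem_mul hs (Submodule.mem_map_of_mem (f := opLin M) hs')
    rw [Submodule.map_span, Submodule.span_mul_span] at h1
    refine (Submodule.span_le (p := T.comap (quot M).toLinearMap)).mpr ?_ h1
    rintro _ ⟨_, ⟨γ, hγ, z, hz, rfl⟩, _, ⟨_, ⟨γ', hγ', z', hz', rfl⟩, rfl⟩, rfl⟩
    refine Submodule.subset_span ⟨γ, γ', hγ, hγ', quot M (z * op M z'),
      quot_mem_heckeSpan hM hconn hsph hβ ?_ ?_, ?_⟩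
    · rw [← mul_assoc, (e_mul_Z hz).1, smul_mul_assoc]
    · have h2 := congrArg (op M) (e_mul_Z hz').1
      rw [op_mul, op_e, op_smul] at h2
      rw [mul_assoc, h2, mul_smul_comm]
    · rw [← map_mul, ← map_mul]
      show quot M (_ * op M _) = _
      rw [op_mul]
      simp only [mul_assoc]
  have hab : ∀ a b, quot M (a * e M i * b) ∈ T := by
    intro a b
    obtain ⟨s, hs, h1⟩ := exists_quot_mul_e hM hconn hsph hβ (i := i) a
    obtain ⟨s', hs', h2⟩ := exists_quot_mul_e hM hconn hsph hβ (i := i) (op M b)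
    have h3 : quot M (op M s') = quot M (e M i * b) := by
      rw [← sub_eq_zero, ← map_sub, quot_eq_zero] at h2 ⊢
      have h4 := op_mem_orthIdeal M h2
      rwa [← opLin_apply, map_sub, opLin_apply, opLin_apply, op_mul, op_op, op_e] at h4
    have h5 := hS s s' hs hs'
    rw [map_mul, h1, h3, ← map_mul, mul_assoc, ← mul_assoc (e M i),
      show e M i * e M i = Qlx.x • e M i from (stdRep M).e_sq i, smul_mul_assoc, mul_smul_comm,
      map_smul, ← mul_assoc] at h5
    exact (Submodule.smul_mem_iff _ Qlx.x_ne_zero).mp h5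
  rintro _ ⟨a, ha, rfl⟩
  have ha' : a ∈ TwoSidedIdeal.span (Set.range (e M)) := ha
  rw [TwoSidedIdeal.mem_span_iff_mem_addSubgroup_closure] at ha'
  show quot M a ∈ T
  clear ha
  induction ha' using AddSubgroup.closure_induction with
  | mem a ha =>
    obtain ⟨_, ⟨a, -, _, ⟨j, rfl⟩, rfl⟩, b, -, rfl⟩ := ha
    obtain ⟨a', b', h⟩ := exists_e_eq hconn i j
    show quot M (a * e M j * b) ∈ T
    rw [h]
    simpa only [mul_assoc] using hab (a * a') (b' * b)
  | zero => rw [map_zero]; exact zero_mem _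
  | add a a' _ _ h h' => rw [map_add]; exact add_mem h h'
  | neg a _ h => rw [map_neg]; exact neg_mem h

theorem spanningSet_subset_idealOne : spanningSet M i ⊆ idealOne M := by
  rintro _ ⟨u, -, z, hz, v, -, rfl⟩
  show _ ∈ TwoSidedIdeal.span (Set.range (e M))
  have h : z = e M i * (Qlx.x⁻¹ • z) := by
    rw [mul_smul_comm, (e_mul_Z hz).1, smul_smul, inv_mul_cancel₀ Qlx.x_ne_zero, one_smul]
  rw [h]
  exact TwoSidedIdeal.mul_mem_right _ _ _ (TwoSidedIdeal.mul_mem_left _ _ _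
    (TwoSidedIdeal.mul_mem_right _ _ _ (TwoSidedIdeal.subset_span ⟨i, rfl⟩)))

include hM hconn hsph hβ in
theorem span_spanningSet :
    Submodule.span Qlx (modTwo M '' spanningSet M i) = oneModTwo M := by
  rw [← Submodule.map_span, oneModTwo]
  refine le_antisymm (Submodule.map_mono (Submodule.span_le.mpr spanningSet_subset_idealOne))
    (map_modTwo_le M ((map_quot_idealOne_le hM hconn hsph hβ (i := i)).trans ?_))
  rw [Submodule.map_span]
  refine Submodule.span_mono ?_
  rintro _ ⟨γ, γ', hγ, hγ', c, hc, rfl⟩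
  rw [← map_quot_Z hM hconn hsph hβ] at hc
  obtain ⟨z, hz, rfl⟩ := hc
  refine ⟨_, ⟨_, rootWord_mem_D hM hconn i hγ, z, hz, _, rootWord_mem_D hM hconn i hγ', rfl⟩, ?_⟩
  rw [hat_wordProd M (isReduced_rootWord hM hconn i hγ),
    hat_wordProd M (isReduced_rootWord hM hconn i hγ')]
  show quot M _ = quot M _ * quot M z * quot M _
  rw [map_mul, map_mul]

include hM hconn hsph hβ in
theorem rank_Z_le : Module.rank Qlx ((Z M i).toSubmodule.map (modTwo M)) ≤
    (Nat.card (parabolic M (nodesC M)) : Cardinal) := by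
  have : Finite (W M) := hsph
  exact rank_map_modTwo_le M _ (map_quot_Z hM hconn hsph hβ).le

include hM hconn hsph hβ i in
theorem rank_oneModTwo_le : Module.rank Qlx (oneModTwo M) ≤
    ((Nat.card (posRoots M) ^ 2 * Nat.card (parabolic M (nodesC M)) : ℕ) : Cardinal) := by
  have : Finite (W M) := hsph
  have : Finite (posRoots M) := ((finite_roots hsph).subset fun _ h => h.1).to_subtype
  have h := rank_map_modTwo_le M (N := idealOne M)
    (fun t : (posRoots M × posRoots M) × parabolic M (nodesC M) =>
      quot M ((stdRep M).word (rootWord M i t.1.1.1)) *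
        (Rep.reducedProd ((quotRep M).hecke i β) t.2.1 * (quotRep M).e i) *
        quot M (op M ((stdRep M).word (rootWord M i t.1.2.1))))
    ((map_quot_idealOne_le hM hconn hsph hβ (i := i)).trans (Submodule.span_le.mpr ?_))
  · rwa [Nat.card_prod, Nat.card_prod, ← pow_two] at h
  · rintro _ ⟨γ, γ', hγ, hγ', c, hc, rfl⟩
    refine Submodule.span_induction (p := fun c _ => _ * c * _ ∈ Submodule.span Qlx _)
      ?_ ?_ ?_ ?_ hc
    · rintro _ ⟨w, rfl⟩
      exact Submodule.subset_span
        ⟨((⟨γ, (mem_posRoots_iff hM).mpr hγ⟩, ⟨γ', (mem_posRoots_iff hM).mpr hγ'⟩), w), rfl⟩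
    · rw [mul_zero, zero_mul]; exact zero_mem _
    · intro y y' _ _ h h'; rw [mul_add, add_mul]; exact add_mem h h'
    · intro c y _ h; rw [mul_smul_comm, smul_mul_assoc]; exact Submodule.smul_mem _ c h

end Quotient

end BMW

theorem mainTheorem4 {V : Type*} [Fintype V] (M : SimpleGraph V)
    (hconn : M.Connected) (hsph : Diagram.IsSpherical M) (i : V) :
    Submodule.span Qlx (BMW.modTwo M '' BMW.spanningSet M i) = BMW.oneModTwo M ∧
    Module.rank Qlx ((BMW.Z M i).toSubmodule.map (BMW.modTwo M)) ≤
      (Nat.card (Diagram.parabolic M (Diagram.nodesC M)) : Cardinal) ∧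
    Module.rank Qlx (BMW.oneModTwo M) ≤
      ((Nat.card (Diagram.posRoots M) ^ 2 *
        Nat.card (Diagram.parabolic M (Diagram.nodesC M)) : ℕ) : Cardinal) := by
  have hM : Diagram.FormPos M := fun v hv => Diagram.form_pos hconn hsph hv
  -- This dominant `β` is the highest root, so its orthogonal nodes form `C`.
  obtain ⟨β, -, hβ⟩ := Diagram.exists_dominant_ge hM hsph (Diagram.isPosRoot_simpleRoot i)
  exact ⟨BMW.span_spanningSet hM hconn hsph hβ, BMW.rank_Z_le hM hconn hsph hβ,
    BMW.rank_oneModTwo_le hM hconn hsph (i := i) hβ⟩
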